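/- Let $\mathfrak g$ be a compact simple Lie algebra, i.e. a finite-dimensional simple real Lie algebra with an $\mathrm{ad}$-invariant (positive definite) inner product $\langle\cdot,\cdot\rangle$ (for instance the basic one). Let $\mathfrak t\subset\mathfrak g$ be a maximal abelian subalgebra, fix a system of positive roots, where $\alpha\in\mathfrak t^*\setminus\{0\}$ is a root if $[X,E]=i\alpha(X)E$ for all $X\in\mathfrak t$ and some $E\neq0$ in $\mathfrak g_{\mathbb C}$, and let $\rho_{\mathfrak g}\in\mathfrak t^*$ be half the sum of the positive roots. Let $\{X_i\}$ be an orthonormal basis of $\mathfrak g$. The quadratic Casimir operator of $\mathfrak g$ in a representation $\pi$ is $\Delta^{\mathfrak g}_\pi=-\frac12\sum_i\pi(X_i)^2$. Let $L\mathfrak g_{\mathbb C}=\mathfrak g_{\mathbb C}[z,z^{-1}]$, $z=e^{i\theta}$, with $\langle Xz^n,Yz^k\rangle=\delta_{n+k,0}\langle X,Y\rangle$, let $X_i^n=X_iz^n$, and let $\mathbb C\partial_\theta\oplus L\mathfrak g_{\mathbb C}\oplus\mathbb C I$ be the extended loop algebra, in which $I$ is central, $[\partial_\theta,\xi]=\partial_\theta\xi$,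 and $[\xi,\eta]=[\xi,\eta]_{L\mathfrak g}+\langle\xi,\partial_\theta\eta\rangle I$. A positive energy representation $r$ of it on a complex vector space $\mathcal H$ is one for which $\mathcal H=\bigoplus_{k\in\mathbb Z}\mathcal H(k)$, $\mathcal H(k)=\ker(r(\partial_\theta)-ik)$, and $\mathcal H(k)=0$ for all $k$ below some integer. A triple $(m,\mu,h)\in\mathbb R\oplus\mathfrak t^*\oplus\mathbb R$ is a weight of $\mathcal H$ if some nonzero vector is an eigenvector of $\partial_\theta$, $X\in\mathfrak t$, $I$ with eigenvalues $im$, $i\mu(X)$, $ih$; the positive affine roots are $(0,\alpha,0)$ for positive roots $\alpha$, and $(n,\alpha,0)$, $(n,0,0)$ for $n>0$ and arbitrary roots $\alpha$; a weight $\boldsymbol\lambda$ is a lowest weight if $\boldsymbol\lambda-\boldsymbol\alpha$ is not a weight for any positive affine root $\boldsymbol\alpha$. On triples put $(m_1,\mu_1,h_1)\cdot(m_2,\mu_2,h_2)=\langle\mu_1,\mu_2\rangle-m_1h_2-m_2h_1$ and $\|x\|^2=x\cdot x$. Let $L\mathfrak g_{\mathbb C}^{\pm}$ be the span of the $Xz^n$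 with $\pm n>0$, let $\mathbb S_{\mathfrak g}$ be an irreducible complex module over the Clifford algebra of $\mathfrak g$ (with $XY+YX=2\langle X,Y\rangle$), and let $\mathcal S_{L\mathfrak g}=\mathbb S_{\mathfrak g}\otimes\Lambda^*(L\mathfrak g_{\mathbb C}^+)$ be the spin representation of $\mathrm{Cl}(L\mathfrak g_{\mathbb C})$, on which positive energy loops act by exterior multiplication, negative energy loops $\eta$ by $2\iota_\eta$ (with $\iota_\eta\xi=\langle\eta,\xi\rangle$), and constant loops by Clifford multiplication on $\mathbb S_{\mathfrak g}$ times the parity operator of $\Lambda^*$. Let $n:\mathrm{Cl}(L\mathfrak g_{\mathbb C})\to\Lambda^*(L\mathfrak g_{\mathbb C})$ be the normal ordering isomorphism, determined by $n(xy)=\mathrm{ch}(x)\wedge\mathrm{ch}(y)$ for $x\in\mathrm{Cl}(\mathfrak g_{\mathbb C}\oplus L\mathfrak g_{\mathbb C}^+)$ and $y\in\mathrm{Cl}(L\mathfrak g_{\mathbb C}^-)$, where $\mathrm{ch}$ is the Chevalley identification (the linear isomorphism from the Clifford algebra to the exterior algebra given by antisymmetrization). An $\mathrm{End}(\mathcal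 H)$-valued $k$-form $\omega$ on $L\mathfrak g_{\mathbb C}$ is identified with the operator $$\sum_{(i_1,n_1),\dots,(i_k,n_k)}\omega\bigl(X_{i_1}^{n_1},\dots,X_{i_k}^{n_k}\bigr)\otimes n^{-1}\bigl(X_{i_1}^{-n_1}\wedge\dots\wedge X_{i_k}^{-n_k}\bigr)$$ on $\mathcal H\otimes\mathcal S_{L\mathfrak g}$, provided that on each vector only finitely many terms are nonzero. In particular the $1$-form $\hat r(\xi)=r(\xi)$ is an operator. **Theorem.** Let $r$ be an irreducible positive energy representation on $\mathcal H$ with lowest weight $\boldsymbol\lambda=(m,-\lambda,h)$. Then: 1. The Casimir operator of $\mathfrak g$ acts on the adjoint representation as a real scalar $c_{\mathfrak g}$. 2. The operator $\hat r^2$ is a sum $(\hat r^2)_0+(\hat r^2)_2$ of forms of degrees $0$ and $2$, and $(\hat r^2)_0\in\mathrm{End}(\mathcal H)$ is uniquely determined by this. The operator $\Delta_r^{L\mathfrak g}:=-\frac12(\hat r^2)_0$ on $\mathcal H$ is called the Casimir operator of the loop algebra. 3. If $V_\lambda$ is an irreducible representation of $\mathfrak g_{\mathbb C}$ with highest weight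 $\lambda$, then its Casimir operator is a real scalar $\Delta^{\mathfrak g}_\lambda$, and $$\Delta_r^{L\mathfrak g}=-i(h+c_{\mathfrak g})\bigl(r(\partial_\theta)-im\bigr)+\Delta^{\mathfrak g}_\lambda .$$ 4. With $\boldsymbol\rho_{\mathfrak g}=(0,\rho_{\mathfrak g},-c_{\mathfrak g})$, $$\Delta_r^{L\mathfrak g}=-i(h+c_{\mathfrak g})\,r(\partial_\theta)+\tfrac12\bigl(\|\boldsymbol\lambda-\boldsymbol\rho_{\mathfrak g}\|^2-\|\boldsymbol\rho_{\mathfrak g}\|^2\bigr).$$ -/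

import Mathlib

open scoped TensorProduct

namespace LoopCasimir

universe u

/-! ### The compact Lie algebra, its complexification, and the loop algebra -/

/-- An `ad`-invariant (positive definite) inner product on a real Lie algebra. -/
structure InvariantInnerProduct (g : Type u) [LieRing g] [LieAlgebra ℝ g] where
  form : LinearMap.BilinForm ℝ g
  symm : ∀ X Y, form X Y = form Y X
  pos : ∀ X, X ≠ 0 → 0 < form X X
  invariant : ∀ X Y Z, form ⁅X, Y⁆ Z = form X ⁅Y, Z⁆

/-- The complexification `g_ℂ = ℂ ⊗ g`. -/
def Complexified (g : Type u) [LieRing g] [LieAlgebra ℝ g] : Type u := ℂ ⊗[ℝ] g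

/-- The complexified loop algebra `Lg_ℂ = g_ℂ[z, z⁻¹]` of loops with finite Fourier expansion. -/
def Loop (g : Type u) [LieRing g] [LieAlgebra ℝ g] : Type u :=
  LieAlgebra.loopAlgebra ℂ ℤ (ℂ ⊗[ℝ] g)

noncomputable section

section Instances

variable (g : Type u) [LieRing g] [LieAlgebra ℝ g]

instance : LieRing (Complexified g) := inferInstanceAs (LieRing (ℂ ⊗[ℝ] g))

instance : LieAlgebra ℂ (Complexified g) := inferInstanceAs (LieAlgebra ℂ (ℂ ⊗[ℝ] g))

instance : LieRing (Loop g) := inferInstanceAs (LieRing (LieAlgebra.loopAlgebra ℂ ℤ (ℂ ⊗[ℝ] g)))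

instance : LieAlgebra ℂ (Loop g) :=
  inferInstanceAs (LieAlgebra ℂ (LieAlgebra.loopAlgebra ℂ ℤ (ℂ ⊗[ℝ] g)))

end Instances

variable {g : Type u} [LieRing g] [LieAlgebra ℝ g]

/-- The pure tensor `a ⊗ X`, that is `a X`, in `g_ℂ`. -/
def ctmul (a : ℂ) (X : g) : Complexified g := (a ⊗ₜ[ℝ] X : ℂ ⊗[ℝ] g)

/-- The inclusion of `g` in `g_ℂ`. -/
def toC (X : g) : Complexified g := ctmul 1 X

theorem ctmul_lie (a b : ℂ) (X Y : g) : ⁅ctmul a X, ctmul b Y⁆ = ctmul (a * b) ⁅X, Y⁆ :=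
  LieAlgebra.ExtendScalars.bracket_tmul ℝ ℂ g g a b X Y

theorem complexified_induction {p : Complexified g → Prop} (Z : Complexified g) (zero : p 0)
    (add : ∀ Z W, p Z → p W → p (Z + W)) (tmul : ∀ a X, p (ctmul a X)) : p Z :=
  TensorProduct.induction_on (motive := p) Z zero tmul add

/-- The loop `X z^n`. -/
def mono (n : ℤ) (X : Complexified g) : Loop g :=
  (AddMonoidAlgebra.single n 1 ⊗ₜ[ℂ] X : LieAlgebra.loopAlgebra ℂ ℤ (ℂ ⊗[ℝ] g))

/-- A loop as its finitely supported family of Fourier coefficients. -/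
def coeffs : Loop g ≃ₗ[ℂ] (ℤ →₀ Complexified g) :=
  LieAlgebra.LoopAlgebra.toFinsupp ℂ ℤ (ℂ ⊗[ℝ] g)

/-- The `n`-th Fourier coefficient of a loop. -/
def coeff (n : ℤ) : Loop g →ₗ[ℂ] Complexified g := Finsupp.lapply n ∘ₗ coeffs.toLinearMap

/-- The derivative `∂_θ`, with `∂_θ (X z^n) = i n X z^n` for `z = e^{iθ}`. -/
def dTheta : Loop g →ₗ[ℂ] Loop g :=
  coeffs.symm.toLinearMap ∘ₗ
    (Finsupp.lsum ℂ fun n : ℤ => (Complex.I * (n : ℂ)) • Finsupp.lsingle n) ∘ₗ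
      coeffs.toLinearMap

theorem coeffs_mono (n : ℤ) (X : Complexified g) : coeffs (mono n X) = Finsupp.single n X := by
  exact LieAlgebra.LoopAlgebra.toFinsupp_single_tmul ℂ ℤ (ℂ ⊗[ℝ] g) n X

theorem dTheta_mono (n : ℤ) (X : Complexified g) :
    dTheta (mono n X) = (Complex.I * (n : ℂ)) • mono n X := by
  rw [dTheta, LinearMap.comp_apply, LinearMap.comp_apply, LinearEquiv.coe_coe,
    LinearEquiv.coe_coe, coeffs_mono, Finsupp.lsum_single, LinearMap.smul_apply,
    Finsupp.lsingle_apply, map_smul, ← coeffs_mono, LinearEquiv.symm_apply_apply]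

theorem mono_lie (n k : ℤ) (X Y : Complexified g) :
    ⁅mono n X, mono k Y⁆ = mono (n + k) ⁅X, Y⁆ := by
  have h : (AddMonoidAlgebra.single n (1 : ℂ) * AddMonoidAlgebra.single k 1 : AddMonoidAlgebra ℂ ℤ)
      = AddMonoidAlgebra.single (n + k) 1 := by
    rw [AddMonoidAlgebra.single_mul_single, one_mul]
  refine (LieAlgebra.ExtendScalars.bracket_tmul ℂ (AddMonoidAlgebra ℂ ℤ) (ℂ ⊗[ℝ] g) (ℂ ⊗[ℝ] g)
    (AddMonoidAlgebra.single n 1) (AddMonoidAlgebra.single k 1) X Y).trans ?_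
  rw [h]
  rfl

theorem loop_induction {p : Loop g → Prop} (ξ : Loop g) (zero : p 0)
    (add : ∀ ξ η, p ξ → p η → p (ξ + η)) (hmono : ∀ n X, p (mono n X)) : p ξ := by
  obtain ⟨f, rfl⟩ := coeffs.symm.surjective ξ
  induction f using Finsupp.induction_linear with
  | zero => simpa using zero
  | add f₁ f₂ h₁ h₂ => rw [map_add]; exact add _ _ h₁ h₂
  | single n X => rw [← coeffs_mono]; simpa using hmono n X

theorem dTheta_lie (ξ η : Loop g) : dTheta ⁅ξ, η⁆ = ⁅dTheta ξ, η⁆ + ⁅ξ, dTheta η⁆ := by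
  induction ξ using loop_induction with
  | zero => simp
  | add ξ₁ ξ₂ h₁ h₂ => simp only [add_lie, map_add, h₁, h₂]; abel
  | hmono n X =>
    induction η using loop_induction with
    | zero => simp
    | add ξ₁ ξ₂ h₁ h₂ => simp only [lie_add, map_add, h₁, h₂]; abel
    | hmono k Y =>
      rw [mono_lie, dTheta_mono, dTheta_mono, dTheta_mono, smul_lie, lie_smul, mono_lie, ← add_smul]
      push_cast; ring_nf

variable (K : InvariantInnerProduct g)

/-- The complex bilinear extension of the inner product to `g_ℂ`. -/
def formC : LinearMap.BilinForm ℂ (Complexified g) :=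
  (K.form.baseChange ℂ : LinearMap.BilinForm ℂ (ℂ ⊗[ℝ] g))

theorem formC_ctmul (a b : ℂ) (X Y : g) :
    formC K (ctmul a X) (ctmul b Y) = (K.form X Y : ℂ) * (a * b) :=
  (LinearMap.BilinForm.baseChange_tmul (A := ℂ) K.form a X b Y).trans Complex.real_smul

theorem formC_symm (X Y : Complexified g) : formC K X Y = formC K Y X :=
  (LinearMap.BilinForm.IsSymm.baseChange ℂ (B₂ := K.form) ⟨K.symm⟩).eq X Y

theorem formC_invariant (X Y Z : Complexified g) : formC K ⁅X, Y⁆ Z = formC K X ⁅Y, Z⁆ := by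
  induction X using complexified_induction with
  | zero => simp
  | add X₁ X₂ h₁ h₂ => simp only [add_lie, map_add, LinearMap.add_apply, h₁, h₂]
  | tmul a x =>
    induction Y using complexified_induction with
    | zero => simp
    | add X₁ X₂ h₁ h₂ => simp only [add_lie, lie_add, map_add, LinearMap.add_apply, h₁, h₂]
    | tmul b y =>
      induction Z using complexified_induction with
      | zero => simp
      | add X₁ X₂ h₁ h₂ => simp only [lie_add, map_add, h₁, h₂]
      | tmul c z => rw [ctmul_lie, ctmul_lie, formC_ctmul, formC_ctmul, K.invariant, mul_assoc]

/-- The inner product of loops `⟨ξ, η⟩ = (1/2π) ∫ ⟨ξ(θ), η(θ)⟩ dθ`, extended bilinearly; in terms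
of Fourier coefficients it is `∑ₙ ⟨ξₙ, η₋ₙ⟩`. -/
def loopForm : LinearMap.BilinForm ℂ (Loop g) :=
  (Finsupp.lsum ℂ fun n : ℤ => (formC K).compl₂ (coeff (-n))) ∘ₗ coeffs.toLinearMap

theorem loopForm_mono_left (n : ℤ) (X : Complexified g) (η : Loop g) :
    loopForm K (mono n X) η = formC K X (coeff (-n) η) := by
  rw [loopForm, LinearMap.comp_apply, LinearEquiv.coe_coe, coeffs_mono, Finsupp.lsum_single,
    LinearMap.compl₂_apply]

theorem loopForm_mono (n k : ℤ) (X Y : Complexified g) :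
    loopForm K (mono n X) (mono k Y) = if n + k = 0 then formC K X Y else 0 := by
  rw [loopForm_mono_left, coeff, LinearMap.comp_apply, LinearEquiv.coe_coe, coeffs_mono,
    Finsupp.lapply_apply, Finsupp.single_apply]
  by_cases h : n + k = 0
  · rw [if_pos h, if_pos (by lia)]
  · rw [if_neg h, if_neg (by lia), map_zero]

theorem loopForm_symm (ξ η : Loop g) : loopForm K ξ η = loopForm K η ξ := by
  induction ξ using loop_induction with
  | zero => simp
  | add ξ₁ ξ₂ h₁ h₂ => simp only [map_add, LinearMap.add_apply, h₁, h₂]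
  | hmono n X =>
    induction η using loop_induction with
    | zero => simp
    | add ξ₁ ξ₂ h₁ h₂ => simp only [map_add, LinearMap.add_apply, h₁, h₂]
    | hmono k Y => rw [loopForm_mono, loopForm_mono, formC_symm, add_comm]

theorem loopForm_invariant (ξ η ζ : Loop g) : loopForm K ⁅ξ, η⁆ ζ = loopForm K ξ ⁅η, ζ⁆ := by
  induction ξ using loop_induction with
  | zero => simp
  | add ξ₁ ξ₂ h₁ h₂ => simp only [add_lie, map_add, LinearMap.add_apply, h₁, h₂]
  | hmono n X =>
    induction η using loop_induction with
    | zero => simp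
    | add ξ₁ ξ₂ h₁ h₂ => simp only [add_lie, lie_add, map_add, LinearMap.add_apply, h₁, h₂]
    | hmono k Y =>
      induction ζ using loop_induction with
      | zero => simp
      | add ξ₁ ξ₂ h₁ h₂ => simp only [lie_add, map_add, h₁, h₂]
      | hmono l Z => rw [mono_lie, mono_lie, loopForm_mono, loopForm_mono, formC_invariant,
          add_assoc]

theorem loopForm_dTheta (ξ η : Loop g) :
    loopForm K (dTheta ξ) η = - loopForm K ξ (dTheta η) := by
  induction ξ using loop_induction with
  | zero => simp
  | add ξ₁ ξ₂ h₁ h₂ => simp only [map_add, LinearMap.add_apply, h₁, h₂]; abel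
  | hmono n X =>
    induction η using loop_induction with
    | zero => simp
    | add ξ₁ ξ₂ h₁ h₂ => simp only [map_add, h₁, h₂]; abel
    | hmono k Y =>
      rw [dTheta_mono, dTheta_mono, map_smul, map_smul, LinearMap.smul_apply, loopForm_mono]
      by_cases h : n + k = 0
      · obtain rfl : k = -n := by lia
        simp
      · simp [h]

theorem loopForm_lie_dTheta (ξ η ζ : Loop g) : loopForm K ξ (dTheta ⁅η, ζ⁆) =
    loopForm K ⁅ξ, η⁆ (dTheta ζ) + loopForm K η (dTheta ⁅ξ, ζ⁆) := by
  have h1 := loopForm_dTheta K ξ ⁅η, ζ⁆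
  have h2 := loopForm_dTheta K η ⁅ξ, ζ⁆
  have h3 := loopForm_dTheta K ⁅ξ, η⁆ ζ
  rw [dTheta_lie, ← lie_skew ξ (dTheta η), map_add, map_neg, LinearMap.add_apply,
    LinearMap.neg_apply, loopForm_invariant, loopForm_invariant] at h3
  linear_combination h1 - h2 - h3

/-! ### The extended (affine) Lie algebra -/

/-- The complexification of `ℝ ∂_θ ⊕ Lg ⊕ ℝ I`, the semidirect sum of the infinitesimal rotation
with the central extension of the loop algebra; `(a, ξ, x)` stands for `a ∂_θ + ξ + x I`. -/
@[ext]
structure Extended (K : InvariantInnerProduct g) where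
  rot : ℂ
  loop : Loop g
  cen : ℂ

namespace Extended

variable {K}

/-- The underlying triple. -/
def toTriple : Extended K ≃ ℂ × Loop g × ℂ where
  toFun x := (x.rot, x.loop, x.cen)
  invFun x := ⟨x.1, x.2.1, x.2.2⟩
  left_inv _ := rfl
  right_inv _ := rfl

instance : AddCommGroup (Extended K) := toTriple.addCommGroup

instance : Module ℂ (Extended K) := toTriple.module ℂ

@[simp] theorem add_rot (x y : Extended K) : (x + y).rot = x.rot + y.rot := rfl
@[simp] theorem add_loop (x y : Extended K) : (x + y).loop = x.loop + y.loop := rfl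
@[simp] theorem add_cen (x y : Extended K) : (x + y).cen = x.cen + y.cen := rfl
@[simp] theorem zero_rot : (0 : Extended K).rot = 0 := rfl
@[simp] theorem zero_loop : (0 : Extended K).loop = 0 := rfl
@[simp] theorem zero_cen : (0 : Extended K).cen = 0 := rfl
@[simp] theorem smul_rot (a : ℂ) (x : Extended K) : (a • x).rot = a * x.rot := rfl
@[simp] theorem smul_loop (a : ℂ) (x : Extended K) : (a • x).loop = a • x.loop := rfl
@[simp] theorem smul_cen (a : ℂ) (x : Extended K) : (a • x).cen = a * x.cen := rfl

/-- `[a ∂_θ + ξ + x I, b ∂_θ + η + y I] = a ∂_θ η - b ∂_θ ξ + [ξ, η] + ⟨ξ, ∂_θ η⟩ I`. -/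
instance : Bracket (Extended K) (Extended K) where
  bracket x y := ⟨0, x.rot • dTheta y.loop - y.rot • dTheta x.loop + ⁅x.loop, y.loop⁆,
    loopForm K x.loop (dTheta y.loop)⟩

@[simp] theorem lie_rot (x y : Extended K) : (⁅x, y⁆ : Extended K).rot = 0 := rfl
@[simp] theorem lie_loop (x y : Extended K) : (⁅x, y⁆ : Extended K).loop =
    x.rot • dTheta y.loop - y.rot • dTheta x.loop + ⁅x.loop, y.loop⁆ := rfl
@[simp] theorem lie_cen (x y : Extended K) : (⁅x, y⁆ : Extended K).cen =
    loopForm K x.loop (dTheta y.loop) := rfl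

theorem loopForm_dTheta_self (ξ : Loop g) : loopForm K ξ (dTheta ξ) = 0 := by
  have h := loopForm_dTheta K ξ ξ
  rw [loopForm_symm] at h
  linear_combination h / 2

theorem cen_jacobi (a b c : ℂ) (ξ η ζ : Loop g) :
    loopForm K ξ (dTheta (b • dTheta ζ - c • dTheta η + ⁅η, ζ⁆)) =
      loopForm K (a • dTheta η - b • dTheta ξ + ⁅ξ, η⁆) (dTheta ζ) +
        loopForm K η (dTheta (a • dTheta ζ - c • dTheta ξ + ⁅ξ, ζ⁆)) := by
  have e1 := loopForm_dTheta K ξ (dTheta ζ)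
  have e2 := loopForm_dTheta K η (dTheta ζ)
  have e3 := loopForm_dTheta K ξ (dTheta η)
  have e4 := loopForm_dTheta K η (dTheta ξ)
  have e5 := loopForm_symm K (dTheta ξ) (dTheta η)
  have e6 := loopForm_lie_dTheta K ξ η ζ
  simp only [map_add, map_sub, map_smul, LinearMap.add_apply, LinearMap.sub_apply,
    LinearMap.smul_apply, smul_eq_mul]
  linear_combination e6 + b * e1 - a * e2 - c * e3 + c * e4 + c * e5

theorem loop_jacobi (a b c : ℂ) (ξ η ζ : Loop g) :
    a • dTheta (b • dTheta ζ - c • dTheta η + ⁅η, ζ⁆) - (0 : ℂ) • dTheta ξ +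
        ⁅ξ, b • dTheta ζ - c • dTheta η + ⁅η, ζ⁆⁆ =
      (0 : ℂ) • dTheta ζ - c • dTheta (a • dTheta η - b • dTheta ξ + ⁅ξ, η⁆) +
          ⁅a • dTheta η - b • dTheta ξ + ⁅ξ, η⁆, ζ⁆ +
        (b • dTheta (a • dTheta ζ - c • dTheta ξ + ⁅ξ, ζ⁆) - (0 : ℂ) • dTheta η +
          ⁅η, a • dTheta ζ - c • dTheta ξ + ⁅ξ, ζ⁆⁆) := by
  simp only [map_add, map_sub, map_smul, dTheta_lie, lie_add, lie_sub, add_lie, sub_lie,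
    smul_lie, lie_smul, leibniz_lie ξ η ζ]
  rw [← lie_skew ξ (dTheta η), ← lie_skew (dTheta ξ) η]
  module

instance : LieRing (Extended K) where
  add_lie x y z := by
    ext1
    · simp
    · simp only [lie_loop, add_loop, add_rot, map_add, add_smul, smul_add, add_lie]; abel
    · simp
  lie_add x y z := by
    ext1
    · simp
    · simp only [lie_loop, add_loop, add_rot, map_add, add_smul, smul_add, lie_add]; abel
    · simp
  lie_self x := by
    ext1
    · simp
    · simp
    · simp [loopForm_dTheta_self]
  leibniz_lie x y z := by
    ext1
    · simp
    · simp only [lie_loop, add_loop, lie_rot]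
      exact loop_jacobi x.rot y.rot z.rot x.loop y.loop z.loop
    · simp only [lie_loop, add_cen, lie_cen]
      exact cen_jacobi x.rot y.rot z.rot x.loop y.loop z.loop

instance : LieAlgebra ℂ (Extended K) where
  lie_smul a x y := by
    ext1
    · simp
    · simp only [lie_loop, smul_loop, smul_rot, map_smul, lie_smul, smul_add, smul_sub, smul_smul,
        mul_comm]
    · simp only [lie_cen, smul_loop, smul_cen, map_smul, smul_eq_mul]

end Extended

/-! ### The Clifford algebra of loops and the spin representation -/

/-- The quadratic form `X ↦ ⟨X, X⟩` on `g_ℂ`, so that `X Y + Y X = 2 ⟨X, Y⟩` in its Clifford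
algebra. -/
def formQ : QuadraticForm ℂ (Complexified g) := (formC K).toQuadraticMap

/-- The quadratic form `ξ ↦ ⟨ξ, ξ⟩` on `Lg_ℂ`, so that `ξ η + η ξ = 2 ⟨ξ, η⟩` in its Clifford
algebra. -/
def loopQ : QuadraticForm ℂ (Loop g) := (loopForm K).toQuadraticMap

variable (g) in
/-- The positive energy loops `Lg_ℂ⁺`: the coefficients of `z^n` vanish unless `n > 0`. -/
def positiveLoops : Submodule ℂ (Loop g) :=
  (Finsupp.supported (Complexified g) ℂ {n : ℤ | 0 < n}).comap coeffs.toLinearMap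

/-- The projection of `Lg_ℂ` onto `Lg_ℂ⁺`, dropping the coefficients of `z^n` for `n ≤ 0`. -/
def posPart : Loop g →ₗ[ℂ] positiveLoops g :=
  LinearMap.codRestrict (positiveLoops g)
    (coeffs.symm.toLinearMap ∘ₗ (Finsupp.supported (Complexified g) ℂ {n : ℤ | 0 < n}).subtype ∘ₗ
      Finsupp.restrictDom (Complexified g) ℂ {n : ℤ | 0 < n} ∘ₗ coeffs.toLinearMap)
    (fun ξ => by
      rw [positiveLoops, Submodule.mem_comap]
      simp only [LinearMap.comp_apply, LinearEquiv.coe_coe, LinearEquiv.apply_symm_apply]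
      exact Subtype.property _)

theorem posPart_mono (n : ℤ) (X : Complexified g) :
    (posPart (mono n X) : Loop g) = if 0 < n then mono n X else 0 := by
  have h : (posPart (mono n X) : Loop g) =
      coeffs.symm ((Finsupp.single n X).filter fun k : ℤ => k ∈ {n : ℤ | 0 < n}) := by
    rw [← coeffs_mono]; rfl
  rw [h]
  by_cases hn : 0 < n
  · rw [if_pos hn, Finsupp.filter_single_of_pos _ (show n ∈ {n : ℤ | 0 < n} from hn),
      ← coeffs_mono, LinearEquiv.symm_apply_apply]
  · rw [if_neg hn, Finsupp.filter_single_of_neg _ (show n ∉ {n : ℤ | 0 < n} from hn), map_zero]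

theorem coeff_mono (k n : ℤ) (X : Complexified g) :
    coeff k (mono n X) = if n = k then X else 0 := by
  rw [coeff, LinearMap.comp_apply, LinearEquiv.coe_coe, coeffs_mono, Finsupp.lapply_apply,
    Finsupp.single_apply]

theorem loopForm_split (ξ η : Loop g) : loopForm K ξ η =
    formC K (coeff 0 ξ) (coeff 0 η) + loopForm K ξ (posPart η) + loopForm K η (posPart ξ) := by
  induction ξ using loop_induction with
  | zero => simp
  | add ξ₁ ξ₂ h₁ h₂ =>
    simp only [map_add, LinearMap.add_apply, Submodule.coe_add, h₁, h₂]; ring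
  | hmono n X =>
    induction η using loop_induction with
    | zero => simp
    | add ξ₁ ξ₂ h₁ h₂ =>
      simp only [map_add, LinearMap.add_apply, Submodule.coe_add, h₁, h₂]; ring
    | hmono k Y =>
      rw [posPart_mono, posPart_mono, coeff_mono, coeff_mono, loopForm_mono]
      rcases lt_trichotomy n 0 with hn | rfl | hn
      · rw [if_neg hn.ne, if_neg (by lia : ¬ 0 < n)]
        by_cases hk : 0 < k
        · rw [if_pos hk, loopForm_mono]; simp
        · rw [if_neg hk, if_neg (by lia)]; simp
      · rcases eq_or_ne k 0 with rfl | hk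
        · simp
        · by_cases hk' : 0 < k
          · simp [hk, hk', loopForm_mono]
          · simp [hk, hk']
      · rw [if_neg hn.ne', if_pos hn, loopForm_mono]
        by_cases hk : 0 < k
        · rw [if_pos hk, loopForm_mono]; simp [show ¬ (n + k = 0) by lia, show ¬ (k + n = 0) by lia]
        · rw [if_neg hk, formC_symm, add_comm k n]; simp

/-- The spin representation `S_{Lg} = S_g ⊗ Λ*(Lg_ℂ⁺)` of the loop algebra, where `Sg` is the spin
representation of `Cl(g)`. -/
abbrev LoopSpin (g : Type u) [LieRing g] [LieAlgebra ℝ g] (Sg : Type*) [AddCommGroup Sg]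
    [Module ℂ Sg] :=
  Sg ⊗[ℂ] ExteriorAlgebra ℂ (positiveLoops g)

/-- Exterior multiplication by the positive energy part of a loop. -/
def extMul (ξ : Loop g) : Module.End ℂ (ExteriorAlgebra ℂ (positiveLoops g)) :=
  LinearMap.mulLeft ℂ (ExteriorAlgebra.ι ℂ (posPart ξ))

/-- Interior contraction on `Λ*(Lg_ℂ⁺)` by the linear form `⟨ξ, ·⟩` on `Lg_ℂ⁺`. It depends on the
negative energy part of `ξ` only. -/
def intMul (ξ : Loop g) : Module.End ℂ (ExteriorAlgebra ℂ (positiveLoops g)) :=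
  CliffordAlgebra.contractLeft (Q := (0 : QuadraticForm ℂ (positiveLoops g)))
    (loopForm K ξ ∘ₗ (positiveLoops g).subtype)

variable (g) in
/-- The parity operator `(-1)^F` on `Λ*(Lg_ℂ⁺)`. -/
def parity : Module.End ℂ (ExteriorAlgebra ℂ (positiveLoops g)) :=
  (CliffordAlgebra.involute (Q := (0 : QuadraticForm ℂ (positiveLoops g)))).toLinearMap

theorem extMul_sq (ξ : Loop g) : extMul ξ * extMul ξ = 0 := by
  refine LinearMap.ext fun x => ?_
  change ExteriorAlgebra.ι ℂ (posPart ξ) * (ExteriorAlgebra.ι ℂ (posPart ξ) * x) = 0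
  rw [← mul_assoc, ExteriorAlgebra.ι_sq_zero, zero_mul]

theorem intMul_sq (ξ : Loop g) : intMul K ξ * intMul K ξ = 0 := by
  refine LinearMap.ext fun x => ?_
  exact CliffordAlgebra.contractLeft_contractLeft _ x

theorem parity_sq : parity g * parity g = 1 := by
  refine LinearMap.ext fun x => ?_
  exact CliffordAlgebra.involute_involute x

theorem intMul_extMul (ξ η : Loop g) : intMul K ξ * extMul η =
    loopForm K ξ (posPart η) • 1 - extMul η * intMul K ξ := by
  refine LinearMap.ext fun x => ?_
  exact CliffordAlgebra.contractLeft_ι_mul _ (posPart η) x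

theorem parity_extMul (ξ : Loop g) : parity g * extMul ξ = - (extMul ξ * parity g) := by
  refine LinearMap.ext fun x => ?_
  refine (map_mul (CliffordAlgebra.involute (Q := (0 : QuadraticForm ℂ (positiveLoops g))))
    (CliffordAlgebra.ι 0 (posPart ξ)) x).trans ?_
  rw [CliffordAlgebra.involute_ι, neg_mul]
  rfl

theorem parity_intMul (ξ : Loop g) : parity g * intMul K ξ = - (intMul K ξ * parity g) := by
  refine LinearMap.ext fun x => ?_
  change CliffordAlgebra.involute (CliffordAlgebra.contractLeft _ x) =
    - CliffordAlgebra.contractLeft _ (CliffordAlgebra.involute x)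
  induction x using CliffordAlgebra.left_induction with
  | algebraMap r => simp
  | add x y hx hy => simp only [map_add, hx, hy, neg_add]
  | ι_mul x m hx =>
    simp only [map_mul, CliffordAlgebra.involute_ι, neg_mul, map_neg,
      CliffordAlgebra.contractLeft_ι_mul, map_sub, map_smul, hx, mul_neg, neg_neg]

section Spin

variable (Sg : Type*) [AddCommGroup Sg] [Module ℂ Sg] [Module (CliffordAlgebra (formQ K)) Sg]
  [IsScalarTower ℂ (CliffordAlgebra (formQ K)) Sg]

/-- The Clifford action of `X ∈ g_ℂ` on `S_g`. -/
def zeroModeAction (X : Complexified g) : Module.End ℂ Sg :=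
  Algebra.lsmul ℂ ℂ Sg (CliffordAlgebra.ι (formQ K) X)

theorem zeroModeAction_sq (X : Complexified g) :
    zeroModeAction K Sg X * zeroModeAction K Sg X = formC K X X • 1 := by
  rw [zeroModeAction, ← map_mul, CliffordAlgebra.ι_sq_scalar, AlgHom.commutes,
    Algebra.algebraMap_eq_smul_one]
  rfl

/-- The Clifford action of loops on `S_{Lg}`: positive energy loops act by exterior multiplication,
negative energy loops by contraction, and constant loops by their action on `S_g` times `(-1)^F`.
The contraction carries the factor `2` that is needed for `c(ξ)c(η) + c(η)c(ξ) = 2 ⟨ξ, η⟩`. -/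
def vectorAction : Loop g →ₗ[ℂ] Module.End ℂ (LoopSpin g Sg) where
  toFun ξ := TensorProduct.map 1 (extMul ξ) + (2 : ℂ) • TensorProduct.map 1 (intMul K ξ) +
    TensorProduct.map (zeroModeAction K Sg (coeff 0 ξ)) (parity g)
  map_add' ξ η := by
    have h1 : extMul (ξ + η) = extMul ξ + extMul η := by
      refine LinearMap.ext fun x => ?_
      simp [extMul, add_mul]
    have h2 : intMul K (ξ + η) = intMul K ξ + intMul K η := by
      simp only [intMul, map_add, LinearMap.add_comp]
    have h3 : zeroModeAction K Sg (coeff 0 (ξ + η)) =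
        zeroModeAction K Sg (coeff 0 ξ) + zeroModeAction K Sg (coeff 0 η) := by
      simp only [zeroModeAction, map_add]
    rw [h1, h2, h3, TensorProduct.map_add_right, TensorProduct.map_add_right,
      TensorProduct.map_add_left, smul_add]
    abel
  map_smul' a ξ := by
    have h1 : extMul (a • ξ) = a • extMul ξ := by
      refine LinearMap.ext fun x => ?_
      simp [extMul]
    have h2 : intMul K (a • ξ) = a • intMul K ξ := by
      simp only [intMul, map_smul, LinearMap.smul_comp]
    have h3 : zeroModeAction K Sg (coeff 0 (a • ξ)) = a • zeroModeAction K Sg (coeff 0 ξ) := by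
      simp only [zeroModeAction, map_smul]
    rw [h1, h2, h3, TensorProduct.map_smul_right, TensorProduct.map_smul_right,
      TensorProduct.map_smul_left, RingHom.id_apply, smul_add, smul_add, smul_comm a (2 : ℂ)]

theorem vectorAction_sq (ξ : Loop g) : vectorAction K Sg ξ * vectorAction K Sg ξ =
    algebraMap ℂ (Module.End ℂ (LoopSpin g Sg)) (loopQ K ξ) := by
  have hQ : loopQ K ξ = loopForm K ξ ξ := rfl
  rw [hQ, loopForm_split, Algebra.algebraMap_eq_smul_one]
  change (TensorProduct.map 1 (extMul ξ) + (2 : ℂ) • TensorProduct.map 1 (intMul K ξ) +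
    TensorProduct.map (zeroModeAction K Sg (coeff 0 ξ)) (parity g)) *
    (TensorProduct.map 1 (extMul ξ) + (2 : ℂ) • TensorProduct.map 1 (intMul K ξ) +
    TensorProduct.map (zeroModeAction K Sg (coeff 0 ξ)) (parity g)) = _
  simp only [add_mul, mul_add, smul_mul_assoc, mul_smul_comm, ← TensorProduct.map_mul, mul_one,
    one_mul, extMul_sq, intMul_sq, intMul_extMul, parity_extMul, parity_intMul, parity_sq,
    zeroModeAction_sq, TensorProduct.map_zero_right]
  have e2 : ∀ (A : Module.End ℂ Sg) (B : Module.End ℂ (ExteriorAlgebra ℂ (positiveLoops g))),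
      TensorProduct.map A (-B) = - TensorProduct.map A B := fun A B =>
    TensorProduct.ext' fun x y => by simp [TensorProduct.tmul_neg]
  have e1 : TensorProduct.map (1 : Module.End ℂ Sg) (loopForm K ξ (posPart ξ) •
      (1 : Module.End ℂ (ExteriorAlgebra ℂ (positiveLoops g))) - extMul ξ * intMul K ξ) =
      loopForm K ξ (posPart ξ) • 1 - TensorProduct.map 1 (extMul ξ * intMul K ξ) := by
    rw [sub_eq_add_neg, TensorProduct.map_add_right, TensorProduct.map_smul_right,
      TensorProduct.map_one, e2, ← sub_eq_add_neg]
  rw [e1, e2, e2, TensorProduct.map_smul_left, TensorProduct.map_one]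
  module

/-- The Clifford action `c : Cl(Lg_ℂ) → End(S_{Lg})`. -/
def cliffordAction : CliffordAlgebra (loopQ K) →ₐ[ℂ] Module.End ℂ (LoopSpin g Sg) :=
  CliffordAlgebra.lift (loopQ K) ⟨vectorAction K Sg, vectorAction_sq K Sg⟩

end Spin

/-! ### Normal ordering and operators defined by forms -/

/-- The contraction `⟨ξ₀, η₀⟩ + 2 ⟨ξ₋, η₊⟩` by which the normal ordered product of two loops
differs from their Clifford product. -/
def contraction : LinearMap.BilinForm ℂ (Loop g) :=
  (formC K).compl₁₂ (coeff 0) (coeff 0) +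
    (2 : ℂ) • (loopForm K).compl₂ ((positiveLoops g).subtype ∘ₗ posPart)

theorem contraction_toQuadraticMap :
    (-contraction K).toQuadraticMap = (0 : QuadraticForm ℂ (Loop g)) - loopQ K := by
  ext ξ
  have h : loopQ K ξ = loopForm K ξ ξ := rfl
  have h' := loopForm_split K ξ ξ
  simp only [contraction, LinearMap.BilinMap.toQuadraticMap_apply, LinearMap.neg_apply,
    LinearMap.add_apply, LinearMap.smul_apply, LinearMap.compl₁₂_apply, LinearMap.compl₂_apply,
    LinearMap.comp_apply, Submodule.subtype_apply, sub_apply,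
    zero_apply, smul_eq_mul, h]
  linear_combination h'

/-- The normal ordering map `n : Cl(Lg_ℂ) → Λ*(Lg_ℂ)`. It is the linear isomorphism with `n 1 = 1`
and `n (ξ · x) = ξ ∧ n x + ι n x`, where `ι` is contraction by `η ↦ ⟨ξ₀, η₀⟩ + 2 ⟨ξ₋, η₊⟩`. It
restricts to the Chevalley identification on the Clifford algebra of `g_ℂ ⊕ Lg_ℂ⁺` and on that of
`Lg_ℂ⁻`, and it sends a product `x · y` of elements of these two subalgebras, in this order, to
the wedge product of their images. -/
def normalOrdering : CliffordAlgebra (loopQ K) ≃ₗ[ℂ] ExteriorAlgebra ℂ (Loop g) :=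
  CliffordAlgebra.changeFormEquiv (contraction_toQuadraticMap K)

section Forms

variable (Sg : Type*) [AddCommGroup Sg] [Module ℂ Sg] [Module (CliffordAlgebra (formQ K)) Sg]
  [IsScalarTower ℂ (CliffordAlgebra (formQ K)) Sg]
  {ι : Type*} (b : ι → g) {H : Type*} [AddCommGroup H] [Module ℂ H]

/-- For an orthonormal basis `Xᵢ` of `g`, the basis `Xᵢ z^n` of `Lg_ℂ` has dual basis `Xᵢ z^{-n}`.
An `End H`-valued `k`-form `ω` has the expansion `∑ ω(Y₁, …, Y_k) Y₁* ∧ ⋯ ∧ Y_k*` over all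
`k`-tuples of elements `Yⱼ = X_{iⱼ} z^{nⱼ}` of this basis, where `(X_i z^n)*` is the element
`X_i z^{-n}` of the dual basis. This is the operator on `H ⊗ S_{Lg}` given by one of the terms:
`ω(Y₁, …, Y_k) ⊗ c(n⁻¹(Y₁* ∧ ⋯ ∧ Y_k*))`. -/
def formTerm {k : ℕ} (ω : Loop g [⋀^Fin k]→ₗ[ℂ] Module.End ℂ H) (a : Fin k → ι × ℤ) :
    Module.End ℂ (H ⊗[ℂ] LoopSpin g Sg) :=
  TensorProduct.map (ω fun j => mono (a j).2 (toC (b (a j).1)))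
    (cliffordAction K Sg ((normalOrdering K).symm
      (ExteriorAlgebra.ιMulti ℂ k fun j => mono (-(a j).2) (toC (b (a j).1)))))

/-- The form `ω` is (the normal ordered symbol of) the operator `A` on `H ⊗ S_{Lg}`: on every vector
only finitely many terms of the infinite sum that represents `ω` are nonzero, and they add up
to `A`. -/
def Represents {k : ℕ} (ω : Loop g [⋀^Fin k]→ₗ[ℂ] Module.End ℂ H)
    (A : Module.End ℂ (H ⊗[ℂ] LoopSpin g Sg)) : Prop :=
  ∀ v, {a : Fin k → ι × ℤ | formTerm K Sg b ω a v ≠ 0}.Finite ∧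
    A v = ∑ᶠ a : Fin k → ι × ℤ, formTerm K Sg b ω a v

end Forms

/-! ### Representations of the loop algebra and the Casimir operators -/

/-- The generator `∂_θ`. -/
def rotation : Extended K := ⟨1, 0, 0⟩

/-- The central generator `I`. -/
def central : Extended K := ⟨0, 0, 1⟩

/-- The inclusion of the loops (as a vector space) in the extended Lie algebra. -/
def ofLoop : Loop g →ₗ[ℂ] Extended K where
  toFun ξ := ⟨0, ξ, 0⟩
  map_add' ξ η := by ext1 <;> simp
  map_smul' a ξ := by ext1 <;> simp

section Representation

variable (H : Type*) [AddCommGroup H] [Module ℂ H] [LieRingModule (Extended K) H]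
  [LieModule ℂ (Extended K) H]

/-- The operator `r(∂_θ)`. -/
def energyOp : Module.End ℂ H := LieModule.toEnd ℂ (Extended K) H (rotation K)

/-- The map `ξ ↦ r(ξ)` on loops. -/
def loopAction : Loop g →ₗ[ℂ] Module.End ℂ H where
  toFun ξ := LieModule.toEnd ℂ (Extended K) H (ofLoop K ξ)
  map_add' ξ η := by simp only [map_add]
  map_smul' a ξ := by simp only [map_smul, RingHom.id_apply]

/-- The energy `k` subspace `H(k)`, on which `r(∂_θ) = i k`. -/
def energySpace (k : ℤ) : Submodule ℂ H :=
  (energyOp K H).eigenspace (Complex.I * (k : ℂ))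

/-- A positive energy representation: `H` is the sum of its constant energy subspaces, and
`H(k) = 0` for all `k` below some fixed integer. -/
def IsPositiveEnergy : Prop :=
  (⨆ k : ℤ, energySpace K H k) = ⊤ ∧ ∃ k₀ : ℤ, ∀ k < k₀, energySpace K H k = ⊥

/-- The tautological `End H`-valued 1-form `r̂(ξ) = r(ξ)` on the loop algebra. -/
def rHat : Loop g [⋀^Fin 1]→ₗ[ℂ] Module.End ℂ H :=
  AlternatingMap.ofSubsingleton ℂ (Loop g) (Module.End ℂ H) (0 : Fin 1) (loopAction K H)

variable {H} in
/-- `Δ = -½ (r̂²)₀`: the square of the operator `R` on `H ⊗ S_{Lg}` represented by the 1-form `r̂` is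
the sum of a 0-form, which is `-2 Δ`, and a 2-form. -/
def IsLoopCasimir (Sg : Type*) [AddCommGroup Sg] [Module ℂ Sg]
    [Module (CliffordAlgebra (formQ K)) Sg] [IsScalarTower ℂ (CliffordAlgebra (formQ K)) Sg]
    {ι : Type*} (b : ι → g) (Δ : Module.End ℂ H) : Prop :=
  ∃ (R A₀ A₂ : Module.End ℂ (H ⊗[ℂ] LoopSpin g Sg))
    (ω₀ : Loop g [⋀^Fin 0]→ₗ[ℂ] Module.End ℂ H) (ω₂ : Loop g [⋀^Fin 2]→ₗ[ℂ] Module.End ℂ H),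
    Represents K Sg b (rHat K H) R ∧ Represents K Sg b ω₀ A₀ ∧ Represents K Sg b ω₂ A₂ ∧
    R * R = A₀ + A₂ ∧ Δ = -(1 / 2 : ℂ) • ω₀ ![]

end Representation

/-- An orthonormal basis of `g`. -/
def InvariantInnerProduct.IsOrthonormal {ι : Type*} (b : Module.Basis ι ℝ g) : Prop :=
  ∀ i j, (i = j → K.form (b i) (b j) = 1) ∧ (i ≠ j → K.form (b i) (b j) = 0)

/-- The operator `-½ ∑ᵢ Xᵢ²`; for an orthonormal basis `Xᵢ` of `g` acting on a representation this is
the quadratic Casimir operator. -/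
def quadraticCasimir (𝕜 : Type*) [Field 𝕜] {A : Type*} [Ring A] [Algebra 𝕜 A] {ι : Type*}
    [Fintype ι] (X : ι → A) : A :=
  -(1 / 2 : 𝕜) • ∑ i, X i * X i

/-! ### Roots and weights -/

section Weights

variable (t : LieSubalgebra ℝ g)

/-- `t` is a maximal abelian subalgebra, i.e. the Lie algebra of a maximal torus. -/
def IsMaximalAbelian : Prop := Maximal (fun s : LieSubalgebra ℝ g => IsLieAbelian s) t

/-- `α ∈ t*` is a root: `α ≠ 0` and `[X, E] = i α(X) E` for all `X ∈ t`, for some nonzero `E`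
in `g_ℂ`. -/
def IsRoot (α : Module.Dual ℝ t) : Prop :=
  α ≠ 0 ∧ ∃ E : Complexified g, E ≠ 0 ∧ ∀ X : t, ⁅toC (X : g), E⁆ = (Complex.I * (α X : ℂ)) • E

/-- A system of positive roots. -/
structure IsPositiveSystem (P : Finset (Module.Dual ℝ t)) : Prop where
  root_iff : ∀ α, IsRoot t α ↔ α ∈ P ∨ -α ∈ P
  neg_notMem : ∀ α ∈ P, -α ∉ P
  add_mem : ∀ α ∈ P, ∀ β ∈ P, IsRoot t (α + β) → α + β ∈ P

/-- `ρ_g`, half the sum of the positive roots. -/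
def rho (P : Finset (Module.Dual ℝ t)) : Module.Dual ℝ t := (1 / 2 : ℝ) • ∑ α ∈ P, α

theorem restrict_nondegenerate : (K.form.restrict t.toSubmodule).Nondegenerate := by
  constructor
  · intro X hX
    by_contra h
    exact (K.pos X (fun h' => h (Subtype.ext h'))).ne' (hX X)
  · intro X hX
    by_contra h
    exact (K.pos X (fun h' => h (Subtype.ext h'))).ne' (hX X)

/-- The inner product on `t*` induced by the inner product on `t ⊆ g`. -/
def weightInner [FiniteDimensional ℝ g] (μ ν : Module.Dual ℝ t) : ℝ :=
  μ (((K.form.restrict t.toSubmodule).toDual (restrict_nondegenerate K t)).symm ν)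

/-- Weights `(m, μ, h)`, with energy `m`, `μ ∈ t*`, and level `h`. -/
abbrev AffineWeight : Type u := ℝ × Module.Dual ℝ t × ℝ

/-- The inner product `(m₁, μ₁, h₁) · (m₂, μ₂, h₂) = ⟨μ₁, μ₂⟩ - m₁ h₂ - m₂ h₁`. -/
def affineInner [FiniteDimensional ℝ g] (x y : AffineWeight t) : ℝ :=
  weightInner K t x.2.1 y.2.1 - x.1 * y.2.2 - y.1 * x.2.2

/-- The positive affine roots: `(0, α, 0)` for `α > 0`, and `(n, α, 0)` and `(n, 0, 0)` for `n > 0`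
and all roots `α`. -/
inductive IsPositiveAffineRoot (P : Finset (Module.Dual ℝ t)) : AffineWeight t → Prop
  | constant (α : Module.Dual ℝ t) (hα : α ∈ P) : IsPositiveAffineRoot P (0, α, 0)
  | real (n : ℕ) (hn : 0 < n) (α : Module.Dual ℝ t) (hα : IsRoot t α) :
      IsPositiveAffineRoot P ((n : ℝ), α, 0)
  | imaginary (n : ℕ) (hn : 0 < n) : IsPositiveAffineRoot P ((n : ℝ), 0, 0)

/-- `(m, μ, h)` is a weight of the representation `H` of the extended loop algebra: some nonzero
vector is an eigenvector of `∂_θ`, `X ∈ t` and `I` with eigenvalues `i m`, `i μ(X)` and `i h`. -/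
def IsAffineWeight (H : Type*) [AddCommGroup H] [Module ℂ H] [LieRingModule (Extended K) H]
    (x : AffineWeight t) : Prop :=
  ∃ v : H, v ≠ 0 ∧ ⁅rotation K, v⁆ = (Complex.I * (x.1 : ℂ)) • v ∧
    (∀ X : t, ⁅ofLoop K (mono 0 (toC (X : g))), v⁆ = (Complex.I * (x.2.1 X : ℂ)) • v) ∧
    ⁅central K, v⁆ = (Complex.I * (x.2.2 : ℂ)) • v

/-- `x` is a lowest weight of `H`: it is a weight, and `x - α` is not a weight for any positive
affine root `α`. -/
def IsLowestWeight (P : Finset (Module.Dual ℝ t)) (H : Type*) [AddCommGroup H] [Module ℂ H]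
    [LieRingModule (Extended K) H] (x : AffineWeight t) : Prop :=
  IsAffineWeight K t H x ∧ ∀ α, IsPositiveAffineRoot t P α → ¬ IsAffineWeight K t H (x - α)

/-- `μ` is a weight of the representation `V` of `g_ℂ`. -/
def IsWeight (V : Type*) [AddCommGroup V] [Module ℂ V] [LieRingModule (Complexified g) V]
    (μ : Module.Dual ℝ t) : Prop :=
  ∃ v : V, v ≠ 0 ∧ ∀ X : t, ⁅toC (X : g), v⁆ = (Complex.I * (μ X : ℂ)) • v

/-- `μ` is a highest weight of the representation `V` of `g_ℂ`: it is a weight, and `μ + α` is not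
a weight for any positive root `α`. -/
def IsHighestWeight (P : Finset (Module.Dual ℝ t)) (V : Type*) [AddCommGroup V] [Module ℂ V]
    [LieRingModule (Complexified g) V] (μ : Module.Dual ℝ t) : Prop :=
  IsWeight t V μ ∧ ∀ α ∈ P, ¬ IsWeight t V (μ + α)

end Weights

end

end LoopCasimir

/-! Write `R = ∑ r(Xᵢ zⁿ) ⊗ c(Xᵢ z⁻ⁿ)` for the operator of `r̂`. In `R²` each Clifford product of
two loops is its normal ordered product plus the scalar `contraction`. The normal ordered product is
antisymmetric, so its coefficient `r(ξ) r(η)` may be replaced by `½ [r(ξ), r(η)]`, which is a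
2-form. The scalars assemble into the Sugawara operator `Ω = ∑ᵢ r(Xᵢ)² + 2 ∑_{n>0} ∑ᵢ r(Xᵢ zⁿ) r(Xᵢ
z⁻ⁿ)` (`normalSquare`), so `Δ = -½ Ω` (`isLoopCasimir_normalSquare`). All sums are locally finite
because modes of sufficiently negative energy kill a given vector of `H` or of the spin module.

Uniqueness (`zero_form_eq_zero`): if a 0-form and a 2-form add up to zero, the vacuum component of
the spinors only sees the constant modes, where the problem lives in `Cl(g)`. The map `T ↦ ∑ₖ Xₖ T
Xₖ` multiplies degree 0 by `dim g` and degree 2 by `dim g - 4`; since the factors differ, both parts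
vanish.

The formula rests on `normalSquare_commutator`: `[Ω, r(X z^m)] = 2 i m r(X z^m) r(I) - 2 m c r(X
z^m)`. The first term comes from the cocycle. The second is what remains when the loop brackets
telescope over the modes: normal ordering leaves `m` copies of a commutator that evaluates to the
adjoint Casimir, hence the shift of `h` to `h + c`. Since `r(I) = i h`, the operator `-½ Ω + i (h +
c) r(∂_θ)` commutes with the whole representation. A lowest weight vector is an eigenvector of it,
and its eigenspace is a submodule, so by irreducibility it is a scalar.

The scalar is read off on the lowest weight vector. Negative modes kill it, so `Ω` reduces to `∑ᵢ
r(Xᵢ)²`, which `sum_sq_apply_extremal` evaluates by replacing the orthonormal basis with root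
vectors and dual bases of `t`. The same lemma, used with the opposite system of positive roots,
gives the Casimir of `V_λ`, so both produce `½ ⟨λ, λ + 2ρ⟩`. Completing the square gives the last
form of the theorem. -/

namespace LoopCasimir

noncomputable section

/-! ### Real structure, Hermitian form and Casimir tensor of `g_ℂ` -/

section Complexification

variable {g : Type*} [LieRing g] [LieAlgebra ℝ g]

theorem ctmul_add (a : ℂ) (X Y : g) : ctmul a (X + Y) = ctmul a X + ctmul a Y :=
  TensorProduct.tmul_add a X Y

theorem ctmul_real_smul (a : ℂ) (r : ℝ) (X : g) : ctmul a (r • X) = ctmul (r * a) X := by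
  rw [← Complex.real_smul]
  exact (TensorProduct.tmul_smul r a X).trans (TensorProduct.smul_tmul' r a X)

theorem smul_ctmul (a b : ℂ) (X : g) : a • ctmul b X = ctmul (a * b) X :=
  TensorProduct.smul_tmul' a b X

theorem ctmul_eq_smul (a : ℂ) (X : g) : ctmul a X = a • toC X := by
  rw [toC, smul_ctmul, mul_one]

@[simp] theorem toC_zero : toC (0 : g) = 0 := TensorProduct.tmul_zero g (1 : ℂ)

theorem toC_add (X Y : g) : toC (X + Y) = toC X + toC Y := ctmul_add 1 X Y

theorem toC_smul (r : ℝ) (X : g) : toC (r • X) = (r : ℂ) • toC X := by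
  rw [toC, toC, ctmul_real_smul, smul_ctmul]

theorem toC_lie (X Y : g) : toC ⁅X, Y⁆ = ⁅toC X, toC Y⁆ := by
  rw [toC, toC, toC, ctmul_lie, one_mul]

theorem formC_toC (K : InvariantInnerProduct g) (X Y : g) :
    formC K (toC X) (toC Y) = (K.form X Y : ℂ) := by
  rw [toC, toC, formC_ctmul, one_mul, mul_one]

/-- The real linear inclusion of `g` in `g_ℂ`. -/
def toCHom : g →+ Complexified g where
  toFun := toC
  map_zero' := toC_zero
  map_add' := toC_add

theorem toC_sum {ι : Type*} (s : Finset ι) (f : ι → g) :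
    toC (∑ i ∈ s, f i) = ∑ i ∈ s, toC (f i) := map_sum toCHom f s

instance [FiniteDimensional ℝ g] : FiniteDimensional ℂ (Complexified g) :=
  inferInstanceAs (FiniteDimensional ℂ (ℂ ⊗[ℝ] g))

theorem exists_eq_toC_add (Z : Complexified g) :
    ∃ A B : g, Z = toC A + Complex.I • toC B := by
  induction Z using complexified_induction with
  | zero => exact ⟨0, 0, by simp⟩
  | add Z W hZ hW =>
    obtain ⟨A, B, rfl⟩ := hZ
    obtain ⟨C, D, rfl⟩ := hW
    exact ⟨A + C, B + D, by rw [toC_add, toC_add]; module⟩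
  | tmul a X =>
    refine ⟨a.re • X, a.im • X, ?_⟩
    rw [ctmul_eq_smul, toC_smul, toC_smul]
    nth_rw 1 [← Complex.re_add_im a]
    module

/-- Complex conjugation of `g_ℂ` with respect to `g`. -/
def conj : Complexified g →+ Complexified g :=
  (LinearMap.rTensor g (Complex.conjAe.toLinearMap) : ℂ ⊗[ℝ] g →ₗ[ℝ] ℂ ⊗[ℝ] g).toAddMonoidHom

theorem conj_ctmul (a : ℂ) (X : g) : conj (ctmul a X) = ctmul (starRingEnd ℂ a) X :=
  LinearMap.rTensor_tmul g Complex.conjAe.toLinearMap X a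

theorem conj_toC (X : g) : conj (toC X) = toC X := by
  rw [toC, conj_ctmul, map_one]

theorem conj_smul (a : ℂ) (Z : Complexified g) : conj (a • Z) = starRingEnd ℂ a • conj Z := by
  induction Z using complexified_induction with
  | zero => simp
  | add Z W hZ hW => simp only [smul_add, map_add, hZ, hW]
  | tmul b X => rw [smul_ctmul, conj_ctmul, conj_ctmul, smul_ctmul, map_mul]

theorem conj_conj (Z : Complexified g) : conj (conj Z) = Z := by
  induction Z using complexified_induction with
  | zero => simp
  | add Z W hZ hW => simp only [map_add, hZ, hW]
  | tmul b X => rw [conj_ctmul, conj_ctmul, Complex.conj_conj]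

theorem conj_lie (Z W : Complexified g) : conj ⁅Z, W⁆ = ⁅conj Z, conj W⁆ := by
  induction Z using complexified_induction with
  | zero => simp
  | add Z Z' hZ hZ' => simp only [add_lie, map_add, hZ, hZ']
  | tmul a X =>
    induction W using complexified_induction with
    | zero => simp
    | add Z Z' hZ hZ' => simp only [lie_add, map_add, hZ, hZ']
    | tmul b Y => simp only [ctmul_lie, conj_ctmul, map_mul]

variable (K : InvariantInnerProduct g)

theorem formC_conj (Z W : Complexified g) :
    formC K (conj Z) (conj W) = starRingEnd ℂ (formC K Z W) := by
  induction Z using complexified_induction with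
  | zero => simp
  | add Z Z' hZ hZ' => simp only [map_add, LinearMap.add_apply, hZ, hZ']
  | tmul a X =>
    induction W using complexified_induction with
    | zero => simp
    | add Z Z' hZ hZ' => simp only [map_add, hZ, hZ']
    | tmul b Y => simp [conj_ctmul, formC_ctmul]

theorem formC_conj_self_toC_add (A B : g) :
    formC K (conj (toC A + Complex.I • toC B)) (toC A + Complex.I • toC B) =
      ((K.form A A + K.form B B : ℝ) : ℂ) := by
  simp only [map_add, conj_smul, conj_toC, Complex.conj_I, LinearMap.add_apply, map_smul,
    LinearMap.smul_apply, formC_toC, smul_eq_mul, K.symm B A]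
  push_cast
  linear_combination (-(K.form B B : ℂ)) * Complex.I_mul_I

/-- Positive definiteness of the Hermitian form: on `A + iB` it takes the value `⟨A, A⟩ + ⟨B, B⟩`.
The real value is named so that it can be substituted into complex identities. -/
theorem formC_conj_self_eq (Z : Complexified g) :
    ∃ r : ℝ, 0 ≤ r ∧ formC K (conj Z) Z = r ∧ (r = 0 → Z = 0) := by
  have hp : ∀ X, 0 ≤ K.form X X := fun X => by
    rcases eq_or_ne X 0 with rfl | h
    · simp
    · exact (K.pos X h).le
  have hz : ∀ X, K.form X X = 0 → X = 0 := fun X h => by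
    by_contra h'
    exact (K.pos X h').ne' h
  obtain ⟨A, B, rfl⟩ := exists_eq_toC_add Z
  refine ⟨_, add_nonneg (hp A) (hp B), formC_conj_self_toC_add K A B, fun h => ?_⟩
  rw [hz A (by linarith [hp A, hp B]), hz B (by linarith [hp A, hp B])]
  simp

theorem formC_lie_left (X Y Z : Complexified g) : formC K ⁅X, Y⁆ Z = - formC K Y ⁅X, Z⁆ := by
  rw [← lie_skew, map_neg, LinearMap.neg_apply, formC_invariant]

/-- The Hermitian inner product `⟨conj Z, W⟩` on `g_ℂ`. -/
@[reducible] def hermitianCore : InnerProductSpace.Core ℂ (Complexified g) where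
  inner Z W := formC K (conj Z) W
  conj_inner_symm Z W := by
    change starRingEnd ℂ (formC K (conj W) Z) = formC K (conj Z) W
    rw [← formC_conj, conj_conj, formC_symm]
  re_inner_nonneg Z := by
    change 0 ≤ (formC K (conj Z) Z).re
    obtain ⟨r, hr, h, -⟩ := formC_conj_self_eq K Z
    rw [h]
    exact hr
  add_left Z Z' W := by
    change formC K (conj (Z + Z')) W = formC K (conj Z) W + formC K (conj Z') W
    rw [map_add, map_add, LinearMap.add_apply]
  smul_left Z W a := by
    change formC K (conj (a • Z)) W = starRingEnd ℂ a * formC K (conj Z) W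
    rw [conj_smul, map_smul, LinearMap.smul_apply, smul_eq_mul]
  definite Z h := by
    change formC K (conj Z) Z = 0 at h
    obtain ⟨r, -, hr, h0⟩ := formC_conj_self_eq K Z
    exact h0 (by rw [hr] at h; exact_mod_cast h)

/-- The operators `-i ad X`, for `X` in an abelian subalgebra, have a joint eigenspace
decomposition. -/
theorem iSup_iInf_eigenspace_eq_top [FiniteDimensional ℝ g] (K : InvariantInnerProduct g)
    (t : LieSubalgebra ℝ g)
    (ht : IsLieAbelian t) :
    (⨆ χ : t → ℂ, ⨅ X : t, Module.End.eigenspace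
      ((-Complex.I) • LieAlgebra.ad ℂ (Complexified g) (toC (X : g))) (χ X)) = ⊤ := by
  let : NormedAddCommGroup (Complexified g) :=
    @InnerProductSpace.Core.toNormedAddCommGroup ℂ _ _ _ _ (hermitianCore K)
  let : InnerProductSpace ℂ (Complexified g) := InnerProductSpace.ofCore (hermitianCore K).toCore
  refine LinearMap.IsSymmetric.iSup_iInf_eq_top_of_commute (fun X => ?_) (fun X Y _ => ?_)
  -- `ad X` is skew for the invariant form and commutes with conjugation, so multiplying by `-i`
  -- makes it Hermitian.
  · intro Z W
    change formC K (conj ((-Complex.I) • ⁅toC (X : g), Z⁆)) W =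
      formC K (conj Z) ((-Complex.I) • ⁅toC (X : g), W⁆)
    rw [conj_smul, conj_lie, conj_toC, map_smul, map_smul, LinearMap.smul_apply, formC_lie_left]
    simp
  · refine Commute.smul_left (Commute.smul_right ?_ _) _
    refine LinearMap.ext fun Z => ?_
    have h : ⁅(X : g), (Y : g)⁆ = 0 := by
      rw [← LieSubalgebra.coe_bracket, ht.trivial X Y]; rfl
    change ⁅toC (X : g), ⁅toC (Y : g), Z⁆⁆ = ⁅toC (Y : g), ⁅toC (X : g), Z⁆⁆
    rw [leibniz_lie, ← toC_lie, h, toC_zero, zero_lie, zero_add]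

section Basis

variable {ι : Type*} [Fintype ι] (b : Module.Basis ι ℝ g) (hb : K.IsOrthonormal b)
include hb

theorem sum_form_smul (X : g) : ∑ i, K.form X (b i) • b i = X := by
  conv_rhs => rw [← b.sum_repr X]
  refine Finset.sum_congr rfl fun i _ => ?_
  congr 1
  conv_lhs => rw [← b.sum_repr X]
  rw [map_sum, LinearMap.sum_apply, Finset.sum_eq_single i]
  · rw [map_smul, LinearMap.smul_apply, (hb i i).1 rfl, smul_eq_mul, mul_one]
  · intro j _ hj
    rw [map_smul, LinearMap.smul_apply, (hb j i).2 hj, smul_zero]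
  · simp

/-- The real orthonormal basis is its own dual basis for the complex bilinear extension. -/
theorem sum_formC_smul (Z : Complexified g) :
    ∑ i, formC K Z (toC (b i)) • toC (b i) = Z := by
  induction Z using complexified_induction with
  | zero => simp
  | add Z W hZ hW => simp only [map_add, LinearMap.add_apply, add_smul, Finset.sum_add_distrib, hZ,
      hW]
  | tmul a X =>
    rw [ctmul_eq_smul]
    conv_rhs => rw [← sum_form_smul K b hb X, toC_sum, Finset.smul_sum]
    simp only [map_smul, LinearMap.smul_apply, formC_toC, toC_smul, smul_smul, smul_eq_mul]

variable {W : Type*} [AddCommGroup W] [Module ℂ W]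

/-- The value of a bilinear map on the Casimir tensor is independent of the pair of dual bases. -/
theorem sum_dual_bases {κ : Type*} [Fintype κ] (e f : κ → Complexified g)
    (hef : ∀ Z, ∑ j, formC K Z (f j) • e j = Z) (β : Complexified g →ₗ[ℂ] Complexified g →ₗ[ℂ] W) :
    ∑ i, β (toC (b i)) (toC (b i)) = ∑ j, β (e j) (f j) := by
  have h : ∀ i, β (toC (b i)) (toC (b i)) =
      ∑ j, formC K (f j) (toC (b i)) • β (e j) (toC (b i)) := fun i => by
    nth_rw 1 [← hef (toC (b i))]
    simp only [map_sum, map_smul, LinearMap.sum_apply, LinearMap.smul_apply, formC_symm K (f _)]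
  simp only [h]
  rw [Finset.sum_comm]
  refine Finset.sum_congr rfl fun j _ => ?_
  conv_rhs => rw [← sum_formC_smul K b hb (f j)]
  simp only [map_sum, map_smul]

/-- Invariance of the Casimir tensor. -/
theorem sum_lie_tmul (X : Complexified g) (β : Complexified g →ₗ[ℂ] Complexified g →ₗ[ℂ] W) :
    ∑ i, β ⁅X, toC (b i)⁆ (toC (b i)) = - ∑ i, β (toC (b i)) ⁅X, toC (b i)⁆ := by
  have h1 : ∀ i, β ⁅X, toC (b i)⁆ (toC (b i)) =
      ∑ j, formC K ⁅X, toC (b i)⁆ (toC (b j)) • β (toC (b j)) (toC (b i)) := fun i => by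
    conv_lhs => rw [← sum_formC_smul K b hb ⁅X, toC (b i)⁆]
    simp only [map_sum, map_smul, LinearMap.sum_apply, LinearMap.smul_apply]
  have h2 : ∀ i, β (toC (b i)) ⁅X, toC (b i)⁆ =
      ∑ j, formC K ⁅X, toC (b i)⁆ (toC (b j)) • β (toC (b i)) (toC (b j)) := fun i => by
    conv_lhs => rw [← sum_formC_smul K b hb ⁅X, toC (b i)⁆]
    simp only [map_sum, map_smul]
  simp only [h1, h2]
  -- After exchanging `i` and `j`, the claim is the antisymmetry of `⟨[X, Xᵢ], Xⱼ⟩` in `i` and `j`.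
  rw [Finset.sum_comm, ← Finset.sum_neg_distrib]
  refine Finset.sum_congr rfl fun i _ => ?_
  rw [← Finset.sum_neg_distrib]
  refine Finset.sum_congr rfl fun j _ => ?_
  rw [formC_lie_left, formC_symm, neg_smul]

end Basis

end Complexification

/-! ### Root decomposition of `g_ℂ` -/

section Roots

variable {g : Type*} [LieRing g] [LieAlgebra ℝ g] (K : InvariantInnerProduct g)
  (t : LieSubalgebra ℝ g)

/-- `E` lies in the subspace of `g_ℂ` on which `X ∈ t` acts by `i α(X)`. -/
def IsWeightVector (α : Module.Dual ℝ t) (E : Complexified g) : Prop :=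
  ∀ X : t, ⁅toC (X : g), E⁆ = (Complex.I * (α X : ℂ)) • E

variable {t} {α β : Module.Dual ℝ t} {E F : Complexified g}

theorem IsWeightVector.smul (a : ℂ) (hE : IsWeightVector t α E) : IsWeightVector t α (a • E) :=
  fun X => by rw [lie_smul, hE X, smul_comm]

theorem IsWeightVector.sub (hE : IsWeightVector t α E) (hF : IsWeightVector t α F) :
    IsWeightVector t α (E - F) :=
  fun X => by rw [lie_sub, hE X, hF X, smul_sub]

theorem IsWeightVector.conj (hE : IsWeightVector t α E) :
    IsWeightVector t (-α) (LoopCasimir.conj E) := fun X => by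
  have h := congrArg LoopCasimir.conj (hE X)
  rw [conj_lie, conj_toC, conj_smul] at h
  rw [h]
  simp

theorem IsWeightVector.lie (hE : IsWeightVector t α E) (hF : IsWeightVector t β F) :
    IsWeightVector t (α + β) ⁅E, F⁆ := fun X => by
  rw [leibniz_lie, hE X, hF X, smul_lie, lie_smul, ← add_smul, LinearMap.add_apply]
  push_cast
  ring_nf

theorem IsWeightVector.isRoot (hE : IsWeightVector t α E) (h0 : E ≠ 0) (hα : α ≠ 0) : IsRoot t α :=
  ⟨hα, E, h0, hE⟩

/-- Invariance under `X ∈ t` gives `i (α + β)(X) ⟨E, F⟩ = 0`. -/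
theorem IsWeightVector.formC_eq_zero (hE : IsWeightVector t α E) (hF : IsWeightVector t β F)
    (h : α + β ≠ 0) : formC K E F = 0 := by
  obtain ⟨X, hX⟩ : ∃ X, (α + β) X ≠ 0 := by
    by_contra! h'
    exact h (LinearMap.ext h')
  have h1 := formC_lie_left K (toC (X : g)) E F
  rw [hE X, hF X, map_smul, map_smul, LinearMap.smul_apply, smul_eq_mul, smul_eq_mul] at h1
  have h2 : (Complex.I * ((α + β) X : ℂ)) * formC K E F = 0 := by
    rw [LinearMap.add_apply]
    push_cast
    linear_combination h1
  refine (mul_eq_zero.mp h2).resolve_left (mul_ne_zero Complex.I_ne_zero ?_)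
  exact_mod_cast hX

theorem eq_of_toC_add_eq (K : InvariantInnerProduct g) {A B : g}
    (h : toC A + Complex.I • toC B = 0) : A = 0 ∧ B = 0 := by
  have h1 := formC_conj_self_toC_add K A B
  rw [h, map_zero] at h1
  have h2 : K.form A A + K.form B B = 0 := by exact_mod_cast h1.symm
  have hp : ∀ X, X ≠ 0 → 0 < K.form X X := K.pos
  have hn : ∀ X, 0 ≤ K.form X X := fun X => by
    rcases eq_or_ne X 0 with rfl | h
    · simp
    · exact (K.pos X h).le
  constructor
  · by_contra h'
    linarith [hp A h', hn B]
  · by_contra h'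
    linarith [hp B h', hn A]

/-- Otherwise `t + ℝ A` would be a larger abelian subalgebra. -/
theorem mem_of_commute (ht : IsMaximalAbelian t) {A : g} (hA : ∀ X ∈ t, ⁅X, A⁆ = 0) : A ∈ t := by
  have ht' : ∀ X ∈ t, ∀ Y ∈ t, ⁅X, Y⁆ = 0 := fun X hX Y hY => by
    have := ht.prop.trivial ⟨X, hX⟩ ⟨Y, hY⟩
    exact congrArg Subtype.val this
  have hc : ∀ X ∈ t.toSubmodule ⊔ Submodule.span ℝ {A}, ∀ Y ∈ t.toSubmodule ⊔ Submodule.span ℝ {A},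
      ⁅X, Y⁆ = 0 := by
    intro X hX Y hY
    obtain ⟨X₁, hX₁, X₂, hX₂, rfl⟩ := Submodule.mem_sup.mp hX
    obtain ⟨Y₁, hY₁, Y₂, hY₂, rfl⟩ := Submodule.mem_sup.mp hY
    obtain ⟨a, rfl⟩ := Submodule.mem_span_singleton.mp hX₂
    obtain ⟨c, rfl⟩ := Submodule.mem_span_singleton.mp hY₂
    have h1 : ⁅A, Y₁⁆ = 0 := by rw [← lie_skew, hA Y₁ hY₁, neg_zero]
    simp [ht' X₁ hX₁ Y₁ hY₁, hA X₁ hX₁, h1]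
  let s : LieSubalgebra ℝ g :=
    { t.toSubmodule ⊔ Submodule.span ℝ {A} with
      lie_mem' := fun {X Y} hX hY => by
        rw [hc X hX Y hY]
        exact Submodule.zero_mem _ }
  have hs : IsLieAbelian s := ⟨fun X Y => Subtype.ext (hc X X.2 Y Y.2)⟩
  have hts : t ≤ s := fun X hX => Submodule.mem_sup_left (show X ∈ t.toSubmodule from hX)
  exact ht.le_of_ge hs hts (Submodule.mem_sup_right (Submodule.mem_span_singleton_self A))

/-- The real and imaginary parts of a vector of weight zero commute with `t` separately, so the zero
weight space is the complexification of `t`. -/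
theorem exists_of_isWeightVector_zero (K : InvariantInnerProduct g) (ht : IsMaximalAbelian t)
    (hE : IsWeightVector t 0 E) :
    ∃ A B : t, E = toC (A : g) + Complex.I • toC (B : g) := by
  obtain ⟨A, B, rfl⟩ := exists_eq_toC_add E
  have h : ∀ X : t, ⁅(X : g), A⁆ = 0 ∧ ⁅(X : g), B⁆ = 0 := fun X => by
    have := hE X
    rw [lie_add, lie_smul, ← toC_lie, ← toC_lie] at this
    exact eq_of_toC_add_eq K (this.trans (by simp))
  exact ⟨⟨A, mem_of_commute ht fun X hX => (h ⟨X, hX⟩).1⟩,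
    ⟨B, mem_of_commute ht fun X hX => (h ⟨X, hX⟩).2⟩, rfl⟩

/-- Pairing the eigenvalue equation with `conj E` shows that `χ` is real valued. Since `E` is
nonzero, eigenvalues are unique, and linearity in `X` follows. -/
theorem exists_dual_of_eigenvector (K : InvariantInnerProduct g) (h0 : E ≠ 0) {χ : t → ℂ}
    (h : ∀ X : t, ⁅toC (X : g), E⁆ = (Complex.I * χ X) • E) :
    ∃ α : Module.Dual ℝ t, IsWeightVector t α E := by
  have hr : ∀ X, ((χ X).re : ℂ) = χ X := fun X => by
    obtain ⟨r, -, hr, hr0⟩ := formC_conj_self_eq K E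
    have h1 := formC_lie_left K (toC (X : g)) (conj E) E
    have h2 := congrArg conj (h X)
    rw [conj_lie, conj_toC, conj_smul] at h2
    rw [h2, h X, map_smul, map_smul, LinearMap.smul_apply, hr, smul_eq_mul, smul_eq_mul, map_mul,
      Complex.conj_I] at h1
    have hrne : (r : ℂ) ≠ 0 := fun h' => h0 (hr0 (by exact_mod_cast h'))
    have h3 : starRingEnd ℂ (χ X) = χ X := by
      have : (Complex.I * r) * (starRingEnd ℂ (χ X) - χ X) = 0 := by linear_combination -h1
      exact sub_eq_zero.mp ((mul_eq_zero.mp this).resolve_left (mul_ne_zero Complex.I_ne_zero hrne))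
    exact Complex.conj_eq_iff_re.mp h3
  have hinj : ∀ a c : ℂ, (Complex.I * a) • E = (Complex.I * c) • E → a = c := fun a c hac =>
    mul_left_cancel₀ Complex.I_ne_zero (smul_left_injective ℂ h0 hac)
  refine ⟨{ toFun := fun X => (χ X).re, map_add' := fun X Y => ?_, map_smul' := fun r X => ?_ },
    fun X => ?_⟩
  · rw [← Complex.add_re]
    congr 1
    apply hinj
    rw [← h, show ((X + Y : t) : g) = X + Y from rfl, toC_add, add_lie, h, h]
    module
  · rw [RingHom.id_apply, smul_eq_mul, ← Complex.re_ofReal_mul]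
    congr 1
    apply hinj
    rw [← h, show ((r • X : t) : g) = r • (X : g) from rfl, toC_smul, smul_lie, h]
    module
  · rw [h X]
    change _ = (Complex.I * ((χ X).re : ℂ)) • E
    rw [hr]

/-- The Cartan decomposition of `g_ℂ`, as an induction principle. -/
theorem root_induction [FiniteDimensional ℝ g] (K : InvariantInnerProduct g)
    (ht : IsMaximalAbelian t) {p : Complexified g → Prop}
    (zero : p 0) (add : ∀ Z W, p Z → p W → p (Z + W))
    (cartan : ∀ (a : ℂ) (X : t), p (a • toC (X : g)))
    (root : ∀ α, IsRoot t α → ∀ E, IsWeightVector t α E → p E) (Z : Complexified g) : p Z := by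
  have hZ : Z ∈ (⨆ χ : t → ℂ, ⨅ X : t, Module.End.eigenspace
      ((-Complex.I) • LieAlgebra.ad ℂ (Complexified g) (toC (X : g))) (χ X)) := by
    rw [iSup_iInf_eigenspace_eq_top K t ht.prop]
    trivial
  refine Submodule.iSup_induction _ (motive := p) hZ (fun χ E hE => ?_) zero add
  have hE' : ∀ X : t, ⁅toC (X : g), E⁆ = (Complex.I * χ X) • E := fun X => by
    have h1 := Module.End.mem_eigenspace_iff.mp ((Submodule.mem_iInf _).mp hE X)
    have h2 : (-Complex.I) • ⁅toC (X : g), E⁆ = χ X • E := h1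
    rw [mul_smul, ← h2, smul_smul]
    simp
  rcases eq_or_ne E 0 with rfl | h0
  · exact zero
  obtain ⟨α, hα⟩ := exists_dual_of_eigenvector K h0 hE'
  -- A joint eigenvector of weight zero lies in `t_ℂ`; any other weight is a root by definition.
  rcases eq_or_ne α 0 with rfl | hα0
  · obtain ⟨A, B, rfl⟩ := exists_of_isWeightVector_zero K ht hα
    exact add _ _ (by simpa using cartan 1 A) (cartan _ B)
  · exact root α (hα.isRoot h0 hα0) E hα

/-- `conj E` has weight `-α` and pairs positively with `E`, so it only has to be rescaled. -/
theorem exists_root_vectors (hα : IsRoot t α) :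
    ∃ E F : Complexified g, IsWeightVector t α E ∧ IsWeightVector t (-α) F ∧ formC K E F = 1 := by
  obtain ⟨-, E, h0, hE⟩ := hα
  obtain ⟨r, -, hr, hr0⟩ := formC_conj_self_eq K E
  have hrne : (r : ℂ) ≠ 0 := fun h' => h0 (hr0 (by exact_mod_cast h'))
  refine ⟨E, (r : ℂ)⁻¹ • conj E, hE, IsWeightVector.smul _ (IsWeightVector.conj hE), ?_⟩
  rw [map_smul, formC_symm, hr, smul_eq_mul, inv_mul_cancel₀ hrne]

section

variable [FiniteDimensional ℝ g]

variable (t) in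
/-- The element of `t` dual to `α ∈ t*`. -/
def coweight (α : Module.Dual ℝ t) : t :=
  ((K.form.restrict t.toSubmodule).toDual (restrict_nondegenerate K t)).symm α

theorem form_coweight (α : Module.Dual ℝ t) (X : t) :
    K.form (coweight K t α : g) (X : g) = α X := by
  have h := LinearEquiv.apply_symm_apply
    ((K.form.restrict t.toSubmodule).toDual (restrict_nondegenerate K t)) α
  exact LinearMap.congr_fun h X

theorem weightInner_eq (μ ν : Module.Dual ℝ t) : weightInner K t μ ν = μ (coweight K t ν) := rfl

theorem weightInner_symm (μ ν : Module.Dual ℝ t) : weightInner K t μ ν = weightInner K t ν μ := by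
  rw [weightInner_eq, weightInner_eq, ← form_coweight, ← form_coweight, K.symm]

theorem weightInner_add_right (μ ν ν' : Module.Dual ℝ t) :
    weightInner K t μ (ν + ν') = weightInner K t μ ν + weightInner K t μ ν' := by
  simp only [weightInner_symm K μ]
  rfl

theorem weightInner_self_pos {α : Module.Dual ℝ t} (hα : α ≠ 0) : 0 < weightInner K t α α := by
  rw [weightInner_eq, ← form_coweight]
  refine K.pos _ fun h => hα (LinearMap.ext fun X => ?_)
  rw [← form_coweight K, h]
  simp

/-- Both sides lie in `t_ℂ` and have equal pairings with `t`. Their difference is therefore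
orthogonal to `t_ℂ`, in particular to its own conjugate, and vanishes by positivity. -/
theorem IsWeightVector.lie_neg (ht : IsMaximalAbelian t) (hE : IsWeightVector t α E)
    (hF : IsWeightVector t (-α) F) :
    ⁅E, F⁆ = (Complex.I * formC K E F) • toC (coweight K t α : g) := by
  have h0 : IsWeightVector t 0 ⁅E, F⁆ := by simpa using hE.lie hF
  have hform : ∀ X : t, formC K (toC (X : g)) ⁅E, F⁆ =
      formC K (toC (X : g)) ((Complex.I * formC K E F) • toC (coweight K t α : g)) := fun X => by
    rw [← formC_invariant, hE X, map_smul, LinearMap.smul_apply, map_smul, formC_toC, K.symm,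
      form_coweight, smul_eq_mul, smul_eq_mul]
    ring
  have h0' : IsWeightVector t 0 (toC (coweight K t α : g)) := fun X => by
    rw [← toC_lie, ← LieSubalgebra.coe_bracket, ht.prop.trivial]
    simp
  obtain ⟨A, B, h⟩ := exists_of_isWeightVector_zero K ht
    (h0.sub (h0'.smul (Complex.I * formC K E F)))
  have hz : ∀ X : t, formC K (toC (X : g)) (⁅E, F⁆ -
      (Complex.I * formC K E F) • toC (coweight K t α : g)) = 0 := fun X => by
    rw [map_sub, hform X, sub_self]
  have hzz : formC K (LoopCasimir.conj (⁅E, F⁆ -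
      (Complex.I * formC K E F) • toC (coweight K t α : g)))
      (⁅E, F⁆ - (Complex.I * formC K E F) • toC (coweight K t α : g)) = 0 := by
    nth_rw 1 [h]
    rw [map_add, conj_smul, conj_toC, conj_toC, map_add, map_smul, LinearMap.add_apply,
      LinearMap.smul_apply, hz, hz]
    simp
  obtain ⟨r, -, hr, hr0⟩ := formC_conj_self_eq K
    (⁅E, F⁆ - (Complex.I * formC K E F) • toC (coweight K t α : g))
  exact sub_eq_zero.mp (hr0 (by exact_mod_cast hr.symm.trans hzz))

/-- The root spaces are one-dimensional. -/
theorem IsWeightVector.eq_zero_of_orthogonal (ht : IsMaximalAbelian t) (hα : α ≠ 0)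
    (hE : IsWeightVector t α E) (h0 : E ≠ 0) (hF : IsWeightVector t α F)
    (hEF : formC K (LoopCasimir.conj E) F = 0) : F = 0 := by
  have h1 : ⁅E, LoopCasimir.conj F⁆ = 0 := by
    rw [hE.lie_neg K ht hF.conj]
    have := formC_conj K (LoopCasimir.conj E) F
    rw [conj_conj, hEF, map_zero] at this
    rw [this, mul_zero, zero_smul]
  -- As `[E, conj F] = 0`, the norm of `[E, F]` involves only `[[E, conj E], conj F]`. It comes out
  -- as minus a product of norms, which positivity allows only if `F = 0`.
  have h2 : formC K (LoopCasimir.conj ⁅E, F⁆) ⁅E, F⁆ =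
      - (formC K (LoopCasimir.conj E) E * formC K (LoopCasimir.conj F) F *
        weightInner K t α α) := by
    rw [formC_symm, formC_lie_left, conj_lie, leibniz_lie, h1, lie_zero, add_zero,
      hE.lie_neg K ht hE.conj, smul_lie, hF.conj, map_smul, map_smul, formC_symm K F,
      formC_symm K E, weightInner_eq]
    simp only [LinearMap.neg_apply, smul_eq_mul]
    push_cast
    linear_combination (formC K (LoopCasimir.conj E) E * formC K (LoopCasimir.conj F) F *
      α (coweight K t α)) * Complex.I_mul_I
  obtain ⟨r, hr, hr1, -⟩ := formC_conj_self_eq K ⁅E, F⁆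
  obtain ⟨s, hs, hs1, hs0⟩ := formC_conj_self_eq K E
  obtain ⟨u, hu, hu1, hu0⟩ := formC_conj_self_eq K F
  rw [hr1, hs1, hu1] at h2
  have h3 : r = -(s * u * weightInner K t α α) := by exact_mod_cast h2
  have hs' : 0 < s := lt_of_le_of_ne hs fun h => h0 (hs0 h.symm)
  refine hu0 (le_antisymm ?_ hu)
  by_contra! hu'
  have := mul_pos (mul_pos hs' hu') (weightInner_self_pos K hα)
  linarith

/-- `conj F` is a nonzero vector of the one-dimensional space of weight `α`, and `G - ⟨G, F⟩ E` is
Hermitian orthogonal to it. -/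
theorem IsWeightVector.eq_smul (ht : IsMaximalAbelian t) (hα : α ≠ 0) {G : Complexified g}
    (hE : IsWeightVector t α E) (hF : IsWeightVector t (-α) F) (hEF : formC K E F = 1)
    (hG : IsWeightVector t α G) : G = formC K G F • E := by
  have hne : LoopCasimir.conj F ≠ 0 := fun h => by
    rw [← conj_conj F, h, map_zero, map_zero] at hEF
    exact zero_ne_one hEF
  have hF' : IsWeightVector t α (LoopCasimir.conj F) := by simpa using hF.conj
  refine sub_eq_zero.mp (hF'.eq_zero_of_orthogonal K ht hα hne (hG.sub (hE.smul _)) ?_)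
  rw [conj_conj, map_sub, map_smul, formC_symm K F E, hEF, formC_symm K F G, smul_eq_mul, mul_one,
    sub_self]

end

end Roots

/-! ### The finite-dimensional Casimir on an extremal vector -/

section ExtremalVectors

variable {g : Type*} [LieRing g] [LieAlgebra ℝ g] [FiniteDimensional ℝ g]
  (K : InvariantInnerProduct g) {t : LieSubalgebra ℝ g}

omit [FiniteDimensional ℝ g] in
theorem sum_form_smul_dualBasis {κ : Type*} [Fintype κ] [DecidableEq κ] (d : Module.Basis κ ℝ t)
    (X : t) :
    ∑ j, K.form (X : g) (d j : g) •
      LinearMap.BilinForm.dualBasis _ (restrict_nondegenerate K t) d j = X := by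
  conv_rhs =>
    rw [← (LinearMap.BilinForm.dualBasis _ (restrict_nondegenerate K t) d).sum_repr X]
  refine Finset.sum_congr rfl fun j _ => ?_
  rw [LinearMap.BilinForm.dualBasis_repr_apply]
  rfl

theorem sum_mul_dualBasis {κ : Type*} [Fintype κ] [DecidableEq κ] (d : Module.Basis κ ℝ t)
    (μ : Module.Dual ℝ t) :
    ∑ j, μ (d j) * μ (LinearMap.BilinForm.dualBasis _ (restrict_nondegenerate K t) d j) =
      weightInner K t μ μ := by
  rw [weightInner_eq, ← sum_form_smul_dualBasis K d (coweight K t μ), map_sum]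
  refine Finset.sum_congr rfl fun j _ => ?_
  rw [form_coweight, map_smul, smul_eq_mul]

/-- Vectors pair nontrivially only when their weights are opposite, so one term survives; it equals
`E` because root spaces are one-dimensional. -/
theorem sum_root_vectors_eq_self (ht : IsMaximalAbelian t) {κ : Type*} [Fintype κ]
    {σ : κ → Module.Dual ℝ t} (hσ : Function.Injective σ) {e f : κ → Complexified g}
    (he : ∀ k, IsWeightVector t (σ k) (e k)) (hf : ∀ k, IsWeightVector t (-σ k) (f k))
    (hef : ∀ k, formC K (e k) (f k) = 1) {E : Complexified g} (k : κ) (hk : σ k ≠ 0)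
    (hE : IsWeightVector t (σ k) E) : ∑ j, formC K E (f j) • e j = E := by
  rw [Finset.sum_eq_single k]
  · exact ((he k).eq_smul K ht hk (hf k) (hef k) hE).symm
  · intro j _ hj
    rw [hE.formC_eq_zero K (hf j), zero_smul]
    intro h
    rw [← sub_eq_add_neg, sub_eq_zero] at h
    exact hj (hσ h).symm
  · intro h
    exact absurd (Finset.mem_univ k) h

omit [FiniteDimensional ℝ g] in
theorem sum_root_vectors_eq_zero {κ : Type*} [Fintype κ]
    {σ : κ → Module.Dual ℝ t} {e f : κ → Complexified g}
    (hf : ∀ k, IsWeightVector t (-σ k) (f k))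
    {E : Complexified g} {α : Module.Dual ℝ t} (hα : ∀ k, σ k ≠ α)
    (hE : IsWeightVector t α E) : ∑ j, formC K E (f j) • e j = 0 := by
  refine Finset.sum_eq_zero fun j _ => ?_
  rw [hE.formC_eq_zero K (hf j), zero_smul]
  intro h
  rw [← sub_eq_add_neg, sub_eq_zero] at h
  exact hα j h.symm

/-- Dual root vectors together with dual bases of `t` are dual bases of `g_ℂ`. -/
theorem root_resolution (ht : IsMaximalAbelian t) {P : Finset (Module.Dual ℝ t)}
    (hroot : ∀ α, IsRoot t α ↔ α ∈ P ∨ -α ∈ P) (hneg : ∀ α ∈ P, -α ∉ P)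
    {κ : Type*} [Fintype κ] [DecidableEq κ] (d : Module.Basis κ ℝ t)
    (e f : P → Complexified g) (he : ∀ α : P, IsWeightVector t (α : Module.Dual ℝ t) (e α))
    (hf : ∀ α : P, IsWeightVector t (-(α : Module.Dual ℝ t)) (f α))
    (hef : ∀ α, formC K (e α) (f α) = 1) (Z : Complexified g) :
    ∑ j, formC K Z (toC (d j : g)) •
        toC (LinearMap.BilinForm.dualBasis _ (restrict_nondegenerate K t) d j : g) +
      (∑ α, formC K Z (f α) • e α + ∑ α, formC K Z (e α) • f α) = Z := by
  have hd : ∀ X : t, IsWeightVector t 0 (toC (X : g)) := fun X Y => by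
    rw [← toC_lie, ← LieSubalgebra.coe_bracket, ht.prop.trivial]
    simp
  have hP0 : ∀ α ∈ P, α ≠ 0 := fun α hα => ((hroot α).mpr (Or.inl hα)).1
  induction Z using root_induction K ht with
  | zero => simp
  | add Z W hZ hW =>
    conv_rhs => rw [← hZ, ← hW]
    simp only [map_add, LinearMap.add_apply, add_smul, Finset.sum_add_distrib]
    abel
  | cartan a X =>
    have h1 : ∀ α : P, formC K (toC (X : g)) (f α) = 0 := fun α =>
      (hd X).formC_eq_zero K (hf α) (by simpa using hP0 α α.2)
    have h2 : ∀ α : P, formC K (toC (X : g)) (e α) = 0 := fun α =>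
      (hd X).formC_eq_zero K (he α) (by simpa using hP0 α α.2)
    simp only [map_smul, LinearMap.smul_apply, h1, h2, smul_zero, zero_smul,
      Finset.sum_const_zero, add_zero, formC_toC]
    conv_rhs => rw [← sum_form_smul_dualBasis K d X]
    rw [show ((∑ j, K.form (X : g) (d j : g) •
      LinearMap.BilinForm.dualBasis _ (restrict_nondegenerate K t) d j : t) : g) =
      ∑ j, K.form (X : g) (d j : g) •
        (LinearMap.BilinForm.dualBasis _ (restrict_nondegenerate K t) d j : g) from
      map_sum t.toSubmodule.subtype _ _, toC_sum, Finset.smul_sum]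
    refine Finset.sum_congr rfl fun j _ => ?_
    rw [toC_smul, smul_assoc]
  | root α hα E hE =>
    have h0 : ∀ j, formC K E (toC (d j : g)) = 0 := fun j =>
      hE.formC_eq_zero K (hd (d j)) (by simpa using hα.1)
    simp only [h0, zero_smul, Finset.sum_const_zero, zero_add]
    have he' : ∀ β : P, IsWeightVector t (- -(β : Module.Dual ℝ t)) (e β) := fun β => by
      rw [neg_neg]; exact he β
    have hinj : Function.Injective fun β : P => -(β : Module.Dual ℝ t) :=
      neg_injective.comp Subtype.val_injective
    have hfe : ∀ β, formC K (f β) (e β) = 1 := fun β => (formC_symm K _ _).trans (hef β)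
    -- Exactly one of the two sums over `P` sees the weight `α`: the first if `α ∈ P`, the second if
    -- `-α ∈ P`.
    rcases (hroot α).mp hα with h | h
    · have h2 : ∀ β : P, -(β : Module.Dual ℝ t) ≠ α := fun β hβ =>
        hneg β β.2 (by rw [hβ]; exact h)
      rw [sum_root_vectors_eq_self K ht Subtype.val_injective he hf hef ⟨α, h⟩ hα.1 hE,
        sum_root_vectors_eq_zero K he' h2 hE, add_zero]
    · have h2 : ∀ β : P, (β : Module.Dual ℝ t) ≠ α := fun β hβ =>
        hneg β β.2 (by rw [hβ]; exact h)
      have hα' : IsWeightVector t (-((⟨-α, h⟩ : P) : Module.Dual ℝ t)) E := by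
        rw [neg_neg]; exact hE
      rw [sum_root_vectors_eq_zero K hf h2 hE,
        sum_root_vectors_eq_self K ht hinj hf he' hfe ⟨-α, h⟩
          (by rw [neg_neg]; exact hα.1) hα', zero_add]

/-- The value of `∑ Xᵢ²` on a vector of weight `μ` that is annihilated by the root vectors of a
system `P` of positive roots is `-⟨μ, μ + 2 ρ⟩`. -/
theorem sum_sq_apply_extremal {ι : Type*} [Fintype ι] (b : Module.Basis ι ℝ g)
    (hb : K.IsOrthonormal b) (ht : IsMaximalAbelian t) {P : Finset (Module.Dual ℝ t)}
    (hroot : ∀ α, IsRoot t α ↔ α ∈ P ∨ -α ∈ P) (hneg : ∀ α ∈ P, -α ∉ P)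
    {W : Type*} [AddCommGroup W] [Module ℂ W] (π : Complexified g →ₗ[ℂ] Module.End ℂ W)
    (hπ : ∀ X Y, π ⁅X, Y⁆ = π X * π Y - π Y * π X) {v : W} {μ : Module.Dual ℝ t}
    (hv : ∀ X : t, π (toC (X : g)) v = (Complex.I * (μ X : ℂ)) • v)
    (hk : ∀ α ∈ P, ∀ E, IsWeightVector t α E → π E v = 0) :
    ∑ i, π (toC (b i)) (π (toC (b i)) v) =
      ((-(weightInner K t μ μ + weightInner K t μ (∑ α ∈ P, α)) : ℝ) : ℂ) • v := by
  classical
  let d := Module.finBasis ℝ t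
  choose e f he hf hef using fun α : P =>
    exists_root_vectors K ((hroot α).mpr (Or.inl α.2))
  let β : Complexified g →ₗ[ℂ] Complexified g →ₗ[ℂ] W :=
    ((LinearMap.mul ℂ (Module.End ℂ W)).compl₁₂ π π).compr₂ (LinearMap.applyₗ v)
  have hβ : ∀ X Y, β X Y = π X (π Y v) := fun X Y => rfl
  have hres := root_resolution K ht hroot hneg d e f he hf hef
  -- The Casimir tensor is rewritten as `∑ dⱼ* ⊗ dⱼ + ∑ e_α ⊗ f_α + ∑ f_α ⊗ e_α`.
  have key := sum_dual_bases K b hb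
    (Sum.elim (fun j => toC (LinearMap.BilinForm.dualBasis _ (restrict_nondegenerate K t) d j : g))
      (Sum.elim e f))
    (Sum.elim (fun j => toC (d j : g)) (Sum.elim f e))
    (fun Z => by
      rw [Fintype.sum_sum_type, Fintype.sum_sum_type]
      exact hres Z) β
  rw [Fintype.sum_sum_type, Fintype.sum_sum_type] at key
  simp only [hβ, Sum.elim_inl, Sum.elim_inr] at key
  rw [key]
  have h1 : ∑ j, π (toC (LinearMap.BilinForm.dualBasis _ (restrict_nondegenerate K t) d j : g))
      (π (toC (d j : g)) v) = (-(weightInner K t μ μ) : ℂ) • v := by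
    rw [← sum_mul_dualBasis K d μ]
    push_cast
    rw [← Finset.sum_neg_distrib, Finset.sum_smul]
    refine Finset.sum_congr rfl fun j _ => ?_
    rw [hv, map_smul, hv, smul_smul]
    congr 1
    linear_combination ((μ (d j) : ℂ) *
      μ (LinearMap.BilinForm.dualBasis _ (restrict_nondegenerate K t) d j)) * Complex.I_mul_I
  -- Since `e_α v = 0`, the product acts as the commutator `[e_α, f_α] = i α*`, with `α*` the dual
  -- of `α` in `t`, and `α*` acts by `i ⟨μ, α⟩`.
  have h2 : ∀ α : P, π (e α) (π (f α) v) = (-(weightInner K t μ α) : ℂ) • v := fun α => by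
    have := congrArg (fun T : Module.End ℂ W => T v) (hπ (e α) (f α))
    simp only [LinearMap.sub_apply, Module.End.mul_apply] at this
    rw [hk α α.2 _ (he α), map_zero, sub_zero] at this
    rw [← this, (he α).lie_neg K ht (hf α), hef, map_smul, LinearMap.smul_apply, hv, smul_smul,
      weightInner_eq]
    congr 1
    linear_combination (μ (coweight K t α) : ℂ) * Complex.I_mul_I
  have h3 : ∀ α : P, π (f α) (π (e α) v) = 0 := fun α => by
    rw [hk α α.2 _ (he α), map_zero]
  have h4 : weightInner K t μ (∑ α ∈ P, α) = ∑ α : P, weightInner K t μ α := by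
    simp only [weightInner_symm K μ]
    rw [Finset.sum_coe_sort P (fun α => weightInner K t α μ)]
    simp only [weightInner_eq, LinearMap.sum_apply]
  simp only [h1, h2, h3, Finset.sum_const_zero, add_zero, h4]
  rw [← Finset.sum_smul, ← add_smul]
  congr 1
  push_cast
  rw [Finset.sum_neg_distrib]
  ring

end ExtremalVectors

/-! ### The Casimir operator in the adjoint representation -/

section AdjointCasimir

variable {g : Type*} [LieRing g] [LieAlgebra ℝ g] (K : InvariantInnerProduct g)
  {ι : Type*} [Fintype ι] (b : Module.Basis ι ℝ g) (hb : K.IsOrthonormal b)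
include hb

theorem sum_lie_tmul_real {W : Type*} [AddCommGroup W] [Module ℝ W] (X : g)
    (β : g →ₗ[ℝ] g →ₗ[ℝ] W) :
    ∑ i, β ⁅X, b i⁆ (b i) = - ∑ i, β (b i) ⁅X, b i⁆ := by
  have h1 : ∀ i, β ⁅X, b i⁆ (b i) =
      ∑ j, K.form ⁅X, b i⁆ (b j) • β (b j) (b i) := fun i => by
    conv_lhs => rw [← sum_form_smul K b hb ⁅X, b i⁆]
    simp only [map_sum, map_smul, LinearMap.sum_apply, LinearMap.smul_apply]
  have h2 : ∀ i, β (b i) ⁅X, b i⁆ =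
      ∑ j, K.form ⁅X, b i⁆ (b j) • β (b i) (b j) := fun i => by
    conv_lhs => rw [← sum_form_smul K b hb ⁅X, b i⁆]
    simp only [map_sum, map_smul]
  simp only [h1, h2]
  rw [Finset.sum_comm, ← Finset.sum_neg_distrib]
  refine Finset.sum_congr rfl fun i _ => ?_
  rw [← Finset.sum_neg_distrib]
  refine Finset.sum_congr rfl fun j _ => ?_
  rw [← lie_skew, map_neg, LinearMap.neg_apply, K.invariant, K.symm, neg_smul]

/-- The Casimir operator of a simple compact Lie algebra is a real scalar in the adjoint
representation. -/
theorem exists_adjoint_casimir [FiniteDimensional ℝ g] [LieAlgebra.IsSimple ℝ g] :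
    ∃ c : ℝ, quadraticCasimir ℝ (fun i => LieAlgebra.ad ℝ g (b i)) = c • 1 := by
  classical
  let C : Module.End ℝ g := quadraticCasimir ℝ (fun i => LieAlgebra.ad ℝ g (b i))
  have hC : ∀ Y, C Y = -(1 / 2 : ℝ) • ∑ i, ⁅b i, ⁅b i, Y⁆⁆ := fun Y => by
    simp [C, quadraticCasimir]
  have hskew : ∀ X Y Z, K.form ⁅X, Y⁆ Z = - K.form Y ⁅X, Z⁆ := fun X Y Z => by
    rw [← lie_skew, map_neg, LinearMap.neg_apply, K.invariant]
  have hsymm : ∀ Y Z, K.form (C Y) Z = K.form Y (C Z) := fun Y Z => by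
    rw [hC, hC, map_smul, map_smul, LinearMap.smul_apply, map_sum, map_sum, LinearMap.sum_apply]
    congr 1
    refine Finset.sum_congr rfl fun i _ => ?_
    rw [hskew, hskew, neg_neg]
  have hcomm : ∀ X Y, C ⁅X, Y⁆ = ⁅X, C Y⁆ := fun X Y => by
    have key := sum_lie_tmul_real K b hb X
      (LinearMap.mk₂ ℝ (fun A B : g => ⁅A, ⁅B, Y⁆⁆) (by simp) (by simp) (by simp) (by simp))
    simp only [LinearMap.mk₂_apply] at key
    rw [hC, hC, lie_smul, lie_sum]
    congr 1
    have h1 : ∀ i, ⁅X, ⁅b i, ⁅b i, Y⁆⁆⁆ = ⁅⁅X, b i⁆, ⁅b i, Y⁆⁆ + ⁅b i, ⁅⁅X, b i⁆, Y⁆⁆ +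
        ⁅b i, ⁅b i, ⁅X, Y⁆⁆⁆ := fun i => by
      rw [leibniz_lie X (b i), leibniz_lie X (b i) Y, lie_add]
      abel
    simp only [h1, Finset.sum_add_distrib, key]
    abel
  have hnt : Nontrivial g := by
    by_contra h
    rw [not_nontrivial_iff_subsingleton] at h
    exact LieAlgebra.IsSimple.non_abelian (R := ℝ) (L := g) ⟨fun _ _ => Subsingleton.elim _ _⟩
  let core : InnerProductSpace.Core ℝ g :=
    { inner := fun X Y => K.form X Y
      conj_inner_symm := fun X Y => K.symm Y X
      re_inner_nonneg := fun X => by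
        rcases eq_or_ne X 0 with rfl | h
        · simp
        · exact (K.pos X h).le
      add_left := fun X Y Z => by simp
      smul_left := fun X Y r => by simp
      definite := fun X h => by
        by_contra h'
        exact (K.pos X h').ne' h }
  let : NormedAddCommGroup g := @InnerProductSpace.Core.toNormedAddCommGroup ℝ _ _ _ _ core
  let : InnerProductSpace ℝ g := InnerProductSpace.ofCore core.toCore
  -- Symmetry provides a real eigenvalue. Since `C` commutes with `ad`, the eigenspace is a nonzero
  -- ideal, hence all of the simple algebra `g`.
  have hS : C.IsSymmetric := hsymm
  have hev := hS.hasEigenvalue_iSup_of_finiteDimensional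
  obtain ⟨c, hc⟩ : ∃ c : ℝ, Module.End.HasEigenvalue C c := ⟨_, hev⟩
  refine ⟨c, ?_⟩
  obtain ⟨Y, hY⟩ := hc.exists_hasEigenvector
  let J : LieIdeal ℝ g :=
    { Module.End.eigenspace C c with
      lie_mem := fun {X Z} hZ => by
        change ⁅X, Z⁆ ∈ Module.End.eigenspace C c
        rw [Module.End.mem_eigenspace_iff, hcomm, Module.End.mem_eigenspace_iff.mp hZ, lie_smul] }
  have hJ : J = ⊤ := by
    refine (LieAlgebra.IsSimple.eq_bot_or_eq_top J).resolve_left fun h => hY.2 ?_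
    have : Y ∈ J := hY.1
    rw [h] at this
    simpa using this
  refine LinearMap.ext fun Z => ?_
  have : Z ∈ J := by rw [hJ]; trivial
  exact Module.End.mem_eigenspace_iff.mp this

end AdjointCasimir

/-! ### Operators of forms of degree at most two -/

section Forms

variable {g : Type*} [LieRing g] [LieAlgebra ℝ g] (K : InvariantInnerProduct g)
  (Sg : Type*) [AddCommGroup Sg] [Module ℂ Sg] [Module (CliffordAlgebra (formQ K)) Sg]
  [IsScalarTower ℂ (CliffordAlgebra (formQ K)) Sg]
  {ι : Type*} (b : ι → g) {H : Type*} [AddCommGroup H] [Module ℂ H]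

/-- The normal ordered product of two loops, acting on the spin representation. -/
def normalProduct (ξ η : Loop g) : Module.End ℂ (LoopSpin g Sg) :=
  vectorAction K Sg ξ * vectorAction K Sg η - contraction K ξ η • 1

theorem cliffordAction_ι (ξ : Loop g) :
    cliffordAction K Sg (CliffordAlgebra.ι (loopQ K) ξ) = vectorAction K Sg ξ :=
  CliffordAlgebra.lift_ι_apply _ _ _

theorem normalOrdering_symm_one : (normalOrdering K).symm 1 = 1 := by
  rw [LinearEquiv.symm_apply_eq]
  exact (CliffordAlgebra.changeForm_one (contraction_toQuadraticMap K)).symm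

theorem normalOrdering_symm_ι (ξ : Loop g) :
    (normalOrdering K).symm (ExteriorAlgebra.ι ℂ ξ) = CliffordAlgebra.ι (loopQ K) ξ := by
  rw [LinearEquiv.symm_apply_eq]
  exact (CliffordAlgebra.changeForm_ι (contraction_toQuadraticMap K) ξ).symm

/-- Changing the quadratic form by the bilinear form `-contraction` sends `ξ η` to `ξ ∧ η +
contraction(ξ, η)`; this is the inverse relation. -/
theorem normalOrdering_symm_ι_mul_ι (ξ η : Loop g) :
    (normalOrdering K).symm (ExteriorAlgebra.ι ℂ ξ * ExteriorAlgebra.ι ℂ η) =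
      CliffordAlgebra.ι (loopQ K) ξ * CliffordAlgebra.ι (loopQ K) η -
        algebraMap ℂ _ (contraction K ξ η) := by
  rw [LinearEquiv.symm_apply_eq, map_sub]
  refine (eq_sub_of_add_eq ?_)
  have h1 : normalOrdering K (CliffordAlgebra.ι (loopQ K) ξ * CliffordAlgebra.ι (loopQ K) η) = _ :=
    CliffordAlgebra.changeForm_ι_mul_ι (contraction_toQuadraticMap K) ξ η
  have h2 : normalOrdering K (algebraMap ℂ _ (contraction K ξ η)) = _ :=
    CliffordAlgebra.changeForm_algebraMap (contraction_toQuadraticMap K) (contraction K ξ η)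
  rw [h1, h2, LinearMap.neg_apply, LinearMap.neg_apply, map_neg, sub_neg_eq_add]

theorem formTerm_zero (ω : Loop g [⋀^Fin 0]→ₗ[ℂ] Module.End ℂ H) (a : Fin 0 → ι × ℤ) :
    formTerm K Sg b ω a = TensorProduct.map (ω ![]) 1 := by
  rw [formTerm, ExteriorAlgebra.ιMulti_apply, List.ofFn_zero, List.prod_nil,
    normalOrdering_symm_one, map_one]
  congr 2
  exact Subsingleton.elim _ _

theorem formTerm_one (ω : Loop g [⋀^Fin 1]→ₗ[ℂ] Module.End ℂ H) (a : Fin 1 → ι × ℤ) :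
    formTerm K Sg b ω a = TensorProduct.map (ω fun _ => mono (a 0).2 (toC (b (a 0).1)))
      (vectorAction K Sg (mono (-(a 0).2) (toC (b (a 0).1)))) := by
  rw [formTerm, ExteriorAlgebra.ιMulti_apply, List.ofFn_succ, List.ofFn_zero, List.prod_singleton,
    normalOrdering_symm_ι, cliffordAction_ι]
  congr 2
  funext j
  rw [Subsingleton.elim j 0]

theorem formTerm_two (ω : Loop g [⋀^Fin 2]→ₗ[ℂ] Module.End ℂ H) (a : Fin 2 → ι × ℤ) :
    formTerm K Sg b ω a = TensorProduct.map (ω fun j => mono (a j).2 (toC (b (a j).1)))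
      (normalProduct K Sg (mono (-(a 0).2) (toC (b (a 0).1)))
        (mono (-(a 1).2) (toC (b (a 1).1)))) := by
  rw [formTerm, ExteriorAlgebra.ιMulti_apply, List.ofFn_succ, List.ofFn_succ, List.ofFn_zero,
    List.prod_cons, List.prod_singleton, normalOrdering_symm_ι_mul_ι, map_sub, map_mul,
    cliffordAction_ι, cliffordAction_ι, AlgHom.commutes, Algebra.algebraMap_eq_smul_one]
  rfl

variable {K Sg b}

theorem formTerm_sub {k : ℕ} (ω ω' : Loop g [⋀^Fin k]→ₗ[ℂ] Module.End ℂ H) (a : Fin k → ι × ℤ) :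
    formTerm K Sg b (ω - ω') a = formTerm K Sg b ω a - formTerm K Sg b ω' a := by
  refine eq_sub_of_add_eq ?_
  rw [formTerm, formTerm, formTerm, ← TensorProduct.map_add_left, AlternatingMap.sub_apply,
    sub_add_cancel]

theorem Represents.sub {k : ℕ} {ω ω' : Loop g [⋀^Fin k]→ₗ[ℂ] Module.End ℂ H}
    {A A' : Module.End ℂ (H ⊗[ℂ] LoopSpin g Sg)} (h : Represents K Sg b ω A)
    (h' : Represents K Sg b ω' A') : Represents K Sg b (ω - ω') (A - A') := fun v => by
  obtain ⟨h1, h2⟩ := h v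
  obtain ⟨h1', h2'⟩ := h' v
  refine ⟨(h1.union h1').subset fun a ha => ?_, ?_⟩
  · by_contra hn
    simp only [Set.mem_union, Set.mem_ofPred_eq, not_or, not_not] at hn
    exact ha (by rw [formTerm_sub, LinearMap.sub_apply, hn.1, hn.2, sub_zero])
  · rw [LinearMap.sub_apply, h2, h2', ← finsum_sub_distrib h1 h1']
    simp only [formTerm_sub, LinearMap.sub_apply]

/-- Any two decompositions of `r̂²` thus refer to the same operator `R`. -/
theorem Represents.unique {k : ℕ} {ω : Loop g [⋀^Fin k]→ₗ[ℂ] Module.End ℂ H}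
    {A A' : Module.End ℂ (H ⊗[ℂ] LoopSpin g Sg)} (h : Represents K Sg b ω A)
    (h' : Represents K Sg b ω A') : A = A' :=
  LinearMap.ext fun v => (h v).2.trans (h' v).2.symm

theorem Represents.apply_zero_form {ω : Loop g [⋀^Fin 0]→ₗ[ℂ] Module.End ℂ H}
    {A : Module.End ℂ (H ⊗[ℂ] LoopSpin g Sg)} (h : Represents K Sg b ω A) :
    A = TensorProduct.map (ω ![]) 1 := by
  refine LinearMap.ext fun v => ?_
  rw [(h v).2, finsum_unique, formTerm_zero]

variable (K Sg)

variable (g) in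
/-- The component of a spinor in `S_g ⊗ Λ⁰`. -/
def vacuumPart : LoopSpin g Sg →ₗ[ℂ] Sg :=
  (TensorProduct.rid ℂ Sg).toLinearMap ∘ₗ
    TensorProduct.map LinearMap.id (ExteriorAlgebra.algebraMapInv
      (R := ℂ) (M := positiveLoops g)).toLinearMap

theorem vacuumPart_tmul (s : Sg) (x : ExteriorAlgebra ℂ (positiveLoops g)) :
    vacuumPart g Sg (s ⊗ₜ x) = ExteriorAlgebra.algebraMapInv x • s := by
  simp [vacuumPart]

theorem vectorAction_tmul (ξ : Loop g) (s : Sg) (x : ExteriorAlgebra ℂ (positiveLoops g)) :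
    vectorAction K Sg ξ (s ⊗ₜ x) = s ⊗ₜ extMul ξ x + (2 : ℂ) • (s ⊗ₜ intMul K ξ x) +
      zeroModeAction K Sg (coeff 0 ξ) s ⊗ₜ parity g x := rfl

theorem extMul_apply (ξ : Loop g) (x : ExteriorAlgebra ℂ (positiveLoops g)) :
    extMul ξ x = ExteriorAlgebra.ι ℂ (posPart ξ) * x := rfl

theorem intMul_one (ξ : Loop g) : intMul K ξ 1 = 0 :=
  CliffordAlgebra.contractLeft_one (Q := (0 : QuadraticForm ℂ (positiveLoops g))) _

theorem intMul_ι_mul (ξ : Loop g) (y : positiveLoops g) (x : ExteriorAlgebra ℂ (positiveLoops g)) :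
    intMul K ξ (ExteriorAlgebra.ι ℂ y * x) = loopForm K ξ y • x -
      ExteriorAlgebra.ι ℂ y * intMul K ξ x :=
  CliffordAlgebra.contractLeft_ι_mul _ y x

theorem parity_one : parity g 1 = 1 := map_one (CliffordAlgebra.involute
  (Q := (0 : QuadraticForm ℂ (positiveLoops g))))

theorem parity_ι (y : positiveLoops g) :
    parity g (ExteriorAlgebra.ι ℂ y) = - ExteriorAlgebra.ι ℂ y := CliffordAlgebra.involute_ι y

/-- The vacuum expectation of the normal ordered product of two loops. -/
theorem vacuumPart_normalProduct (ξ η : Loop g) (s : Sg) :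
    vacuumPart g Sg (normalProduct K Sg ξ η (s ⊗ₜ 1)) =
      zeroModeAction K Sg (coeff 0 ξ) (zeroModeAction K Sg (coeff 0 η) s) -
        formC K (coeff 0 ξ) (coeff 0 η) • s := by
  have hi : ∀ y : positiveLoops g, intMul K ξ (ExteriorAlgebra.ι ℂ y) =
      algebraMap ℂ _ (loopForm K ξ y) := fun y =>
    CliffordAlgebra.contractLeft_ι (Q := (0 : QuadraticForm ℂ (positiveLoops g))) _ y
  have hz : ∀ y : positiveLoops g,
      ExteriorAlgebra.algebraMapInv (R := ℂ) (ExteriorAlgebra.ι ℂ y) = 0 := fun y => by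
    simp [ExteriorAlgebra.algebraMapInv]
  rw [normalProduct, LinearMap.sub_apply, Module.End.mul_apply, LinearMap.smul_apply,
    Module.End.one_apply, vectorAction_tmul, intMul_one, TensorProduct.tmul_zero, smul_zero,
    add_zero, parity_one, map_add, vectorAction_tmul, vectorAction_tmul, intMul_one, parity_one,
    extMul_apply, extMul_apply, extMul_apply, mul_one, mul_one, hi, parity_ι]
  simp only [map_sub, map_add, map_smul, vacuumPart_tmul, map_mul, hz, map_one, map_neg,
    TensorProduct.tmul_zero, smul_zero, add_zero, zero_smul, neg_zero, mul_zero,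
    one_smul, AlgHom.commutes, zero_add]
  -- Creating `η₊` and contracting it with `ξ` gives `2 ⟨ξ, η₊⟩`, which cancels the second term of
  -- `contraction`. Only the constant modes remain.
  have hc : contraction K ξ η = formC K (coeff 0 ξ) (coeff 0 η) +
      2 * loopForm K ξ (posPart η) := rfl
  rw [hc, Algebra.algebraMap_self_apply]
  module

theorem zeroModeAction_add (X Y : Complexified g) :
    zeroModeAction K Sg (X + Y) = zeroModeAction K Sg X + zeroModeAction K Sg Y := by
  simp only [zeroModeAction, map_add]

theorem zeroModeAction_mul_add_mul (X Y : Complexified g) :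
    zeroModeAction K Sg X * zeroModeAction K Sg Y + zeroModeAction K Sg Y * zeroModeAction K Sg X =
      (2 * formC K X Y) • 1 := by
  have h := zeroModeAction_sq K Sg (X + Y)
  rw [zeroModeAction_add, add_mul, mul_add, mul_add, zeroModeAction_sq, zeroModeAction_sq, map_add,
    map_add, LinearMap.add_apply, LinearMap.add_apply, formC_symm K Y X] at h
  have h' : zeroModeAction K Sg X * zeroModeAction K Sg Y +
      zeroModeAction K Sg Y * zeroModeAction K Sg X =
      (formC K X X • 1 + zeroModeAction K Sg X * zeroModeAction K Sg Y +
        (zeroModeAction K Sg Y * zeroModeAction K Sg X + formC K Y Y • 1)) -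
        formC K X X • 1 - formC K Y Y • 1 := by abel
  rw [h', h]
  module

end Forms

/-! ### Uniqueness of the degree 0 component -/

section Uniqueness

variable {g : Type*} [LieRing g] [LieAlgebra ℝ g] (K : InvariantInnerProduct g)
  (Sg : Type*) [AddCommGroup Sg] [Module ℂ Sg] [Module (CliffordAlgebra (formQ K)) Sg]
  [IsScalarTower ℂ (CliffordAlgebra (formQ K)) Sg]
  {ι : Type*} [Fintype ι] (b : Module.Basis ι ℝ g) (hb : K.IsOrthonormal b)
include hb

/-- Conjugation of the elements of degree two of the Clifford algebra by an orthonormal basis. -/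
theorem sum_conj_zeroModeAction (i j : ι) :
    ∑ k, zeroModeAction K Sg (toC (b k)) *
        (zeroModeAction K Sg (toC (b i)) * zeroModeAction K Sg (toC (b j)) -
          formC K (toC (b i)) (toC (b j)) • 1) * zeroModeAction K Sg (toC (b k)) =
      ((Fintype.card ι : ℂ) - 4) •
        (zeroModeAction K Sg (toC (b i)) * zeroModeAction K Sg (toC (b j)) -
          formC K (toC (b i)) (toC (b j)) • 1) := by
  classical
  let z : ι → Module.End ℂ Sg := fun i => zeroModeAction K Sg (toC (b i))
  let δ : ι → ι → ℂ := fun i j => formC K (toC (b i)) (toC (b j))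
  have hδ : ∀ i j, δ i j = if i = j then 1 else 0 := fun i j => by
    change formC K (toC (b i)) (toC (b j)) = _
    rw [formC_toC]
    split_ifs with h
    · rw [(hb i j).1 h, Complex.ofReal_one]
    · rw [(hb i j).2 h, Complex.ofReal_zero]
  have hz : ∀ i j, z i * z j = (2 * δ i j) • 1 - z j * z i := fun i j =>
    eq_sub_of_add_eq (zeroModeAction_mul_add_mul K Sg (toC (b i)) (toC (b j)))
  have hsq : ∀ k, z k * z k = 1 := fun k => by
    have := zeroModeAction_sq K Sg (toC (b k))
    rwa [show formC K (toC (b k)) (toC (b k)) = 1 from (hδ k k).trans (if_pos rfl), one_smul]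
      at this
  -- For `i ≠ j`, `z k` commutes with `z i * z j` unless `k` is `i` or `j`, when it anticommutes.
  -- Summing over `k` gives `(dim g - 2) - 2 = dim g - 4`; for `i = j` the element is zero.
  have hk : ∀ k, z k * (z i * z j - δ i j • 1) * z k =
      (2 * δ k i) • (z j * z k) - (2 * δ k j) • (z i * z k) + z i * z j - δ i j • 1 := fun k => by
    have h1 : z k * (z i * z j) * z k = (2 * δ k i) • (z j * z k) - (2 * δ k j) • (z i * z k) +
        z i * z j := by
      rw [← mul_assoc, hz k i, sub_mul, smul_mul_assoc, one_mul, sub_mul, smul_mul_assoc,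
        mul_assoc (z i) (z k) (z j), hz k j, mul_sub, sub_mul, mul_assoc (z i) (z j * z k) (z k),
        mul_assoc (z j), hsq, mul_one, mul_smul_comm, mul_one, smul_mul_assoc]
      abel
    rw [mul_sub, sub_mul, h1, mul_smul_comm, mul_one, smul_mul_assoc, hsq]
  change ∑ k, z k * (z i * z j - δ i j • 1) * z k = _ • (z i * z j - δ i j • 1)
  simp only [hk, Finset.sum_sub_distrib, Finset.sum_add_distrib, Finset.sum_const,
    Finset.card_univ]
  have h1 : ∑ k, (2 * δ k i) • (z j * z k) = (2 : ℂ) • (z j * z i) := by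
    rw [Finset.sum_eq_single i]
    · simp [hδ]
    · intro k _ hk
      simp [hδ, hk]
    · simp
  have h2 : ∑ k, (2 * δ k j) • (z i * z k) = (2 : ℂ) • (z i * z j) := by
    rw [Finset.sum_eq_single j]
    · simp [hδ]
    · intro k _ hk
      simp [hδ, hk]
    · simp
  have hδs : δ j i = δ i j := formC_symm K _ _
  rw [h1, h2, hz j i, hδs, ← Nat.cast_smul_eq_nsmul ℂ, ← Nat.cast_smul_eq_nsmul ℂ]
  module

variable {H : Type*} [AddCommGroup H] [Module ℂ H]

variable {K Sg} in
/-- A sum of a form of degree 0 and a form of degree 2 that vanishes as an operator has vanishing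
component of degree 0. -/
theorem zero_form_eq_zero [Nontrivial Sg]
    {ω₀ : Loop g [⋀^Fin 0]→ₗ[ℂ] Module.End ℂ H} {ω₂ : Loop g [⋀^Fin 2]→ₗ[ℂ] Module.End ℂ H}
    {A₀ A₂ : Module.End ℂ (H ⊗[ℂ] LoopSpin g Sg)} (h₀ : Represents K Sg b ω₀ A₀)
    (h₂ : Represents K Sg b ω₂ A₂) (h : A₀ + A₂ = 0) : ω₀ ![] = 0 := by
  classical
  -- The pairs of constant modes: the only ones whose normal ordered product has a component along
  -- the vacuum.
  let S : Finset (Fin 2 → ι × ℤ) := Fintype.piFinset fun _ => Finset.univ ×ˢ {0}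
  let u : H → (Fin 2 → ι × ℤ) → H := fun v a => ω₂ (fun j => mono (a j).2 (toC (b (a j).1))) v
  let D : (Fin 2 → ι × ℤ) → Module.End ℂ Sg := fun a =>
    zeroModeAction K Sg (toC (b (a 0).1)) * zeroModeAction K Sg (toC (b (a 1).1)) -
      formC K (toC (b (a 0).1)) (toC (b (a 1).1)) • 1
  have hmain : ∀ v s, ω₀ ![] v ⊗ₜ[ℂ] s + ∑ a ∈ S, u v a ⊗ₜ[ℂ] D a s = 0 := fun v s => by
    obtain ⟨hf, hA⟩ := h₂ (v ⊗ₜ (s ⊗ₜ 1))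
    have hterm : ∀ a : Fin 2 → ι × ℤ,
        LinearMap.lTensor H (vacuumPart g Sg) (formTerm K Sg b ω₂ a (v ⊗ₜ (s ⊗ₜ 1))) =
          u v a ⊗ₜ (zeroModeAction K Sg (coeff 0 (mono (-(a 0).2) (toC (b (a 0).1))))
            (zeroModeAction K Sg (coeff 0 (mono (-(a 1).2) (toC (b (a 1).1)))) s) -
        formC K (coeff 0 (mono (-(a 0).2) (toC (b (a 0).1))))
          (coeff 0 (mono (-(a 1).2) (toC (b (a 1).1)))) • s) := fun a => by
      rw [formTerm_two, TensorProduct.map_tmul, LinearMap.lTensor_tmul, vacuumPart_normalProduct]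
    have hz0 : zeroModeAction K Sg 0 = 0 := by simp [zeroModeAction]
    have hsum : LinearMap.lTensor H (vacuumPart g Sg) (A₂ (v ⊗ₜ (s ⊗ₜ 1))) =
        ∑ a ∈ S, u v a ⊗ₜ[ℂ] D a s := by
      rw [hA, map_finsum _ hf]
      rw [finsum_eq_finsetSum_of_support_subset (s := S)]
      · refine Finset.sum_congr rfl fun a ha => ?_
        rw [hterm]
        have ha' := Fintype.mem_piFinset.mp ha
        have h0 : (a 0).2 = 0 := Finset.mem_singleton.mp (Finset.mem_product.mp (ha' 0)).2
        have h1 : (a 1).2 = 0 := Finset.mem_singleton.mp (Finset.mem_product.mp (ha' 1)).2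
        rw [h0, h1, coeff_mono, coeff_mono, if_pos neg_zero, if_pos neg_zero]
        rfl
      · intro a ha
        rw [Finset.mem_coe, Fintype.mem_piFinset]
        by_contra hn
        apply ha
        simp only [Finset.mem_product, Finset.mem_univ, true_and, Finset.mem_singleton,
          Fin.forall_fin_two, not_and_or] at hn
        change LinearMap.lTensor H (vacuumPart g Sg) _ = 0
        rw [hterm]
        rcases hn with hn | hn
        · rw [coeff_mono, if_neg (neg_ne_zero.mpr hn), hz0]
          simp
        · rw [coeff_mono _ (-(a 1).2), if_neg (neg_ne_zero.mpr hn), hz0]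
          simp
    have h0 := congrArg (fun T : Module.End ℂ (H ⊗[ℂ] LoopSpin g Sg) =>
      LinearMap.lTensor H (vacuumPart g Sg) (T (v ⊗ₜ (s ⊗ₜ 1)))) h
    simp only [LinearMap.add_apply, map_add, hsum, LinearMap.zero_apply, map_zero] at h0
    rw [h₀.apply_zero_form, TensorProduct.map_tmul, LinearMap.lTensor_tmul, Module.End.one_apply,
      vacuumPart_tmul, map_one, one_smul] at h0
    exact h0
  have hzz : ∀ k s, zeroModeAction K Sg (toC (b k)) (zeroModeAction K Sg (toC (b k)) s) = s :=
    fun k s => by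
      have := LinearMap.congr_fun (zeroModeAction_sq K Sg (toC (b k))) s
      rwa [formC_toC, (hb k k).1 rfl, Complex.ofReal_one, one_smul] at this
  -- Apply `hmain` to `Xₖ s`, act by `Xₖ` once more and sum over `k`.
  have hconj : ∀ v s, (Fintype.card ι : ℂ) • (ω₀ ![] v ⊗ₜ[ℂ] s) +
      ((Fintype.card ι : ℂ) - 4) • ∑ a ∈ S, u v a ⊗ₜ[ℂ] D a s = 0 := fun v s => by
    have hk : ∑ k, LinearMap.lTensor H (zeroModeAction K Sg (toC (b k)))
        (ω₀ ![] v ⊗ₜ[ℂ] zeroModeAction K Sg (toC (b k)) s +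
          ∑ a ∈ S, u v a ⊗ₜ[ℂ] D a (zeroModeAction K Sg (toC (b k)) s)) = 0 :=
      Finset.sum_eq_zero fun k _ => by rw [hmain, map_zero]
    simp only [map_add, map_sum, LinearMap.lTensor_tmul, hzz, Finset.sum_add_distrib,
      Finset.sum_const, Finset.card_univ] at hk
    rw [Finset.sum_comm, ← Nat.cast_smul_eq_nsmul ℂ] at hk
    rw [← hk, Finset.smul_sum]
    congr 1
    refine Finset.sum_congr rfl fun a _ => ?_
    rw [← TensorProduct.tmul_sum, ← TensorProduct.tmul_smul]
    congr 1
    have := LinearMap.congr_fun (sum_conj_zeroModeAction K Sg b hb (a 0).1 (a 1).1) s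
    rw [LinearMap.sum_apply] at this
    exact this.symm
  refine LinearMap.ext fun v => ?_
  obtain ⟨s, hs⟩ := exists_ne (0 : Sg)
  obtain ⟨f, hf⟩ := Module.Projective.exists_dual_eq_one ℂ hs
  have h4 : ω₀ ![] v ⊗ₜ[ℂ] s = 0 := by
    have e1 := hmain v s
    have e2 := hconj v s
    -- The difference of the factors `dim g` and `dim g - 4`.
    have e3 : (4 : ℂ) • (ω₀ ![] v ⊗ₜ[ℂ] s) = 0 := by
      rw [eq_neg_of_add_eq_zero_right e1] at e2
      rw [← e2]
      module
    exact (smul_eq_zero.mp e3).resolve_left (by norm_num)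
  have := congrArg (fun w => TensorProduct.rid ℂ H (LinearMap.lTensor H f w)) h4
  simpa [hf] using this

end Uniqueness

/-! ### Locally finite sums of operators -/

section LocallyFinite

open Filter

variable {A W : Type*} [AddCommGroup W]

/-- The form `∀ᶠ L` lets several infinite sums be truncated at one common `L`, so that their
identities reduce to finite algebra. -/
theorem eventually_finsum_eq_sum {B : ℕ → Finset A} (hB : ∀ a, ∀ᶠ L in atTop, a ∈ B L) {f : A → W}
    (hf : {a | f a ≠ 0}.Finite) : ∀ᶠ L in atTop, ∑ᶠ a, f a = ∑ a ∈ B L, f a := by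
  filter_upwards [(eventually_all_finite hf).mpr fun a _ => hB a] with L hL
  exact finsum_eq_finsetSum_of_support_subset f hL

variable [Module ℂ W]

/-- The sum of a family of operators of which only finitely many are nonzero on each vector. -/
def locallyFiniteSum (T : A → Module.End ℂ W) (hT : ∀ v, {a | T a v ≠ 0}.Finite) :
    Module.End ℂ W where
  toFun v := ∑ᶠ a, T a v
  map_add' v w := by
    simp only [map_add]
    exact finsum_add_distrib (hT v) (hT w)
  map_smul' c v := by
    simp only [map_smul, RingHom.id_apply]
    exact (smul_finsum' c (hT v)).symm

theorem eventually_locallyFiniteSum_apply {B : ℕ → Finset A} (hB : ∀ a, ∀ᶠ L in atTop, a ∈ B L)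
    (T : A → Module.End ℂ W) (hT : ∀ v, {a | T a v ≠ 0}.Finite) (v : W) :
    ∀ᶠ L in atTop, locallyFiniteSum T hT v = ∑ a ∈ B L, T a v :=
  eventually_finsum_eq_sum hB (hT v)

theorem finite_support_tensor {V V' : Type*} [AddCommGroup V] [Module ℂ V] [AddCommGroup V']
    [Module ℂ V'] (T : A → Module.End ℂ (V ⊗[ℂ] V'))
    (h : ∀ v s, {a | T a (v ⊗ₜ s) ≠ 0}.Finite) (w : V ⊗[ℂ] V') : {a | T a w ≠ 0}.Finite := by
  induction w with
  | zero => simp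
  | tmul v s => exact h v s
  | add w w' hw hw' =>
    refine (hw.union hw').subset fun a ha => ?_
    by_contra hn
    simp only [Set.mem_union, Set.mem_ofPred_eq, not_or, not_not] at hn
    exact ha (by rw [map_add, hn.1, hn.2, add_zero])

/-- The elements `(i, n)` of `ι × ℤ` with `|n| ≤ L`. -/
def box (ι : Type*) [Fintype ι] (L : ℕ) : Finset (ι × ℤ) :=
  Finset.univ ×ˢ Finset.Icc (-(L : ℤ)) L

theorem eventually_mem_Icc (n : ℤ) : ∀ᶠ L : ℕ in atTop, n ∈ Finset.Icc (-(L : ℤ)) L := by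
  filter_upwards [eventually_ge_atTop n.natAbs] with L hL
  rw [Finset.mem_Icc]
  omega

theorem eventually_mem_box {ι : Type*} [Fintype ι] (a : ι × ℤ) :
    ∀ᶠ L : ℕ in atTop, a ∈ box ι L := by
  filter_upwards [eventually_mem_Icc a.2] with L hL
  exact Finset.mem_product.mpr ⟨Finset.mem_univ _, hL⟩

theorem eventually_mem_piFinset_box {ι : Type*} [Fintype ι] {k : ℕ} (a : Fin k → ι × ℤ) :
    ∀ᶠ L : ℕ in atTop, a ∈ Fintype.piFinset fun _ : Fin k => box ι L := by
  filter_upwards [eventually_all.mpr fun j => eventually_mem_box (a j)] with L hL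
  exact Fintype.mem_piFinset.mpr hL

omit [Module ℂ W] in
theorem sum_piFinset_one (s : Finset A) (f : A → W) :
    ∑ a ∈ Fintype.piFinset (fun _ : Fin 1 => s), f (a 0) = ∑ p ∈ s, f p := by
  refine Finset.sum_nbij' (fun a => a 0) (fun p _ => p) ?_ ?_ ?_ ?_ ?_
  · intro a ha
    exact Fintype.mem_piFinset.mp ha 0
  · intro p hp
    exact Fintype.mem_piFinset.mpr fun _ => hp
  · intro a _
    funext j
    rw [Subsingleton.elim j 0]
  · intro p _
    rfl
  · intro a _
    rfl

omit [Module ℂ W] in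
theorem sum_piFinset_two (s : Finset A) (f : A → A → W) :
    ∑ a ∈ Fintype.piFinset (fun _ : Fin 2 => s), f (a 0) (a 1) = ∑ p ∈ s, ∑ q ∈ s, f p q := by
  rw [← Finset.sum_product']
  refine Finset.sum_nbij' (fun a => (a 0, a 1)) (fun p => ![p.1, p.2]) ?_ ?_ ?_ ?_ ?_
  · intro a ha
    have := Fintype.mem_piFinset.mp ha
    exact Finset.mem_product.mpr ⟨this 0, this 1⟩
  · intro p hp
    have := Finset.mem_product.mp hp
    refine Fintype.mem_piFinset.mpr fun j => ?_
    fin_cases j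
    · exact this.1
    · exact this.2
  · intro a _
    funext j
    fin_cases j <;> rfl
  · intro p _
    rfl
  · intro a _
    rfl

end LocallyFinite

/-! ### Commutation relations and vanishing of very negative modes -/

section Annihilation

variable {g : Type*} [LieRing g] [LieAlgebra ℝ g] (K : InvariantInnerProduct g)
  (Sg : Type*) [AddCommGroup Sg] [Module ℂ Sg] [Module (CliffordAlgebra (formQ K)) Sg]
  [IsScalarTower ℂ (CliffordAlgebra (formQ K)) Sg]
  (H : Type*) [AddCommGroup H] [Module ℂ H] [LieRingModule (Extended K) H]
  [LieModule ℂ (Extended K) H]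

/-- The operator `r(I)`. -/
def centralOp : Module.End ℂ H := LieModule.toEnd ℂ (Extended K) H (central K)

variable {K H}

theorem extended_eq (x : Extended K) :
    x = x.rot • rotation K + ofLoop K x.loop + x.cen • central K := by
  ext1 <;> simp [rotation, ofLoop, central]

theorem loopAction_mul_sub_mul (ξ η : Loop g) :
    loopAction K H ξ * loopAction K H η - loopAction K H η * loopAction K H ξ =
      loopAction K H ⁅ξ, η⁆ + loopForm K ξ (dTheta η) • centralOp K H := by
  have h : ⁅ofLoop K ξ, ofLoop K η⁆ =
      ofLoop K ⁅ξ, η⁆ + loopForm K ξ (dTheta η) • central K := by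
    ext1 <;> simp [ofLoop, central]
  refine LinearMap.ext fun v => ?_
  change ⁅ofLoop K ξ, ⁅ofLoop K η, v⁆⁆ - ⁅ofLoop K η, ⁅ofLoop K ξ, v⁆⁆ =
    ⁅ofLoop K ⁅ξ, η⁆, v⁆ + loopForm K ξ (dTheta η) • ⁅central K, v⁆
  rw [← lie_lie, h, add_lie, smul_lie]

theorem energyOp_mul_sub_mul (ξ : Loop g) :
    energyOp K H * loopAction K H ξ - loopAction K H ξ * energyOp K H =
      loopAction K H (dTheta ξ) := by
  have h : ⁅rotation K, ofLoop K ξ⁆ = ofLoop K (dTheta ξ) := by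
    ext1 <;> simp [ofLoop, rotation]
  refine LinearMap.ext fun v => ?_
  change ⁅rotation K, ⁅ofLoop K ξ, v⁆⁆ - ⁅ofLoop K ξ, ⁅rotation K, v⁆⁆ = ⁅ofLoop K (dTheta ξ), v⁆
  rw [← lie_lie, h]

theorem centralOp_commute (x : Extended K) :
    Commute (centralOp K H) (LieModule.toEnd ℂ (Extended K) H x) := by
  have h : ⁅central K, x⁆ = 0 := by
    ext1 <;> simp [central]
  refine LinearMap.ext fun v => ?_
  change ⁅central K, ⁅x, v⁆⁆ = ⁅x, ⁅central K, v⁆⁆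
  rw [leibniz_lie, h, zero_lie, zero_add]

/-- Follows from `[∂_θ, X zⁿ] = i n X zⁿ`. -/
theorem loopAction_mono_mem_energySpace {n k : ℤ} (X : Complexified g) {v : H}
    (hv : v ∈ energySpace K H k) : loopAction K H (mono n X) v ∈ energySpace K H (n + k) := by
  rw [energySpace, Module.End.mem_eigenspace_iff] at hv ⊢
  have h := LinearMap.congr_fun (energyOp_mul_sub_mul (K := K) (H := H) (mono n X)) v
  rw [LinearMap.sub_apply, Module.End.mul_apply, Module.End.mul_apply, hv, dTheta_mono, map_smul,
    map_smul, LinearMap.smul_apply, sub_eq_iff_eq_add] at h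
  rw [h, ← add_smul]
  push_cast
  ring_nf

theorem exists_loopAction_eq_zero (hpos : IsPositiveEnergy K H) (v : H) :
    ∃ N : ℕ, ∀ n : ℤ, n < -N → ∀ X, loopAction K H (mono n X) v = 0 := by
  obtain ⟨htop, k₀, hk₀⟩ := hpos
  have hv : v ∈ ⨆ k : ℤ, energySpace K H k := by rw [htop]; trivial
  induction hv using Submodule.iSup_induction' with
  | mem k v hv =>
    refine ⟨(k - k₀).natAbs, fun n hn X => ?_⟩
    have := loopAction_mono_mem_energySpace (n := n) X hv
    rwa [hk₀ _ (by omega), Submodule.mem_bot] at this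
  | zero => exact ⟨0, fun n _ X => map_zero _⟩
  | add v w _ _ hv hw =>
    obtain ⟨N, hN⟩ := hv
    obtain ⟨M, hM⟩ := hw
    refine ⟨N + M, fun n hn X => ?_⟩
    push_cast at hn
    rw [map_add, hN n (by omega), hM n (by omega), add_zero]

/-- Contraction by `X zⁿ` sees only coefficients of `z⁻ⁿ`, and `x` involves finitely many loops with
finitely many modes each. -/
theorem exists_intMul_eq_zero (x : ExteriorAlgebra ℂ (positiveLoops g)) :
    ∃ N : ℕ, ∀ n : ℤ, n < -N → ∀ X, intMul K (mono n X) x = 0 := by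
  induction x using CliffordAlgebra.left_induction with
  | algebraMap r =>
    exact ⟨0, fun n _ X =>
      CliffordAlgebra.contractLeft_algebraMap (Q := (0 : QuadraticForm ℂ (positiveLoops g))) _ r⟩
  | add x y hx hy =>
    obtain ⟨N, hN⟩ := hx
    obtain ⟨M, hM⟩ := hy
    refine ⟨N + M, fun n hn X => ?_⟩
    push_cast at hn
    rw [map_add, hN n (by omega), hM n (by omega), add_zero]
  | ι_mul x y hx =>
    obtain ⟨N, hN⟩ := hx
    have hc : ∃ M : ℕ, ∀ n : ℤ, n < -M → coeff (-n) (y : Loop g) = 0 := by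
      refine ⟨(coeffs (y : Loop g)).support.sup Int.natAbs, fun n hn => ?_⟩
      by_contra h
      have hmem : -n ∈ (coeffs (y : Loop g)).support := Finsupp.mem_support_iff.mpr h
      have := Finset.le_sup (f := Int.natAbs) hmem
      omega
    obtain ⟨M, hM⟩ := hc
    refine ⟨N + M, fun n hn X => ?_⟩
    push_cast at hn
    refine (intMul_ι_mul K (mono n X) y x).trans ?_
    rw [hN n (by omega), loopForm_mono_left, hM n (by omega), map_zero, zero_smul, mul_zero,
      sub_zero]

theorem exists_vectorAction_eq_zero (s : LoopSpin g Sg) :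
    ∃ N : ℕ, ∀ n : ℤ, n < -N → ∀ X, vectorAction K Sg (mono n X) s = 0 := by
  induction s using TensorProduct.induction_on with
  | zero => exact ⟨0, fun n _ X => map_zero _⟩
  | add s s' hs hs' =>
    obtain ⟨N, hN⟩ := hs
    obtain ⟨M, hM⟩ := hs'
    refine ⟨N + M, fun n hn X => ?_⟩
    push_cast at hn
    rw [map_add, hN n (by omega), hM n (by omega), add_zero]
  | tmul s x =>
    obtain ⟨N, hN⟩ := exists_intMul_eq_zero (K := K) x
    refine ⟨N, fun n hn X => ?_⟩
    have h1 : posPart (mono n X) = 0 := by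
      rw [← Submodule.coe_eq_zero, posPart_mono, if_neg (by omega)]
    have h2 : coeff 0 (mono n X) = 0 := by rw [coeff_mono, if_neg (by omega)]
    rw [vectorAction_tmul, hN n hn, extMul_apply, h1, h2]
    simp [zeroModeAction]

variable (K)

theorem normalProduct_eq (ξ η : Loop g) : normalProduct K Sg ξ η =
    cliffordAction K Sg ((normalOrdering K).symm
      (ExteriorAlgebra.ι ℂ ξ * ExteriorAlgebra.ι ℂ η)) := by
  rw [normalOrdering_symm_ι_mul_ι, map_sub, map_mul, cliffordAction_ι, cliffordAction_ι,
    AlgHom.commutes, Algebra.algebraMap_eq_smul_one]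
  rfl

/-- The normal ordered product is the image of `ξ ∧ η` under a linear map. -/
theorem normalProduct_swap (ξ η : Loop g) :
    normalProduct K Sg η ξ = - normalProduct K Sg ξ η := by
  rw [normalProduct_eq, normalProduct_eq, ← map_neg, ← map_neg,
    eq_neg_of_add_eq_zero_left (ExteriorAlgebra.ι_add_mul_swap η ξ)]

/-- The factor is 2 when an annihilation operator stands on the left, 0 when the product is already
in normal order, and 1 for constant modes, which are antisymmetrized. -/
theorem contraction_mono (n k : ℤ) (X Y : Complexified g) :
    contraction K (mono n X) (mono k Y) =
      if n + k = 0 then (if n = 0 then 1 else if n < 0 then 2 else 0) * formC K X Y else 0 := by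
  have hc : contraction K (mono n X) (mono k Y) =
      formC K (coeff 0 (mono n X)) (coeff 0 (mono k Y)) +
        2 * loopForm K (mono n X) (posPart (mono k Y)) := rfl
  rw [hc, coeff_mono, coeff_mono, posPart_mono]
  rcases lt_trichotomy n 0 with hn | rfl | hn
  · rw [if_neg hn.ne, if_neg hn.ne, if_pos hn, map_zero, LinearMap.zero_apply, zero_add]
    by_cases h : n + k = 0
    · rw [if_pos (by omega), if_pos h, loopForm_mono, if_pos h]
    · rw [if_neg h]
      split_ifs
      · rw [loopForm_mono, if_neg h, mul_zero]
      · simp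
  · rw [if_pos rfl, if_pos rfl, zero_add]
    by_cases h : k = 0
    · simp [h]
    · rw [if_neg h, if_neg h]
      split_ifs
      · rw [loopForm_mono, if_neg (by omega)]
        simp
      · simp
  · rw [if_neg hn.ne', if_neg hn.ne', if_neg (by omega : ¬ n < 0), map_zero, LinearMap.zero_apply,
      zero_add, zero_mul, ite_self]
    split_ifs
    · rw [loopForm_mono, if_neg (by omega), mul_zero]
    · simp

variable {Sg}

/-- A negative loop on the right has no constant or positive part, so the contraction vanishes and
the plain product remains. The left version follows by antisymmetry. -/
theorem normalProduct_eq_zero_right {s : LoopSpin g Sg} {n : ℤ} (hn : n < 0)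
    (hs : ∀ X, vectorAction K Sg (mono n X) s = 0) (ξ : Loop g) (X : Complexified g) :
    normalProduct K Sg ξ (mono n X) s = 0 := by
  have hc : contraction K ξ (mono n X) =
      formC K (coeff 0 ξ) (coeff 0 (mono n X)) + 2 * loopForm K ξ (posPart (mono n X)) := rfl
  rw [normalProduct, LinearMap.sub_apply, Module.End.mul_apply, hs, map_zero,
    hc, coeff_mono, posPart_mono, if_neg (by omega), if_neg (by omega)]
  simp

theorem normalProduct_eq_zero_left {s : LoopSpin g Sg} {n : ℤ} (hn : n < 0)
    (hs : ∀ X, vectorAction K Sg (mono n X) s = 0) (ξ : Loop g) (X : Complexified g) :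
    normalProduct K Sg (mono n X) ξ s = 0 := by
  rw [normalProduct_swap, LinearMap.neg_apply, normalProduct_eq_zero_right K hn hs, neg_zero]

end Annihilation

/-! ### The square of `r̂` and its degree 0 part -/

section Existence

open Filter

variable {g : Type*} [LieRing g] [LieAlgebra ℝ g] (K : InvariantInnerProduct g)
  (Sg : Type*) [AddCommGroup Sg] [Module ℂ Sg] [Module (CliffordAlgebra (formQ K)) Sg]
  [IsScalarTower ℂ (CliffordAlgebra (formQ K)) Sg]
  (H : Type*) [AddCommGroup H] [Module ℂ H] [LieRingModule (Extended K) H]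
  [LieModule ℂ (Extended K) H]

/-- The `End H`-valued 2-form `½ [r(ξ), r(η)]`. -/
def halfCommutator : Loop g [⋀^Fin 2]→ₗ[ℂ] Module.End ℂ H where
  toFun a := (1 / 2 : ℂ) • (loopAction K H (a 0) * loopAction K H (a 1) -
    loopAction K H (a 1) * loopAction K H (a 0))
  map_update_add' a i x y := by
    fin_cases i <;> simp [add_mul, mul_add, ← smul_add] <;> abel
  map_update_smul' a i c x := by
    fin_cases i <;> simp [← smul_sub] <;> exact smul_comm _ _ _
  map_eq_zero_of_eq' a i j h hij := by
    have h01 : a 0 = a 1 := by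
      fin_cases i <;> fin_cases j <;> simp_all
    rw [h01, sub_self, smul_zero]

theorem halfCommutator_apply (a : Fin 2 → Loop g) : halfCommutator K H a =
    (1 / 2 : ℂ) • (loopAction K H (a 0) * loopAction K H (a 1) -
      loopAction K H (a 1) * loopAction K H (a 0)) := rfl

theorem rHat_apply (a : Fin 1 → Loop g) : rHat K H a = loopAction K H (a 0) := rfl

variable {K H}

/-- The commutator is a single mode of degree `n + k`, together with a central term that requires `n
+ k = 0`. -/
theorem halfCommutator_mono_eq_zero {M : ℕ} {v : H}
    (hM : ∀ n : ℤ, n < -M → ∀ X, loopAction K H (mono n X) v = 0) {n k : ℤ} (hnk : n + k < -M)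
    (X Y : Complexified g) (a : Fin 2 → Loop g) (h0 : a 0 = mono n X) (h1 : a 1 = mono k Y) :
    halfCommutator K H a v = 0 := by
  rw [halfCommutator_apply, h0, h1, loopAction_mul_sub_mul, mono_lie, dTheta_mono, map_smul,
    loopForm_mono, if_neg (by omega), smul_zero, zero_smul, add_zero, LinearMap.smul_apply,
    hM _ hnk, smul_zero]

variable {ι : Type*} [Fintype ι] (b : ι → g)

/-- On a pure tensor, `r(Xᵢ zⁿ)` bounds `n` from below and `c(Xᵢ z⁻ⁿ)` bounds it from above. -/
theorem finite_formTerm_rHat (hpos : IsPositiveEnergy K H) (w : H ⊗[ℂ] LoopSpin g Sg) :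
    {a : Fin 1 → ι × ℤ | formTerm K Sg b (rHat K H) a w ≠ 0}.Finite := by
  refine finite_support_tensor _ (fun v s => ?_) w
  obtain ⟨M, hM⟩ := exists_loopAction_eq_zero hpos v
  obtain ⟨N, hN⟩ := exists_vectorAction_eq_zero (K := K) Sg s
  refine (Finset.finite_toSet (Fintype.piFinset fun _ : Fin 1 => box ι (M + N))).subset
    fun a ha => ?_
  rw [Finset.mem_coe, Fintype.mem_piFinset]
  intro j
  obtain rfl := Subsingleton.elim 0 j
  rw [box, Finset.mem_product, Finset.mem_Icc]
  refine ⟨Finset.mem_univ _, ?_⟩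
  rw [Set.mem_ofPred_eq, formTerm_one, TensorProduct.map_tmul] at ha
  push_cast
  constructor
  · by_contra h
    exact ha (by rw [rHat_apply, hM _ (by omega), TensorProduct.zero_tmul])
  · by_contra h
    exact ha (by rw [hN _ (by omega), TensorProduct.tmul_zero])

/-- Normal ordering bounds both degrees from above, and the commutator bounds their sum from below.
-/
theorem finite_formTerm_halfCommutator (hpos : IsPositiveEnergy K H) (w : H ⊗[ℂ] LoopSpin g Sg) :
    {a : Fin 2 → ι × ℤ | formTerm K Sg b (halfCommutator K H) a w ≠ 0}.Finite := by
  refine finite_support_tensor _ (fun v s => ?_) w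
  obtain ⟨M, hM⟩ := exists_loopAction_eq_zero hpos v
  obtain ⟨N, hN⟩ := exists_vectorAction_eq_zero (K := K) Sg s
  refine (Finset.finite_toSet (Fintype.piFinset fun _ : Fin 2 => box ι (M + N))).subset
    fun a ha => ?_
  rw [Finset.mem_coe, Fintype.mem_piFinset]
  rw [Set.mem_ofPred_eq, formTerm_two, TensorProduct.map_tmul] at ha
  have h0 : (a 0).2 ≤ N := by
    by_contra h
    exact ha (by rw [normalProduct_eq_zero_left K (by omega) (hN _ (by omega)),
      TensorProduct.tmul_zero])
  have h1 : (a 1).2 ≤ N := by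
    by_contra h
    exact ha (by rw [normalProduct_eq_zero_right K (by omega) (hN _ (by omega)),
      TensorProduct.tmul_zero])
  have h2 : -(M : ℤ) ≤ (a 0).2 + (a 1).2 := by
    by_contra h
    exact ha (by rw [halfCommutator_mono_eq_zero hM (not_le.mp h) _ _ _ rfl rfl,
      TensorProduct.zero_tmul])
  intro j
  rw [box, Finset.mem_product, Finset.mem_Icc]
  refine ⟨Finset.mem_univ _, ?_⟩
  push_cast
  fin_cases j <;> constructor <;> simp <;> omega

variable (K H)

/-- The operator `∑ᵢ r(Xᵢ zⁿ) r(Xᵢ z⁻ⁿ)`. -/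
def modeSum (n : ℤ) : Module.End ℂ H :=
  ∑ i, loopAction K H (mono n (toC (b i))) * loopAction K H (mono (-n) (toC (b i)))

/-- The multiplicity of the modes of degree `n` in the normal ordered Casimir operator. -/
def modeWeight (n : ℤ) : ℂ := if n = 0 then 1 else if 0 < n then 2 else 0

variable {K H}

theorem finite_modeSum (hpos : IsPositiveEnergy K H) (v : H) :
    {n : ℤ | (modeWeight n • modeSum K H b n) v ≠ 0}.Finite := by
  obtain ⟨M, hM⟩ := exists_loopAction_eq_zero hpos v
  refine (Set.finite_Icc (0 : ℤ) M).subset fun n hn => ?_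
  constructor
  · by_contra h
    apply hn
    rw [modeWeight, if_neg (by omega), if_neg (by omega), zero_smul, LinearMap.zero_apply]
  · by_contra h
    apply hn
    rw [LinearMap.smul_apply, modeSum, LinearMap.sum_apply]
    rw [Finset.sum_eq_zero fun i _ => ?_, smul_zero]
    rw [Module.End.mul_apply, hM _ (by omega), map_zero]

/-- The normal ordered operator `∑ᵢ r(Xᵢ)² + 2 ∑_{n > 0} ∑ᵢ r(Xᵢ zⁿ) r(Xᵢ z⁻ⁿ)`. -/
def normalSquare (hpos : IsPositiveEnergy K H) : Module.End ℂ H :=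
  locallyFiniteSum (fun n => modeWeight n • modeSum K H b n) (finite_modeSum b hpos)

theorem eventually_normalSquare (hpos : IsPositiveEnergy K H) (v : H) :
    ∀ᶠ L : ℕ in atTop, normalSquare b hpos v =
      ∑ n ∈ Finset.Icc (-(L : ℤ)) L, modeWeight n • modeSum K H b n v :=
  eventually_locallyFiniteSum_apply eventually_mem_Icc _ (finite_modeSum b hpos) v

/-- The only partner of `(i, n)` with nonzero contraction is `(i, -n)`. The box is symmetric, so it
contains that partner. -/
theorem sum_contraction (b : Module.Basis ι ℝ g) (hb : K.IsOrthonormal b) (L : ℕ) :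
    ∑ p ∈ box ι L, ∑ q ∈ box ι L,
      contraction K (mono (-p.2) (toC (b p.1))) (mono (-q.2) (toC (b q.1))) •
        (loopAction K H (mono p.2 (toC (b p.1))) * loopAction K H (mono q.2 (toC (b q.1)))) =
      ∑ n ∈ Finset.Icc (-(L : ℤ)) L, modeWeight n • modeSum K H b n := by
  classical
  rw [box, Finset.sum_product, Finset.sum_comm]
  refine Finset.sum_congr rfl fun n hn => ?_
  rw [modeSum, Finset.smul_sum]
  refine Finset.sum_congr rfl fun i _ => ?_
  rw [Finset.mem_Icc] at hn
  rw [Finset.sum_eq_single (i, -n)]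
  · rw [contraction_mono, if_pos (by simp), formC_toC, (hb i i).1 rfl, modeWeight]
    simp
  · rintro ⟨j, k⟩ _ hjk
    rw [contraction_mono]
    split_ifs with h
    · have hij : i ≠ j := by
        rintro rfl
        exact hjk (Prod.ext rfl (by simp only at h ⊢; omega))
      rw [formC_toC, (hb i j).2 hij]
      simp
    all_goals try (rw [formC_toC, (hb i j).2 (by
        rintro rfl
        exact hjk (Prod.ext rfl (by simp only at h ⊢; omega)))]; simp)
    simp
  · intro h
    exact absurd (Finset.mem_product.mpr ⟨Finset.mem_univ _, Finset.mem_Icc.mpr ⟨by simp; omega,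
      by simp; omega⟩⟩) h

theorem tensorMap_neg_right {V V' : Type*} [AddCommGroup V] [Module ℂ V] [AddCommGroup V']
    [Module ℂ V'] (A : Module.End ℂ V) (B : Module.End ℂ V') :
    TensorProduct.map A (-B) = -TensorProduct.map A B :=
  TensorProduct.ext' fun x y => by simp [TensorProduct.tmul_neg]

/-- The square of the operator `r̂` is the sum of the form of degree 0 given by `normalSquare` and
a form of degree 2. -/
theorem isLoopCasimir_normalSquare (b : Module.Basis ι ℝ g) (hb : K.IsOrthonormal b)
    (hpos : IsPositiveEnergy K H) :
    IsLoopCasimir K Sg b (-(1 / 2 : ℂ) • normalSquare b hpos) := by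
  have hR := finite_formTerm_rHat (K := K) Sg b hpos
  have h2 := finite_formTerm_halfCommutator (K := K) Sg b hpos
  let ω₀ : Loop g [⋀^Fin 0]→ₗ[ℂ] Module.End ℂ H :=
    AlternatingMap.constOfIsEmpty ℂ (Loop g) (Fin 0) (normalSquare b hpos)
  refine ⟨locallyFiniteSum _ hR, TensorProduct.map (normalSquare b hpos) 1,
    locallyFiniteSum _ h2, ω₀, halfCommutator K H, fun w => ⟨hR w, rfl⟩,
    fun w => ⟨Set.toFinite _, ?_⟩, fun w => ⟨h2 w, rfl⟩, ?_, rfl⟩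
  · rw [finsum_unique, formTerm_zero]
    rfl
  let r : ι × ℤ → Module.End ℂ H := fun p => loopAction K H (mono p.2 (toC (b p.1)))
  let ξ : ι × ℤ → Loop g := fun p => mono (-p.2) (toC (b p.1))
  let N : ι × ℤ → ι × ℤ → Module.End ℂ (LoopSpin g Sg) := fun p q => normalProduct K Sg (ξ p) (ξ q)
  -- Exchanging `p` and `q` changes the sign of `N`, so only the antisymmetric part of `r p * r q`
  -- contributes.
  have hswap : ∀ s : Finset (ι × ℤ), ∑ p ∈ s, ∑ q ∈ s, TensorProduct.map (r p * r q) (N p q) =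
      ∑ p ∈ s, ∑ q ∈ s,
        TensorProduct.map ((1 / 2 : ℂ) • (r p * r q - r q * r p)) (N p q) := fun s => by
    have e1 : ∑ p ∈ s, ∑ q ∈ s, TensorProduct.map (r q * r p) (N p q) =
        -∑ p ∈ s, ∑ q ∈ s, TensorProduct.map (r p * r q) (N p q) := by
      rw [Finset.sum_comm, ← Finset.sum_neg_distrib]
      refine Finset.sum_congr rfl fun p _ => ?_
      rw [← Finset.sum_neg_distrib]
      refine Finset.sum_congr rfl fun q _ => ?_
      rw [show N q p = -N p q from normalProduct_swap K Sg _ _, tensorMap_neg_right]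
    have e2 : ∀ p q, TensorProduct.map ((1 / 2 : ℂ) • (r p * r q - r q * r p)) (N p q) =
        (1 / 2 : ℂ) • (TensorProduct.map (r p * r q) (N p q) -
          TensorProduct.map (r q * r p) (N p q)) := fun p q => by
      rw [TensorProduct.map_smul_left]
      congr 1
      refine eq_sub_of_add_eq ?_
      rw [← TensorProduct.map_add_left, sub_add_cancel]
    simp only [e2, ← Finset.smul_sum, Finset.sum_sub_distrib, e1]
    module
  have hprod : ∀ p q, TensorProduct.map (r p) (vectorAction K Sg (ξ p)) *
      TensorProduct.map (r q) (vectorAction K Sg (ξ q)) = TensorProduct.map (r p * r q) (N p q) +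
        TensorProduct.map (contraction K (ξ p) (ξ q) • (r p * r q)) 1 := fun p q => by
    rw [← TensorProduct.map_mul, TensorProduct.map_smul_left, ← TensorProduct.map_smul_right,
      ← TensorProduct.map_add_right]
    congr 1
    exact (sub_add_cancel _ _).symm
  refine TensorProduct.ext' fun v s => ?_
  have hRL := fun w => eventually_locallyFiniteSum_apply
    (B := fun L => Fintype.piFinset fun _ : Fin 1 => box ι L) eventually_mem_piFinset_box _ hR w
  have hR' : ∀ (L : ℕ) (w : H ⊗[ℂ] LoopSpin g Sg),
      ∑ a ∈ Fintype.piFinset fun _ : Fin 1 => box ι L, formTerm K Sg b (rHat K H) a w =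
        ∑ p ∈ box ι L, TensorProduct.map (r p) (vectorAction K Sg (ξ p)) w := fun L w => by
    simp only [formTerm_one]
    exact sum_piFinset_one (box ι L) fun p =>
      TensorProduct.map (r p) (vectorAction K Sg (ξ p)) w
  have h2L := eventually_locallyFiniteSum_apply
    (B := fun L => Fintype.piFinset fun _ : Fin 2 => box ι L) eventually_mem_piFinset_box _ h2
      (v ⊗ₜ s)
  -- One truncation that is exact for the inner `R`, for the outer `R` applied to its result, for
  -- the 2-form and for `normalSquare`.
  obtain ⟨L, h1, h2, h3, h4⟩ := ((hRL (v ⊗ₜ s)).and ((hRL (locallyFiniteSum _ hR (v ⊗ₜ s))).and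
    (h2L.and (eventually_normalSquare b hpos v)))).exists
  have h5 : ∑ a ∈ Fintype.piFinset fun _ : Fin 2 => box ι L,
      formTerm K Sg b (halfCommutator K H) a (v ⊗ₜ s) = ∑ p ∈ box ι L, ∑ q ∈ box ι L,
        TensorProduct.map ((1 / 2 : ℂ) • (r p * r q - r q * r p)) (N p q) (v ⊗ₜ s) := by
    rw [← sum_piFinset_two (box ι L) fun p q =>
      TensorProduct.map ((1 / 2 : ℂ) • (r p * r q - r q * r p)) (N p q) (v ⊗ₜ s)]
    refine Finset.sum_congr rfl fun a _ => ?_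
    rw [formTerm_two, halfCommutator_apply]
  have h6 := LinearMap.congr_fun (sum_contraction (H := H) b hb L) v
  have h7 := LinearMap.congr_fun (hswap (box ι L)) (v ⊗ₜ s)
  rw [Module.End.mul_apply, h2, hR', h1, hR', LinearMap.add_apply, h3, h5]
  have h8 : ∑ p ∈ box ι L, TensorProduct.map (r p) (vectorAction K Sg (ξ p))
      (∑ q ∈ box ι L, TensorProduct.map (r q) (vectorAction K Sg (ξ q)) (v ⊗ₜ s)) =
      ∑ p ∈ box ι L, ∑ q ∈ box ι L, (TensorProduct.map (r p * r q) (N p q) (v ⊗ₜ s) +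
        TensorProduct.map (contraction K (ξ p) (ξ q) • (r p * r q)) 1 (v ⊗ₜ s)) := by
    refine Finset.sum_congr rfl fun p _ => ?_
    rw [map_sum]
    refine Finset.sum_congr rfl fun q _ => ?_
    exact LinearMap.congr_fun (hprod p q) (v ⊗ₜ s)
  rw [h8]
  simp only [LinearMap.sum_apply] at h6 h7
  simp only [Finset.sum_add_distrib]
  refine (congrArg₂ (· + ·) h7 ?_).trans (add_comm _ _)
  simp only [TensorProduct.map_tmul, Module.End.one_apply, ← TensorProduct.sum_tmul]
  rw [h4]
  exact congrArg (fun w => w ⊗ₜ[ℂ] s) h6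

/-- The Casimir operator of the loop algebra is unique, and given by `normalSquare`. -/
theorem isLoopCasimir_iff [IsSimpleModule (CliffordAlgebra (formQ K)) Sg]
    (b : Module.Basis ι ℝ g) (hb : K.IsOrthonormal b)
    (hpos : IsPositiveEnergy K H) (Δ : Module.End ℂ H) :
    IsLoopCasimir K Sg b Δ ↔ Δ = -(1 / 2 : ℂ) • normalSquare b hpos := by
  have : Nontrivial Sg := IsSimpleModule.nontrivial (CliffordAlgebra (formQ K)) Sg
  constructor
  · intro h
    obtain ⟨R, A₀, A₂, ω₀, ω₂, hR, h₀, h₂, h, rfl⟩ := h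
    obtain ⟨R', A₀', A₂', ω₀', ω₂', hR', h₀', h₂', h', e⟩ :=
      isLoopCasimir_normalSquare (K := K) Sg b hb hpos
    obtain rfl := hR.unique hR'
    -- The difference of two decompositions of the same `R * R` is a decomposition of zero.
    have hsub := zero_form_eq_zero b hb (h₀.sub h₀') (h₂.sub h₂') (by
      rw [h] at h'
      rw [sub_add_sub_comm, h', sub_self])
    rw [e, ← sub_eq_zero, ← smul_sub, ← AlternatingMap.sub_apply, hsub, smul_zero]
  · rintro rfl
    exact isLoopCasimir_normalSquare Sg b hb hpos

end Existence

/-! ### Telescoping sums over the modes -/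

section TailSums

open Filter

variable {W : Type*} [AddCommGroup W] [Module ℂ W]

/-- The sum of the values of `f` at the integers `k ≤ n < N`. -/
def tailSum (N : ℤ) (f : ℤ → W) (k : ℤ) : W := ∑ j ∈ Finset.range (N - k).toNat, f (k + j)

omit [Module ℂ W] in
theorem tailSum_eq_add {N : ℤ} {f : ℤ → W} (hf : ∀ n, N ≤ n → f n = 0) (k : ℤ) :
    tailSum N f k = f k + tailSum N f (k + 1) := by
  rcases lt_or_ge k N with h | h
  · rw [tailSum, tailSum, show (N - k).toNat = (N - (k + 1)).toNat + 1 by omega,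
      Finset.sum_range_succ', add_comm]
    congr 1
    · simp
    · refine Finset.sum_congr rfl fun j _ => ?_
      congr 1
      push_cast
      ring
  · rw [tailSum, tailSum, hf k h, show (N - k).toNat = 0 by omega,
      show (N - (k + 1)).toNat = 0 by omega]
    simp

omit [Module ℂ W] in
theorem sum_range_eq_tailSum {N : ℤ} {f : ℤ → W} (hf : ∀ n, N ≤ n → f n = 0) {k : ℤ} {L : ℕ}
    (hL : N ≤ k + L) : ∑ j ∈ Finset.range L, f (k + j) = tailSum N f k := by
  refine (Finset.sum_subset (Finset.range_mono (by omega)) fun j _ hj => hf _ ?_).symm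
  rw [Finset.mem_range] at hj
  omega

/-- Negative modes carry weight zero, so only the constant mode and the doubled positive modes
remain. -/
theorem sum_modeWeight (L : ℕ) (f : ℤ → W) :
    ∑ n ∈ Finset.Icc (-(L : ℤ)) L, modeWeight n • f n =
      f 0 + (2 : ℂ) • ∑ j ∈ Finset.range L, f (1 + j) := by
  have h : ∑ n ∈ (Finset.range (L + 1)).map Nat.castEmbedding, modeWeight n • f n =
      ∑ n ∈ Finset.Icc (-(L : ℤ)) L, modeWeight n • f n := by
    refine Finset.sum_subset (fun n hn => ?_) fun n hn hn' => ?_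
    · obtain ⟨j, hj, rfl⟩ := Finset.mem_map.mp hn
      rw [Finset.mem_range] at hj
      simp only [Nat.castEmbedding_apply, Finset.mem_Icc]
      omega
    · rw [Finset.mem_Icc] at hn
      rw [modeWeight]
      have : ¬ 0 ≤ n := fun h0 => hn' (Finset.mem_map.mpr
        ⟨n.toNat, Finset.mem_range.mpr (by omega), by simp [h0]⟩)
      rw [if_neg (by omega), if_neg (by omega), zero_smul]
  rw [← h, Finset.sum_map, Finset.sum_range_succ', add_comm, Finset.smul_sum]
  congr 1
  · simp [modeWeight]
  · refine Finset.sum_congr rfl fun j _ => ?_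
    rw [Nat.castEmbedding_apply, modeWeight, if_neg (by omega), if_pos (by omega)]
    push_cast
    rw [add_comm]

/-- If `f n + f (m - n)` is independent of `n`, then the sum of the differences `f (n + m) - f n`
telescopes. -/
theorem sum_modeWeight_telescope {N m : ℤ} {f : ℤ → W} {w : W} (hf : ∀ n, N ≤ n → f n = 0)
    (hw : ∀ n, f n + f (m - n) = w) {L : ℕ} (hL : N ≤ L) (hL' : N ≤ m + L) :
    ∑ n ∈ Finset.Icc (-(L : ℤ)) L, modeWeight n • (f (n + m) - f n) = -((m : ℂ) • w) := by
  have hG := tailSum_eq_add hf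
  -- Increasing `j` by one changes the left side by `-(f j + f (m - j)) = -w`, so it is affine in
  -- `j`. Its value at `j = m` is what is needed, for `m` of either sign.
  have hQ : ∀ j : ℤ, tailSum N f j - tailSum N f (m + 1 - j) =
      tailSum N f 0 - tailSum N f (m + 1) - (j : ℂ) • w := fun j => by
    have hstep : ∀ j : ℤ, tailSum N f (j + 1) - tailSum N f (m + 1 - (j + 1)) =
        tailSum N f j - tailSum N f (m + 1 - j) - w := fun j => by
      rw [hG j, show m + 1 - (j + 1) = m - j by ring, hG (m - j), ← hw j,
        show m - j + 1 = m + 1 - j by ring]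
      abel
    induction j using Int.induction_on with
    | zero => simp
    | succ i ih =>
      rw [hstep, ih]
      push_cast
      module
    | pred i ih =>
      have := hstep (-(i : ℤ) - 1)
      rw [sub_add_cancel, ih] at this
      rw [eq_sub_iff_add_eq] at this
      rw [← this]
      push_cast
      module
  rw [sum_modeWeight L fun n => f (n + m) - f n, Finset.sum_sub_distrib,
    sum_range_eq_tailSum hf (by omega)]
  have h1 : ∑ j ∈ Finset.range L, f (1 + j + m) = tailSum N f (m + 1) := by
    rw [← sum_range_eq_tailSum hf (k := m + 1) (L := L) (by omega)]
    refine Finset.sum_congr rfl fun j _ => ?_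
    congr 1
    ring
  have h2 := hQ m
  have h3 := hG 0
  have h4 := hG m
  rw [show m + 1 - m = 1 by ring] at h2
  rw [zero_add] at h3 ⊢
  rw [h1, eq_sub_of_add_eq h4.symm, eq_sub_of_add_eq h3.symm]
  have h5 : (m : ℂ) • w = tailSum N f 0 - tailSum N f (m + 1) -
      (tailSum N f m - tailSum N f 1) := by
    rw [h2]
    abel
  rw [h5]
  module

/-- The central term of the commutator with `X z^m` occurs at `n = m` and `n = -m`; normal ordering
always counts it twice in total. -/
theorem modeWeight_add_neg (m : ℤ) : modeWeight m + modeWeight (-m) = 2 := by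
  rcases lt_trichotomy m 0 with h | rfl | h
  · rw [modeWeight, modeWeight, if_neg h.ne, if_neg (by omega), if_neg (by omega),
      if_pos (by omega), zero_add]
  · norm_num [modeWeight]
  · rw [modeWeight, modeWeight, if_neg h.ne', if_pos h, if_neg (by omega), if_neg (by omega),
      add_zero]

end TailSums

/-! ### Commutators of the normal ordered square with loops and energy -/

section Commutator

open Filter

variable {g : Type*} [LieRing g] [LieAlgebra ℝ g] {K : InvariantInnerProduct g}
  {H : Type*} [AddCommGroup H] [Module ℂ H] [LieRingModule (Extended K) H]
  [LieModule ℂ (Extended K) H]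

/-- The linear map `X ↦ X zⁿ`. -/
def monoLinear (n : ℤ) : Complexified g →ₗ[ℂ] Loop g where
  toFun := mono n
  map_add' X Y := coeffs.injective (by
    rw [map_add, coeffs_mono, coeffs_mono, coeffs_mono, Finsupp.single_add])
  map_smul' a X := coeffs.injective (by
    rw [RingHom.id_apply, map_smul, coeffs_mono, coeffs_mono, Finsupp.smul_single])

variable (K H) in
/-- The operator `r(X zⁿ)`, as a linear function of `X`. -/
def modeAction (n : ℤ) : Complexified g →ₗ[ℂ] Module.End ℂ H := loopAction K H ∘ₗ monoLinear n

theorem modeAction_apply (n : ℤ) (X : Complexified g) :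
    modeAction K H n X = loopAction K H (mono n X) := rfl

theorem modeAction_mul_sub_mul (n k : ℤ) (X Y : Complexified g) :
    modeAction K H n X * modeAction K H k Y - modeAction K H k Y * modeAction K H n X =
      modeAction K H (n + k) ⁅X, Y⁆ +
        (if n + k = 0 then Complex.I * k * formC K X Y else 0) • centralOp K H := by
  rw [modeAction_apply, modeAction_apply, modeAction_apply, loopAction_mul_sub_mul, mono_lie,
    dTheta_mono, map_smul, loopForm_mono, smul_eq_mul, mul_ite, mul_zero]

theorem energyOp_modeAction (n : ℤ) (X : Complexified g) :
    energyOp K H * modeAction K H n X =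
      modeAction K H n X * energyOp K H + (Complex.I * n) • modeAction K H n X := by
  rw [modeAction_apply, ← map_smul, ← dTheta_mono, ← energyOp_mul_sub_mul]
  abel

variable {ι : Type*} [Fintype ι] (b : Module.Basis ι ℝ g) (hb : K.IsOrthonormal b)

theorem modeSum_eq (n : ℤ) : modeSum K H b n =
    ∑ i, modeAction K H n (toC (b i)) * modeAction K H (-n) (toC (b i)) := rfl

variable (K H) in
/-- The operator `∑ᵢ r([Xᵢ, X] zⁿ) r(Xᵢ zᵏ)`. -/
def crossSum (X : Complexified g) (n k : ℤ) : Module.End ℂ H :=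
  ∑ i, modeAction K H n ⁅toC (b i), X⁆ * modeAction K H k (toC (b i))

include hb

/-- Invariance of the Casimir tensor moves `ad X` to the other factor at the cost of a sign. -/
theorem crossSum_eq_neg (X : Complexified g) (n k : ℤ) : crossSum K H b X n k =
    -∑ i, modeAction K H n (toC (b i)) * modeAction K H k ⁅toC (b i), X⁆ := by
  have h := sum_lie_tmul K b hb X
    ((LinearMap.mul ℂ (Module.End ℂ H)).compl₁₂ (modeAction K H n) (modeAction K H k))
  simp only [LinearMap.compl₁₂_apply, LinearMap.mul_apply'] at h
  rw [crossSum]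
  simp only [← lie_skew X, map_neg, neg_mul, mul_neg, Finset.sum_neg_distrib] at h ⊢
  simpa [neg_eq_iff_eq_neg] using h

/-- By the Leibniz rule, the loop brackets with the two factors give cross sums that differ by the
shift `n ↦ n + m`, and a sign after moving `ad X`. This is the shape that telescopes. The cocycle
contributes only at `n = ±m`. -/
theorem modeSum_commutator (n m : ℤ) (X : Complexified g) :
    modeSum K H b n * modeAction K H m X - modeAction K H m X * modeSum K H b n =
      crossSum K H b X (n + m) (m - (n + m)) - crossSum K H b X n (m - n) +
        ((if n = m then 1 else 0) + (if n = -m then 1 else 0) : ℂ) •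
          ((Complex.I * m) • (modeAction K H m X * centralOp K H)) := by
  have hX : ∀ k, ∑ i, formC K (toC (b i)) X • modeAction K H k (toC (b i)) =
      modeAction K H k X := fun k => by
    conv_rhs => rw [← sum_formC_smul K b hb X]
    simp only [map_sum, map_smul, formC_symm K X]
  have hI : ∀ k Y, centralOp K H * modeAction K H k Y = modeAction K H k Y * centralOp K H :=
    fun k Y => centralOp_commute _
  have hi : ∀ i, modeAction K H n (toC (b i)) * modeAction K H (-n) (toC (b i)) *
      modeAction K H m X - modeAction K H m X *
        (modeAction K H n (toC (b i)) * modeAction K H (-n) (toC (b i))) =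
      modeAction K H n (toC (b i)) * modeAction K H (m - n) ⁅toC (b i), X⁆ +
        modeAction K H (n + m) ⁅toC (b i), X⁆ * modeAction K H (-n) (toC (b i)) +
        ((if -n + m = 0 then Complex.I * m else 0) • (formC K (toC (b i)) X •
          modeAction K H n (toC (b i))) +
        (if n + m = 0 then Complex.I * m else 0) • (formC K (toC (b i)) X •
          modeAction K H (-n) (toC (b i)))) * centralOp K H := fun i => by
    have h1 := modeAction_mul_sub_mul (K := K) (H := H) n m (toC (b i)) X
    have h2 := modeAction_mul_sub_mul (K := K) (H := H) (-n) m (toC (b i)) X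
    have h3 : ∀ A B C : Module.End ℂ H, A * B * C - C * (A * B) =
        A * (B * C - C * B) + (A * C - C * A) * B := fun A B C => by noncomm_ring
    rw [h3, h1, h2, mul_add, add_mul, add_mul, mul_smul_comm, smul_mul_assoc, hI,
      show -n + m = m - n by ring]
    simp only [smul_smul, smul_mul_assoc, ite_mul, zero_mul]
    abel
  rw [modeSum_eq, Finset.sum_mul, Finset.mul_sum, ← Finset.sum_sub_distrib]
  simp only [hi, Finset.sum_add_distrib, ← Finset.sum_mul, ← Finset.smul_sum, hX]
  rw [crossSum_eq_neg b hb X n, show m - (n + m) = -n by ring, ← crossSum]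
  have h4 : (if -n + m = 0 then Complex.I * m else 0) • modeAction K H n X =
      ((if n = m then 1 else 0 : ℂ) * (Complex.I * m)) • modeAction K H m X := by
    by_cases h : n = m
    · rw [h]; simp
    · rw [if_neg (by omega), if_neg h]; simp
  have h5 : (if n + m = 0 then Complex.I * m else 0) • modeAction K H (-n) X =
      ((if n = -m then 1 else 0 : ℂ) * (Complex.I * m)) • modeAction K H m X := by
    by_cases h : n = -m
    · rw [h]; simp
    · rw [if_neg (by omega), if_neg h]; simp
  rw [h4, h5, ← add_smul, smul_mul_assoc, smul_smul, add_mul]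
  abel

/-- The two terms form a commutator, which collapses to `-r(∑ᵢ [Xᵢ, [Xᵢ, X]] z^m)`; here the adjoint
Casimir enters. The cocycle drops out because `⟨[Xᵢ, X], Xᵢ⟩ = 0`. -/
theorem crossSum_add {c : ℂ}
    (hc : ∀ X : Complexified g, ∑ i, ⁅toC (b i), ⁅toC (b i), X⁆⁆ = -(2 * c) • X)
    (X : Complexified g) (n m : ℤ) :
    crossSum K H b X n (m - n) + crossSum K H b X (m - n) n = (2 * c) • modeAction K H m X := by
  rw [crossSum_eq_neg b hb X (m - n) n, crossSum, ← sub_eq_add_neg, ← Finset.sum_sub_distrib]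
  have hi : ∀ i, modeAction K H n ⁅toC (b i), X⁆ * modeAction K H (m - n) (toC (b i)) -
      modeAction K H (m - n) (toC (b i)) * modeAction K H n ⁅toC (b i), X⁆ =
      -modeAction K H m ⁅toC (b i), ⁅toC (b i), X⁆⁆ := fun i => by
    have h0 : formC K ⁅toC (b i), X⁆ (toC (b i)) = 0 := by
      rw [formC_lie_left, lie_self, map_zero, neg_zero]
    rw [modeAction_mul_sub_mul, h0, mul_zero, ite_self, zero_smul, add_zero, add_sub_cancel,
      ← lie_skew, map_neg]
  simp only [hi]
  rw [Finset.sum_neg_distrib, ← map_sum, hc, map_smul]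
  module

theorem normalSquare_commutator (hpos : IsPositiveEnergy K H) {c : ℂ}
    (hc : ∀ X : Complexified g, ∑ i, ⁅toC (b i), ⁅toC (b i), X⁆⁆ = -(2 * c) • X)
    (m : ℤ) (X : Complexified g) :
    normalSquare b hpos * modeAction K H m X - modeAction K H m X * normalSquare b hpos =
      (2 * Complex.I * m) • (modeAction K H m X * centralOp K H) -
        (2 * m * c) • modeAction K H m X := by
  refine LinearMap.ext fun v => ?_
  obtain ⟨M, hM⟩ := exists_loopAction_eq_zero hpos v
  obtain ⟨L, h1, h2, h3, h4⟩ := ((eventually_normalSquare b hpos (modeAction K H m X v)).and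
    -- The lower bound on `L` leaves room for the shift by `m`, of either sign, in the telescoping
    -- sum.
    ((eventually_normalSquare b hpos v).and ((eventually_mem_Icc m).and
      (eventually_ge_atTop (M + 2 * m.natAbs + 1))))).exists
  rw [LinearMap.sub_apply, Module.End.mul_apply, Module.End.mul_apply, h1, h2, map_sum,
    ← Finset.sum_sub_distrib]
  have hn : ∀ n : ℤ, modeWeight n • modeSum K H b n (modeAction K H m X v) -
      modeAction K H m X (modeWeight n • modeSum K H b n v) =
      modeWeight n • (crossSum K H b X (n + m) (m - (n + m)) v - crossSum K H b X n (m - n) v) +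
        (if n = m then modeWeight n else 0) •
          ((Complex.I * m) • (modeAction K H m X (centralOp K H v))) +
        (if n = -m then modeWeight n else 0) •
          ((Complex.I * m) • (modeAction K H m X (centralOp K H v))) := fun n => by
    have := LinearMap.congr_fun (modeSum_commutator (H := H) b hb n m X) v
    simp only [LinearMap.sub_apply, LinearMap.add_apply, Module.End.mul_apply,
      LinearMap.smul_apply] at this
    rw [map_smul, ← smul_sub, this, smul_add, add_smul, smul_add, ← add_assoc]
    split_ifs <;> simp only [one_smul, zero_smul, smul_zero]
  simp only [hn, Finset.sum_add_distrib, ← Finset.sum_smul]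
  -- From `n = M + m + 1` on, the right factor has degree `m - n < -M` and kills `v`.
  rw [sum_modeWeight_telescope (N := M + m + 1) (m := m) (w := (2 * c) • modeAction K H m X v)
    (f := fun n => crossSum K H b X n (m - n) v)]
  · rw [Finset.sum_ite_eq' , Finset.sum_ite_eq', if_pos h3, if_pos (by
      rw [Finset.mem_Icc] at h3 ⊢; omega), add_assoc, ← add_smul, modeWeight_add_neg]
    simp only [LinearMap.sub_apply, LinearMap.smul_apply, Module.End.mul_apply]
    module
  · intro n hn
    rw [crossSum, LinearMap.sum_apply]
    refine Finset.sum_eq_zero fun i _ => ?_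
    rw [Module.End.mul_apply, modeAction_apply _ (toC (b i)), hM _ (by omega), map_zero]
  · intro n
    have := LinearMap.congr_fun (crossSum_add (H := H) b hb hc X n m) v
    rw [sub_sub_cancel]
    exact this
  · omega
  · omega

omit hb in
-- Each product `r(Xᵢ zⁿ) r(Xᵢ z⁻ⁿ)` preserves energy.
theorem energyOp_commute_normalSquare (hpos : IsPositiveEnergy K H) :
    Commute (energyOp K H) (normalSquare b hpos) := by
  have hn : ∀ n, Commute (energyOp K H) (modeSum K H b n) := fun n => by
    rw [modeSum_eq]
    refine Commute.sum_right _ _ _ fun i _ => ?_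
    change _ * (_ * _) = _ * _ * _
    rw [← mul_assoc, energyOp_modeAction, add_mul, mul_assoc, energyOp_modeAction, mul_add,
      mul_smul_comm, smul_mul_assoc, mul_assoc]
    push_cast
    module
  refine LinearMap.ext fun v => ?_
  obtain ⟨L, h1, h2⟩ := ((eventually_normalSquare b hpos (energyOp K H v)).and
    (eventually_normalSquare b hpos v)).exists
  rw [Module.End.mul_apply, Module.End.mul_apply, h1, h2, map_sum]
  refine Finset.sum_congr rfl fun n _ => ?_
  rw [map_smul]
  congr 1
  exact LinearMap.congr_fun (hn n) v

end Commutator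

/-- An operator that commutes with an irreducible representation and has an eigenvector is a
scalar. -/
theorem eq_smul_one_of_commute {L M : Type*} [LieRing L] [LieAlgebra ℂ L] [AddCommGroup M]
    [Module ℂ M] [LieRingModule L M] [LieModule ℂ L M] (hirr : LieModule.IsIrreducible ℂ L M)
    {T : Module.End ℂ M} (hT : ∀ (x : L) (v : M), T ⁅x, v⁆ = ⁅x, T v⁆) {v : M} (hv : v ≠ 0) {κ : ℂ}
    (hκ : T v = κ • v) : T = κ • 1 := by
  let N : LieSubmodule ℂ L M :=
    { Module.End.eigenspace T κ with
      lie_mem := fun {x w} hw => by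
        change ⁅x, w⁆ ∈ Module.End.eigenspace T κ
        rw [Module.End.mem_eigenspace_iff, hT, Module.End.mem_eigenspace_iff.mp hw, lie_smul] }
  have hN : N = ⊤ := by
    refine (hirr.eq_bot_or_eq_top N).resolve_left fun h => hv ?_
    have : v ∈ N := Module.End.mem_eigenspace_iff.mpr hκ
    rw [h] at this
    simpa using this
  refine LinearMap.ext fun w => ?_
  have : w ∈ N := by rw [hN]; trivial
  exact Module.End.mem_eigenspace_iff.mp this

/-! ### Evaluation on extremal vectors and the scalar formulas -/

section Final

variable {g : Type*} [LieRing g] [LieAlgebra ℝ g] {K : InvariantInnerProduct g}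
  {ι : Type*} [Fintype ι] (b : Module.Basis ι ℝ g) (hb : K.IsOrthonormal b)
  {t : LieSubalgebra ℝ g} {P : Finset (Module.Dual ℝ t)}

theorem sum_lie_lie_of_adjoint_casimir {c : ℝ}
    (hc : quadraticCasimir ℝ (fun i => LieAlgebra.ad ℝ g (b i)) = c • 1) (X : Complexified g) :
    ∑ i, ⁅toC (b i), ⁅toC (b i), X⁆⁆ = -(2 * (c : ℂ)) • X := by
  have hr : ∀ Y, ∑ i, ⁅b i, ⁅b i, Y⁆⁆ = (-(2 * c)) • Y := fun Y => by
    have := LinearMap.congr_fun hc Y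
    simp only [quadraticCasimir, LinearMap.smul_apply, LinearMap.sum_apply, Module.End.mul_apply,
      LieAlgebra.ad_apply, Module.End.one_apply] at this
    rw [neg_smul, mul_smul, ← this, smul_smul]
    norm_num
  obtain ⟨A, B, rfl⟩ := exists_eq_toC_add X
  simp only [lie_add, lie_smul, ← toC_lie, Finset.sum_add_distrib, ← Finset.smul_sum]
  rw [← toC_sum, ← toC_sum, hr, hr, toC_smul, toC_smul]
  push_cast
  module

section Affine

variable {H : Type*} [AddCommGroup H] [Module ℂ H] [LieRingModule (Extended K) H]
  [LieModule ℂ (Extended K) H]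

/-- Root vectors of the extended loop algebra shift the weights. -/
theorem modeAction_eq_zero_or_isAffineWeight {v : H} {m h : ℝ} {μ α : Module.Dual ℝ t}
    (h1 : ⁅rotation K, v⁆ = (Complex.I * (m : ℂ)) • v)
    (h2 : ∀ X : t, ⁅ofLoop K (mono 0 (toC (X : g))), v⁆ = (Complex.I * (μ X : ℂ)) • v)
    (h3 : ⁅central K, v⁆ = (Complex.I * (h : ℂ)) • v) (n : ℤ) {E : Complexified g}
    (hE : IsWeightVector t α E) :
    modeAction K H n E v = 0 ∨ IsAffineWeight K t H (m + n, μ + α, h) := by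
  refine or_iff_not_imp_left.mpr fun hne => ⟨_, hne, ?_, fun X => ?_, ?_⟩
  · have := LinearMap.congr_fun (energyOp_modeAction (K := K) (H := H) n E) v
    simp only [Module.End.mul_apply, LinearMap.add_apply, LinearMap.smul_apply] at this
    refine this.trans ?_
    rw [show energyOp K H v = _ from h1, map_smul, ← add_smul]
    push_cast
    ring_nf
  · have := LinearMap.congr_fun
      (modeAction_mul_sub_mul (K := K) (H := H) 0 n (toC (X : g)) E) v
    simp only [LinearMap.sub_apply, Module.End.mul_apply, LinearMap.add_apply,
      LinearMap.smul_apply] at this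
    have h0 : (if (0 : ℤ) + n = 0 then Complex.I * n * formC K (toC (X : g)) E else 0) = 0 := by
      split_ifs with hn
      · rw [zero_add] at hn
        simp [hn]
      · rfl
    rw [h0, zero_smul, add_zero, zero_add, hE X, map_smul, LinearMap.smul_apply,
      show modeAction K H 0 (toC (X : g)) v = _ from h2 X, map_smul, sub_eq_iff_eq_add,
      ← add_smul] at this
    refine this.trans ?_
    rw [LinearMap.add_apply]
    push_cast
    ring_nf
  · have := LinearMap.congr_fun (centralOp_commute (K := K) (H := H) (ofLoop K (mono n E))) v
    refine this.trans ?_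
    rw [Module.End.mul_apply, show centralOp K H v = _ from h3, map_smul]
    rfl

/-- In each term with `n > 0` the right factor is a negative mode. -/
theorem normalSquare_apply_of_annihilated (hpos : IsPositiveEnergy K H) {v : H}
    (hv : ∀ n : ℤ, n < 0 → ∀ X, modeAction K H n X v = 0) :
    normalSquare b hpos v =
      ∑ i, modeAction K H 0 (toC (b i)) (modeAction K H 0 (toC (b i)) v) := by
  obtain ⟨L, hL⟩ := (eventually_normalSquare b hpos v).exists
  rw [hL, Finset.sum_eq_single 0]
  · rw [modeWeight, if_pos rfl, one_smul, modeSum_eq, LinearMap.sum_apply]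
    rfl
  · intro n _ hn
    rw [modeWeight, if_neg hn]
    split_ifs with h
    · rw [modeSum_eq, LinearMap.sum_apply, Finset.sum_eq_zero, smul_zero]
      intro i _
      rw [Module.End.mul_apply, hv _ (by omega), map_zero]
    · rw [zero_smul]
  · intro h
    exact absurd (Finset.mem_Icc.mpr ⟨by omega, by omega⟩) h

variable [FiniteDimensional ℝ g]
include hb

/-- A lowest weight vector is killed by all negative modes and by the constant root vectors of
weight in `-P`. The finite-dimensional computation then applies with weight `-λ` and positive system
`-P`; the two signs cancel. -/
theorem normalSquare_apply_lowestWeight (hpos : IsPositiveEnergy K H) (ht : IsMaximalAbelian t)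
    (hP : IsPositiveSystem t P) {m h : ℝ} {lam : Module.Dual ℝ t}
    (hlow : ∀ α, IsPositiveAffineRoot t P α → ¬ IsAffineWeight K t H ((m, -lam, h) - α)) {v : H}
    (h1 : ⁅rotation K, v⁆ = (Complex.I * (m : ℂ)) • v)
    (h2 : ∀ X : t, ⁅ofLoop K (mono 0 (toC (X : g))), v⁆ = (Complex.I * ((-lam) X : ℂ)) • v)
    (h3 : ⁅central K, v⁆ = (Complex.I * (h : ℂ)) • v) :
    normalSquare b hpos v =
      ((-(weightInner K t lam lam + weightInner K t lam (∑ α ∈ P, α)) : ℝ) : ℂ) • v := by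
  classical
  have hshift : ∀ (n : ℤ) (α : Module.Dual ℝ t) (E : Complexified g), IsWeightVector t α E →
      IsPositiveAffineRoot t P (((-n : ℤ) : ℝ), -α, 0) → modeAction K H n E v = 0 :=
    fun n α E hE hr => by
      refine (modeAction_eq_zero_or_isAffineWeight h1 h2 h3 n hE).resolve_right fun hw =>
        hlow _ hr ?_
      convert hw using 1
      simp
  have hcast : ∀ n : ℤ, n < 0 → ((-n : ℤ) : ℝ) = ((-n).toNat : ℝ) := fun n hn => by
    have : (((-n).toNat : ℤ) : ℝ) = ((-n : ℤ) : ℝ) := by rw [Int.toNat_of_nonneg (by omega)]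
    rw [← this, Int.cast_natCast]
  have hneg : ∀ α, IsRoot t α → IsRoot t (-α) := fun α hα => by
    rw [hP.root_iff] at hα ⊢
    rw [neg_neg]
    exact hα.symm
  have hann : ∀ n : ℤ, n < 0 → ∀ X, modeAction K H n X v = 0 := fun n hn X => by
    induction X using root_induction K ht with
    | zero => simp
    | add Z W hZ hW => rw [map_add, LinearMap.add_apply, hZ, hW, add_zero]
    | cartan a X =>
      rw [map_smul, LinearMap.smul_apply, hshift n 0, smul_zero]
      · intro Y
        rw [← toC_lie, ← LieSubalgebra.coe_bracket, ht.prop.trivial]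
        simp
      · rw [hcast n hn, neg_zero]
        exact IsPositiveAffineRoot.imaginary _ (by omega)
    | root α hα E hE =>
      refine hshift n α E hE ?_
      rw [hcast n hn]
      exact IsPositiveAffineRoot.real _ (by omega) _ (hneg α hα)
  rw [normalSquare_apply_of_annihilated b hpos hann]
  have hmem : ∀ α : Module.Dual ℝ t, α ∈ P.image (fun β => -β) ↔ -α ∈ P := fun α => by
    rw [Finset.mem_image]
    constructor
    · rintro ⟨β, hβ, rfl⟩
      rwa [neg_neg]
    · intro hα
      exact ⟨-α, hα, neg_neg α⟩
  -- Only the partition of the roots into `P` and `-P` is required, and it is symmetric under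
  -- negation.
  have key := sum_sq_apply_extremal K b hb ht (P := P.image fun β => -β)
    (fun α => by rw [hP.root_iff, hmem, hmem, neg_neg, or_comm])
    (fun α hα => by
      rw [hmem] at hα ⊢
      exact hP.neg_notMem _ hα) (modeAction K H 0)
    (fun X Y => by simp [modeAction_mul_sub_mul]) (v := v) (μ := -lam) h2
    (fun α hα E hE => by
      refine hshift 0 α E hE ?_
      rw [neg_zero, Int.cast_zero]
      exact IsPositiveAffineRoot.constant _ ((hmem α).mp hα))
  rw [key, Finset.sum_image (fun _ _ _ _ h => neg_injective h), Finset.sum_neg_distrib]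
  congr 3
  have hnn : ∀ μ ν : Module.Dual ℝ t, weightInner K t (-μ) (-ν) = weightInner K t μ ν :=
    fun μ ν => by simp only [weightInner, map_neg, LinearMap.neg_apply, neg_neg]
  rw [hnn, hnn]

/-- The Casimir operator of the loop algebra in an irreducible positive energy representation. -/
theorem normalSquare_eq (hirr : LieModule.IsIrreducible ℂ (Extended K) H)
    (hpos : IsPositiveEnergy K H) (ht : IsMaximalAbelian t) (hP : IsPositiveSystem t P) {m h c : ℝ}
    (hc : quadraticCasimir ℝ (fun i => LieAlgebra.ad ℝ g (b i)) = c • 1)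
    {lam : Module.Dual ℝ t} (hlow : IsLowestWeight K t P H (m, -lam, h)) :
    -(1 / 2 : ℂ) • normalSquare b hpos = -(Complex.I * (h + c)) • energyOp K H +
      ((1 / 2 * (weightInner K t lam lam + weightInner K t lam (∑ α ∈ P, α)) - (h + c) * m : ℝ) : ℂ)
        • 1 := by
  obtain ⟨⟨v, hv, h1, h2, h3⟩, hlow⟩ := hlow
  have hΩ := normalSquare_apply_lowestWeight b hb hpos ht hP hlow h1 h2 h3
  have hcen : centralOp K H = (Complex.I * (h : ℂ)) • 1 :=
    eq_smul_one_of_commute hirr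
      (fun x w => LinearMap.congr_fun (centralOp_commute (K := K) (H := H) x) w) hv h3
  -- The energy term is chosen to cancel the commutator: `-½ Ω` contributes `(h + c) m r(X z^m)`,
  -- and `i (h + c) r(∂_θ)` contributes `i (h + c) · i m r(X z^m)`.
  obtain ⟨T, hTdef⟩ : ∃ T : Module.End ℂ H,
    T = -(1 / 2 : ℂ) • normalSquare b hpos + (Complex.I * (h + c)) • energyOp K H := ⟨_, rfl⟩
  have hmode : ∀ n X, T * modeAction K H n X = modeAction K H n X * T := fun n X => by
    have e1 := normalSquare_commutator b hb hpos (sum_lie_lie_of_adjoint_casimir b hc) n X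
    rw [hcen, mul_smul_comm, mul_one, sub_eq_iff_eq_add] at e1
    rw [hTdef, add_mul, mul_add (modeAction K H n X), smul_mul_assoc, smul_mul_assoc, e1,
      energyOp_modeAction, mul_smul_comm, mul_smul_comm]
    have hI : (Complex.I * (h + c)) • ((Complex.I * n) • modeAction K H n X) =
        (-(h + c) * n : ℂ) • modeAction K H n X := by
      rw [smul_smul]
      congr 1
      linear_combination ((h + c) * n : ℂ) * Complex.I_mul_I
    have hI' : (2 * Complex.I * n) • ((Complex.I * h) • modeAction K H n X) =
        (-2 * h * n : ℂ) • modeAction K H n X := by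
      rw [smul_smul]
      congr 1
      linear_combination (2 * h * n : ℂ) * Complex.I_mul_I
    rw [smul_add (Complex.I * ((h : ℂ) + c)), hI, hI']
    module
  have hloop : ∀ ξ w, T (loopAction K H ξ w) = loopAction K H ξ (T w) := fun ξ w => by
    induction ξ using loop_induction with
    | zero => simp
    | add ξ η hξ hη => rw [map_add, LinearMap.add_apply, LinearMap.add_apply, map_add, hξ, hη]
    | hmono n X => exact LinearMap.congr_fun (hmode n X) w
  have hrot : ∀ w, T (energyOp K H w) = energyOp K H (T w) := fun w => by
    have hcomm : Commute (energyOp K H) T := hTdef ▸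
      ((energyOp_commute_normalSquare b hpos).smul_right _).add_right
        ((Commute.refl (energyOp K H)).smul_right _)
    exact (LinearMap.congr_fun hcomm w).symm
  have hT := eq_smul_one_of_commute hirr (T := T) (v := v)
    (κ := ((1 / 2 * (weightInner K t lam lam + weightInner K t lam (∑ α ∈ P, α)) -
      (h + c) * m : ℝ) : ℂ)) (fun x w => by
      have hx : ∀ u : H, ⁅x, u⁆ = x.rot • energyOp K H u + loopAction K H x.loop u +
          x.cen • centralOp K H u := fun u => by
        conv_lhs => rw [extended_eq x, add_lie, add_lie, smul_lie, smul_lie]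
        rfl
      rw [hx, hx, map_add, map_add, map_smul, map_smul, hrot, hloop, hcen]
      simp only [LinearMap.smul_apply, Module.End.one_apply, map_smul]) hv (by
      rw [hTdef, LinearMap.add_apply, LinearMap.smul_apply, LinearMap.smul_apply, hΩ,
        show energyOp K H v = _ from h1, smul_smul, smul_smul, ← add_smul]
      congr 1
      push_cast
      linear_combination ((h + c) * m : ℂ) * Complex.I_mul_I)
  rw [← hT, hTdef]
  module

end Affine

variable [FiniteDimensional ℝ g]
include hb

/-- The Casimir operator of `g` in an irreducible highest weight representation. -/
theorem quadraticCasimir_eq_of_isHighestWeight (ht : IsMaximalAbelian t)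
    (hP : IsPositiveSystem t P) {V : Type*} [AddCommGroup V] [Module ℂ V]
    [LieRingModule (Complexified g) V] [LieModule ℂ (Complexified g) V]
    (hirr : LieModule.IsIrreducible ℂ (Complexified g) V) {lam : Module.Dual ℝ t}
    (hV : IsHighestWeight t P V lam) :
    quadraticCasimir ℂ (fun i => LieModule.toEnd ℂ (Complexified g) V (toC (b i))) =
      ((1 / 2 * (weightInner K t lam lam + weightInner K t lam (∑ α ∈ P, α)) : ℝ) : ℂ) • 1 := by
  obtain ⟨⟨v, hv, hw⟩, hmax⟩ := hV
  let π : Complexified g →ₗ[ℂ] Module.End ℂ V := (LieModule.toEnd ℂ (Complexified g) V : _ →ₗ[ℂ] _)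
  have hπ : ∀ X w, π X w = ⁅X, w⁆ := fun X w => rfl
  have key := sum_sq_apply_extremal K b hb ht hP.root_iff hP.neg_notMem π
    (fun X Y => LinearMap.ext fun w => lie_lie X Y w) (v := v) (μ := lam) hw
    -- Otherwise `E v` would be a vector of the excluded weight `λ + α`.
    (fun α hα E hE => by
      by_contra hne
      refine hmax α hα ⟨π E v, hne, fun X => ?_⟩
      rw [hπ, leibniz_lie, hE X, hw X, smul_lie, lie_smul, ← add_smul, LinearMap.add_apply]
      push_cast
      ring_nf)
  have happ : ∀ w, quadraticCasimir ℂ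
      (fun i => LieModule.toEnd ℂ (Complexified g) V (toC (b i))) w =
        -(1 / 2 : ℂ) • ∑ i, π (toC (b i)) (π (toC (b i)) w) := fun w => by
    rw [quadraticCasimir, LinearMap.smul_apply, LinearMap.sum_apply]
    rfl
  refine eq_smul_one_of_commute hirr (fun X w => ?_) hv ?_
  · rw [happ, happ, lie_smul, lie_sum]
    congr 1
    have h := sum_lie_tmul K b hb X
      (((LinearMap.mul ℂ (Module.End ℂ V)).compl₁₂ π π).compr₂ (LinearMap.applyₗ w))
    have h1 : ∑ i, ⁅⁅X, toC (b i)⁆, ⁅toC (b i), w⁆⁆ = -∑ i, ⁅toC (b i), ⁅⁅X, toC (b i)⁆, w⁆⁆ := h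
    have h2 : ∀ i, ⁅X, ⁅toC (b i), ⁅toC (b i), w⁆⁆⁆ = ⁅⁅X, toC (b i)⁆, ⁅toC (b i), w⁆⁆ +
        ⁅toC (b i), ⁅⁅X, toC (b i)⁆, w⁆⁆ + ⁅toC (b i), ⁅toC (b i), ⁅X, w⁆⁆⁆ := fun i => by
      rw [leibniz_lie X (toC (b i)), leibniz_lie X (toC (b i)) w, lie_add]
      abel
    simp only [hπ, h2, Finset.sum_add_distrib, h1]
    abel
  · rw [happ, key, smul_smul]
    congr 1
    push_cast
    ring

end Final

/-- The shifted weight is `(m, -(λ + ρ), h + c)`, of square `‖λ + ρ‖² - 2 m (h + c)`. The vector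
`(0, ρ, -c)` has energy zero, so its square is just `‖ρ‖²`. -/
theorem affineInner_shift {g : Type*} [LieRing g] [LieAlgebra ℝ g]
    [FiniteDimensional ℝ g] (K : InvariantInnerProduct g) (t : LieSubalgebra ℝ g)
    (P : Finset (Module.Dual ℝ t)) (m h c : ℝ) (lam : Module.Dual ℝ t) :
    1 / 2 * (affineInner K t
        ((m, -lam, h) - (0, rho t P, -c))
        ((m, -lam, h) - (0, rho t P, -c)) -
      affineInner K t
        (0, rho t P, -c) (0, rho t P, -c)) =
    1 / 2 * (weightInner K t lam lam +
      weightInner K t lam (∑ α ∈ P, α)) - (h + c) * m := by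
  have hsum : ∑ α ∈ P, α = rho t P + rho t P := by
    rw [rho, ← add_smul]
    norm_num
  have hneg : ∀ μ ν : Module.Dual ℝ t, weightInner K t (-μ) (-ν) =
      weightInner K t μ ν :=
    fun μ ν => by simp only [weightInner, map_neg, LinearMap.neg_apply, neg_neg]
  have hadd : ∀ μ μ' ν : Module.Dual ℝ t, weightInner K t (μ + μ') ν =
      weightInner K t μ ν + weightInner K t μ' ν := fun _ _ _ => rfl
  have hs : -lam - rho t P = -(lam + rho t P) := by abel
  rw [hsum]
  simp only [affineInner, Prod.mk_sub_mk, hs, hneg, hadd,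
    weightInner_add_right, weightInner_symm K (rho t P) lam]
  ring

end

end LoopCasimir

/-! ### The main theorem -/

theorem mainTheorem4
    {g : Type*} [LieRing g] [LieAlgebra ℝ g] [FiniteDimensional ℝ g] [LieAlgebra.IsSimple ℝ g]
    (K : LoopCasimir.InvariantInnerProduct g)
    {ι : Type*} [Fintype ι] (b : Module.Basis ι ℝ g) (hb : K.IsOrthonormal b)
    (t : LieSubalgebra ℝ g) (ht : LoopCasimir.IsMaximalAbelian t)
    (P : Finset (Module.Dual ℝ t)) (hP : LoopCasimir.IsPositiveSystem t P)
    (Sg : Type*) [AddCommGroup Sg] [Module ℂ Sg]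
    [Module (CliffordAlgebra (LoopCasimir.formQ K)) Sg]
    [IsScalarTower ℂ (CliffordAlgebra (LoopCasimir.formQ K)) Sg]
    [IsSimpleModule (CliffordAlgebra (LoopCasimir.formQ K)) Sg]
    (H : Type*) [AddCommGroup H] [Module ℂ H] [LieRingModule (LoopCasimir.Extended K) H]
    [LieModule ℂ (LoopCasimir.Extended K) H]
    (hirr : LieModule.IsIrreducible ℂ (LoopCasimir.Extended K) H)
    (hpos : LoopCasimir.IsPositiveEnergy K H)
    (m h : ℝ) (lam : Module.Dual ℝ t)
    (hlow : LoopCasimir.IsLowestWeight K t P H (m, -lam, h)) :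
    ∃ c : ℝ,
      LoopCasimir.quadraticCasimir ℝ (fun i => LieAlgebra.ad ℝ g (b i)) = c • 1 ∧
      (∃! Δ : Module.End ℂ H, LoopCasimir.IsLoopCasimir K Sg b Δ) ∧
      ∀ Δ : Module.End ℂ H, LoopCasimir.IsLoopCasimir K Sg b Δ →
        (∀ (V : Type*) [AddCommGroup V] [Module ℂ V] [LieRingModule (LoopCasimir.Complexified g) V]
          [LieModule ℂ (LoopCasimir.Complexified g) V],
          LieModule.IsIrreducible ℂ (LoopCasimir.Complexified g) V →
          LoopCasimir.IsHighestWeight t P V lam →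
          ∃ d : ℝ,
            LoopCasimir.quadraticCasimir ℂ (fun i =>
              LieModule.toEnd ℂ (LoopCasimir.Complexified g) V (LoopCasimir.toC (b i))) =
                (d : ℂ) • 1 ∧
            Δ = -(Complex.I * (h + c)) • (LoopCasimir.energyOp K H - (Complex.I * m) • 1) +
              (d : ℂ) • 1) ∧
        Δ = -(Complex.I * (h + c)) • LoopCasimir.energyOp K H +
          ((1 / 2 * (LoopCasimir.affineInner K t
                ((m, -lam, h) - (0, LoopCasimir.rho t P, -c))
                ((m, -lam, h) - (0, LoopCasimir.rho t P, -c)) -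
              LoopCasimir.affineInner K t
                (0, LoopCasimir.rho t P, -c) (0, LoopCasimir.rho t P, -c)) : ℝ) : ℂ) • 1 := by
  obtain ⟨c, hc⟩ := LoopCasimir.exists_adjoint_casimir K b hb
  have hiff := LoopCasimir.isLoopCasimir_iff (K := K) (H := H) Sg b hb hpos
  have hΔ := LoopCasimir.normalSquare_eq b hb hirr hpos ht hP hc hlow
  refine ⟨c, hc, ⟨_, (hiff _).mpr rfl, fun Δ h' => (hiff Δ).mp h'⟩, fun Δ h' => ⟨?_, ?_⟩⟩
  · intro V _ _ _ _ hV hlam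
    refine ⟨_, LoopCasimir.quadraticCasimir_eq_of_isHighestWeight b hb ht hP hV hlam, ?_⟩
    rw [(hiff Δ).mp h', hΔ, smul_sub, smul_smul,
      sub_eq_add_neg (-(Complex.I * (h + c)) • LoopCasimir.energyOp K H), ← neg_smul, add_assoc,
      ← add_smul]
    -- The constant `-(h + c) m` is exactly `-i (h + c) · (-i m)`, absorbed by measuring energy from
    -- the lowest weight.
    congr 2
    push_cast
    linear_combination (-(h + c) * m : ℂ) * Complex.I_mul_I
  · rw [(hiff Δ).mp h', hΔ, LoopCasimir.affineInner_shift]
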